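/- Let $m\ge 1$, let $\vec h\in\mathbb R^m$, and let $(\vec\beta_p)_{p\ge 2}$ be vectors in $\mathbb R^m$ with $\vec\beta_p=0$ for odd $p$ and $\sum_{p\ge2}2^p\vec\beta_p(j)^2<\infty$ for every $j$. For a symmetric matrix $A$ with entries in $[-1,1]$ put $\xi'(A)=\sum_{p\ge 2}p\,(\vec\beta_p\otimes\vec\beta_p)\odot A^{\circ(p-1)}$ (entrywise products and powers), and let $\langle A,B\rangle=\sum_{i,j}A_{ij}B_{ij}$. Let $Q$ be a symmetric positive semidefinite $m\times m$ matrix with entries in $[-1,1]$ and unit diagonal. Consider pairs $(\mu,\Phi)$ in which $\mu$ is a Borel probability measure on $[0,m]$, with distribution function $x(t)=\mu([0,t])$ and $t_x=\inf\{t\in[0,m]:x(t)=1\}$, and $\Phi$ is a continuously differentiable path on $[0,m]$ of positive semidefinite $m\times m$ matrices, monotone in the positive semidefinite order, Lipschitz with Lipschitz derivative, with $\Phi(0)=0$, $\Phi(m)=Q$ and $\operatorname{Trace}\Phi(t)=t$ for all $t\in\operatorname{supp}\mu$. Call the pair admissible if moreover $t_x<m$ and $|Q-\Phi(t_x)|>0$,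 where $|\cdot|$ denotes the determinant. The Crisanti–Sommers functional of an admissible pair is $$\mathscr C(\mu,\Phi)=\frac12\Big[\int_0^m x(t)\big\langle\xi'(\Phi(t))+\vec h\vec h^T,\Phi'(t)\big\rangle\,dt+\log|\Phi(m)-\Phi(\hat T)|+\int_0^{\hat T}\big\langle\hat\Phi(t)^{-1},\Phi'(t)\big\rangle\,dt\Big],\qquad \hat\Phi(t)=\int_t^m x(s)\Phi'(s)\,ds,$$ where $\hat T\in(t_x,m)$ is any point with $|Q-\Phi(\hat T)|>0$ (the value does not depend on the choice). Let $(\mu_P,\Phi)$ minimize $\mathscr C$ over all admissible pairs. Suppose that there are a strictly increasing sequence $(u_l^-)_l$ and a strictly decreasing sequence $(u_l^+)_l$ of points of $\operatorname{supp}\mu_P$ with $\lim_l u_l^-=u_0=\lim_l u_l^+$. Then $\mu_P$ is continuous at $u_0$: the distribution function $t\mapsto\mu_P([0,t])$ is continuous at $u_0$, and $\mu_P(\{u_0\})=0$. -/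

import Mathlib

open MeasureTheory Set Filter Topology

namespace VectorSpin

noncomputable section

/-- Frobenius inner product `⟨A, B⟩ = ∑ᵢⱼ Aᵢⱼ Bᵢⱼ`. -/
def frob {m : ℕ} (A B : Matrix (Fin m) (Fin m) ℝ) : ℝ :=
  ∑ i, ∑ j, A i j * B i j

/-- Self-overlap constraints: symmetric positive semidefinite matrices with entries in `[-1, 1]`
and unit diagonal. -/
structure IsConstraint {m : ℕ} (Q : Matrix (Fin m) (Fin m) ℝ) : Prop where
  posSemidef : Q.PosSemidef
  entries : ∀ i j, Q i j ∈ Icc (-1 : ℝ) 1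
  diag : ∀ i, Q i i = 1

/-- Inverse temperatures `(β_p)_{p ≥ 2}` of a mixed even `p`-spin model with `m` copies; only the
values at `p ≥ 2` are used. -/
structure IsEvenMixture {m : ℕ} (β : ℕ → Fin m → ℝ) : Prop where
  even : ∀ p, 3 ≤ p → Odd p → ∀ j, β p j = 0
  summable : ∀ j, Summable fun p : ℕ => (2 : ℝ) ^ p * β p j ^ 2

/-- The matrix `ξ'(A) = ∑_{p ≥ 2} p (β_p ⊗ β_p) ⊙ A^{∘(p-1)}`; the summation index is `p - 2`. -/
def xiDeriv {m : ℕ} (β : ℕ → Fin m → ℝ) (A : Matrix (Fin m) (Fin m) ℝ) :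
    Matrix (Fin m) (Fin m) ℝ :=
  Matrix.of fun i j => ∑' p : ℕ, ((p : ℝ) + 2) * (β (p + 2) i * β (p + 2) j) * A i j ^ (p + 1)

/-- The distribution function `x(t) = μ([0, t])`. -/
def distFun (μ : Measure ℝ) (t : ℝ) : ℝ := μ.real (Icc 0 t)

/-- `t_x = inf {t ∈ [0, m] | x(t) = 1}`. -/
def topPoint (m : ℕ) (μ : Measure ℝ) : ℝ := sInf {t | t ∈ Icc (0 : ℝ) m ∧ distFun μ t = 1}

/-- The entrywise derivative `Φ'(t)` of a matrix path on `[0, m]` (one-sided at the end points). -/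
def pathDeriv {m : ℕ} (Φ : ℝ → Matrix (Fin m) (Fin m) ℝ) (t : ℝ) :
    Matrix (Fin m) (Fin m) ℝ :=
  Matrix.of fun i j => derivWithin (fun s => Φ s i j) (Icc (0 : ℝ) m) t

/-- `Φ̂(t) = ∫_t^m x(s) Φ'(s) ds`. -/
def hatPath {m : ℕ} (μ : Measure ℝ) (Φ : ℝ → Matrix (Fin m) (Fin m) ℝ) (t : ℝ) :
    Matrix (Fin m) (Fin m) ℝ :=
  Matrix.of fun i j => ∫ s in t..(m : ℝ), distFun μ s * pathDeriv Φ s i j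

/-- The Crisanti–Sommers functional with cut-off `T`. -/
def crisantiSommers {m : ℕ} (β : ℕ → Fin m → ℝ) (h : Fin m → ℝ) (μ : Measure ℝ)
    (Φ : ℝ → Matrix (Fin m) (Fin m) ℝ) (T : ℝ) : ℝ :=
  (1 / 2) *
    ((∫ t in (0 : ℝ)..(m : ℝ),
        distFun μ t * frob (xiDeriv β (Φ t) + Matrix.vecMulVec h h) (pathDeriv Φ t))
      + Real.log (Φ m - Φ T).det
      + ∫ t in (0 : ℝ)..T, frob (hatPath μ Φ t)⁻¹ (pathDeriv Φ t))

/-- Continuously differentiable monotone paths of positive semidefinite matrices from `0` to `Q`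
on `[0, m]`, Lipschitz with Lipschitz derivative, whose trace is `t` at every point `t` of the
support of `μ`. -/
structure IsRegularPath {m : ℕ} (Q : Matrix (Fin m) (Fin m) ℝ) (μ : Measure ℝ)
    (Φ : ℝ → Matrix (Fin m) (Fin m) ℝ) : Prop where
  posSemidef : ∀ t ∈ Icc (0 : ℝ) m, (Φ t).PosSemidef
  monotone : ∀ s ∈ Icc (0 : ℝ) m, ∀ t ∈ Icc (0 : ℝ) m, s ≤ t → (Φ t - Φ s).PosSemidef
  start : Φ 0 = 0
  finish : Φ m = Q
  differentiable : ∀ i j, DifferentiableOn ℝ (fun t => Φ t i j) (Icc (0 : ℝ) m)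
  lipschitz : ∃ K : NNReal, ∀ i j, LipschitzOnWith K (fun t => Φ t i j) (Icc (0 : ℝ) m)
  lipschitz_deriv :
    ∃ K : NNReal, ∀ i j, LipschitzOnWith K (fun t => pathDeriv Φ t i j) (Icc (0 : ℝ) m)
  trace_eq : ∀ t ∈ μ.support, (Φ t).trace = t

/-- Pairs on which the functional is defined: `μ` is a probability measure on `[0, m]`, `Φ` is a
regular path for `μ`, `t_x < m` and `|Q - Φ(t_x)| > 0`. -/
structure IsAdmissible {m : ℕ} (Q : Matrix (Fin m) (Fin m) ℝ) (μ : Measure ℝ)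
    (Φ : ℝ → Matrix (Fin m) (Fin m) ℝ) : Prop where
  prob : IsProbabilityMeasure μ
  concentrated : μ (Icc (0 : ℝ) m)ᶜ = 0
  path : IsRegularPath Q μ Φ
  top_lt : topPoint m μ < m
  det_pos : 0 < (Q - Φ (topPoint m μ)).det

/-- Cut-offs `t_x < T < m` with `|Q - Φ(T)| > 0`. The value of the functional is the same for all
of them. -/
def IsCutoff {m : ℕ} (Q : Matrix (Fin m) (Fin m) ℝ) (μ : Measure ℝ)
    (Φ : ℝ → Matrix (Fin m) (Fin m) ℝ) (T : ℝ) : Prop :=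
  topPoint m μ < T ∧ T < m ∧ 0 < (Q - Φ T).det

/-- `(μ, Φ)` minimizes the Crisanti–Sommers functional over all admissible pairs. -/
def IsCSMinimizer {m : ℕ} (β : ℕ → Fin m → ℝ) (h : Fin m → ℝ) (Q : Matrix (Fin m) (Fin m) ℝ)
    (μ : Measure ℝ) (Φ : ℝ → Matrix (Fin m) (Fin m) ℝ) : Prop :=
  IsAdmissible Q μ Φ ∧
    ∀ (ν : Measure ℝ) (Ψ : ℝ → Matrix (Fin m) (Fin m) ℝ), IsAdmissible Q ν Ψ →
      ∀ T S : ℝ, IsCutoff Q μ Φ T → IsCutoff Q ν Ψ S →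
        crisantiSommers β h μ Φ T ≤ crisantiSommers β h ν Ψ S

end

end VectorSpin

/-! The trace constraint can be dropped when varying the path. If `P + ε η` has trace `t + ε κ(t)`
on the support, the time change `t ↦ t + ε κ(t)` restores the constraint, and the functional does
not see the parametrization (`exists_admissible_of_timeChange`). A minimizer can therefore be varied
in all directions that keep the path increasing. The first variation in direction `η` is, up to a
positive factor, `-∫ ⟨F, η⟩ dμ` with `F = ξ'(P) + h hᵀ - ∫₀ᵗ P̂⁻¹ P' P̂⁻¹`
(`tendsto_reduced_quotient`). Put `Λ(t) = -∫_{(t,∞)} F dμ`. Steps in direction `v vᵀ` and the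
direction `η = -P` yield the conditions `Λ(t) ≥ 0` and `⟨Λ(t), P'(t)⟩ = 0` (`posSemidef_multiplier`,
`frob_multiplier_eq_zero`).

Suppose that `u` carries an atom of mass `a > 0`, and let `D = P'(u)`. Then `Λ(u)` and `Λ(u-) = Λ(u)
- a F(u)` are both positive semidefinite and orthogonal to `D`, so `⟨F(u), D⟩ = 0`. On each side of
`u`, where the accumulating support supplies mass, `Λ` leaves its one-sided limit along `± F(u)`.
The atom makes this direction two-sided, so it vanishes on the kernel of the limit and small steps
along it preserve positivity. Complementarity then leaves `⟨F'(u), P'(t)⟩ ≤ o(|t - u|)`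
(`eventually_frob_le_of_side`).

Now `F'(t) = L_t(P'(t))` with `L_t` symmetric, so `⟨F'(t), D⟩ = ⟨L_t(D), P'(t)⟩`: only `L_t` has to
be differentiated, not the merely Lipschitz `P'`. With `Z = P̂(u)⁻¹`, the one-sided derivatives of
`⟨L_t(D), D⟩` at `u` are `T - 2 c K`, where `K = ⟨Z D Z D Z, D⟩`, `T` comes from `ξ'''`, and `c` is
`x(u)` on the right and `x(u-)` on the left. A negative value on the right, or a positive one on the
left, would make `⟨Λ(t), D⟩` negative nearby (`second_order_nonneg`). Hence `2 x(u) K ≤ T ≤ 2 x(u-)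
K`. The trace of `P` is the identity on a set accumulating at `u`, so `D` has trace one and `K > 0`.
Thus `x(u) ≤ x(u-)`, which excludes the atom. -/

namespace VectorSpin

/-! ### The Frobenius pairing on positive semidefinite matrices. -/

section LinearAlgebra

variable {m : ℕ}

lemma frob_eq_trace (A B : Matrix (Fin m) (Fin m) ℝ) : frob A B = (A.transpose * B).trace := by
  simp only [frob, Matrix.trace, Matrix.diag, Matrix.mul_apply, Matrix.transpose_apply]
  rw [Finset.sum_comm]

lemma frob_comm (A B : Matrix (Fin m) (Fin m) ℝ) : frob A B = frob B A := by
  simp only [frob, mul_comm]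

lemma frob_add_left (A A' B : Matrix (Fin m) (Fin m) ℝ) :
    frob (A + A') B = frob A B + frob A' B := by
  simp [frob, add_mul, Finset.sum_add_distrib]

lemma frob_sub_left (A A' B : Matrix (Fin m) (Fin m) ℝ) :
    frob (A - A') B = frob A B - frob A' B := by
  simp [frob, sub_mul, Finset.sum_sub_distrib]

lemma frob_neg_left (A B : Matrix (Fin m) (Fin m) ℝ) : frob (-A) B = -frob A B := by
  simp [frob]

lemma frob_smul_left (c : ℝ) (A B : Matrix (Fin m) (Fin m) ℝ) :
    frob (c • A) B = c * frob A B := by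
  simp [frob, Finset.mul_sum, mul_assoc]

lemma frob_add_right (A B B' : Matrix (Fin m) (Fin m) ℝ) :
    frob A (B + B') = frob A B + frob A B' := by
  simp [frob, mul_add, Finset.sum_add_distrib]

lemma frob_sub_right (A B B' : Matrix (Fin m) (Fin m) ℝ) :
    frob A (B - B') = frob A B - frob A B' := by
  simp [frob, mul_sub, Finset.sum_sub_distrib]

lemma frob_neg_right (A B : Matrix (Fin m) (Fin m) ℝ) : frob A (-B) = -frob A B := by
  simp [frob]

lemma frob_smul_right (c : ℝ) (A B : Matrix (Fin m) (Fin m) ℝ) :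
    frob A (c • B) = c * frob A B := by
  simp only [frob, Matrix.smul_apply, smul_eq_mul, Finset.mul_sum]
  exact Finset.sum_congr rfl fun i _ => Finset.sum_congr rfl fun j _ => by ring

lemma frob_vecMulVec (A : Matrix (Fin m) (Fin m) ℝ) (v : Fin m → ℝ) :
    frob A (Matrix.vecMulVec v v) = v ⬝ᵥ A.mulVec v := by
  simp only [frob, Matrix.vecMulVec_apply, dotProduct, Matrix.mulVec, Finset.mul_sum]
  exact Finset.sum_congr rfl fun i _ => Finset.sum_congr rfl fun j _ => by ring

lemma abs_frob_le {A B : Matrix (Fin m) (Fin m) ℝ} {a b : ℝ} (ha : 0 ≤ a)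
    (hA : ∀ i j, |A i j| ≤ a) (hB : ∀ i j, |B i j| ≤ b) : |frob A B| ≤ m ^ 2 * (a * b) := by
  calc |frob A B| ≤ ∑ i, ∑ j, |A i j * B i j| :=
        (Finset.abs_sum_le_sum_abs _ _).trans
          (Finset.sum_le_sum fun i _ => Finset.abs_sum_le_sum_abs _ _)
    _ ≤ ∑ _i : Fin m, ∑ _j : Fin m, a * b := by
        refine Finset.sum_le_sum fun i _ => Finset.sum_le_sum fun j _ => ?_
        rw [abs_mul]
        exact mul_le_mul (hA i j) (hB i j) (abs_nonneg _) ha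
    _ = m ^ 2 * (a * b) := by simp; ring

lemma posSemidef_iff_form {A : Matrix (Fin m) (Fin m) ℝ} :
    A.PosSemidef ↔ A.IsHermitian ∧ ∀ v : Fin m → ℝ, 0 ≤ v ⬝ᵥ A.mulVec v := by
  rw [Matrix.posSemidef_iff_dotProduct_mulVec]
  simp

lemma isHermitian_iff_apply {A : Matrix (Fin m) (Fin m) ℝ} :
    A.IsHermitian ↔ ∀ i j, A j i = A i j := by
  rw [Matrix.IsHermitian.ext_iff]; simp

lemma exists_eq_transpose_mul {A : Matrix (Fin m) (Fin m) ℝ} (hA : A.PosSemidef) :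
    ∃ C : Matrix (Fin m) (Fin m) ℝ, A = C.transpose * C := by
  open scoped MatrixOrder in
  obtain ⟨C, hC⟩ := CStarAlgebra.nonneg_iff_eq_star_mul_self.mp hA.nonneg
  exact ⟨C, by simpa [Matrix.star_eq_conjTranspose] using hC⟩

lemma frob_nonneg {A B : Matrix (Fin m) (Fin m) ℝ} (hA : A.PosSemidef) (hB : B.PosSemidef) :
    0 ≤ frob A B := by
  obtain ⟨C, rfl⟩ := exists_eq_transpose_mul hA
  have h := (hB.mul_mul_conjTranspose_same C).trace_nonneg
  rw [frob_eq_trace, Matrix.transpose_mul, Matrix.transpose_transpose, Matrix.mul_assoc,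
    Matrix.trace_mul_comm]
  simpa using h

lemma apply_comm_of_posSemidef {A : Matrix (Fin m) (Fin m) ℝ} (hA : A.PosSemidef)
    (i j : Fin m) : A j i = A i j := isHermitian_iff_apply.mp hA.1 i j

/-- Testing positivity on `eᵢ ± eⱼ` gives `|A i j| ≤ (A i i + A j j) / 2`. -/
lemma abs_apply_le_one {A Q : Matrix (Fin m) (Fin m) ℝ} (hA : A.PosSemidef)
    (hQA : (Q - A).PosSemidef) (hQ : ∀ i, Q i i = 1) (i j : Fin m) : |A i j| ≤ 1 := by
  have hd : ∀ i, A i i ≤ 1 := fun i => by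
    have := hQA.diag_nonneg (i := i)
    simp [hQ] at this; linarith
  have hs := apply_comm_of_posSemidef hA i j
  have key : ∀ c : ℝ, 0 ≤ A i i + c * A i j + c * A j i + c * c * A j j := fun c => by
    have := (posSemidef_iff_form.mp hA).2 (Pi.single i 1 + c • Pi.single j 1)
    simp [Matrix.mulVec_add, Matrix.mulVec_smul, add_dotProduct, dotProduct_add] at this
    linarith
  have h1 := key 1
  have h2 := key (-1)
  rw [abs_le]
  constructor <;> nlinarith [hd i, hd j]

lemma posDef_of_det_pos {A : Matrix (Fin m) (Fin m) ℝ} (hA : A.PosSemidef) (h : 0 < A.det) :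
    A.PosDef := by
  rw [hA.posDef_iff_isUnit, Matrix.isUnit_iff_isUnit_det]
  exact h.ne'.isUnit

lemma transpose_eq_of_isHermitian {M : Matrix (Fin m) (Fin m) ℝ} (hM : M.IsHermitian) :
    M.transpose = M := by
  rw [← Matrix.conjTranspose_eq_transpose_of_trivial]; exact hM

lemma dotProduct_mulVec_comm {M : Matrix (Fin m) (Fin m) ℝ} (hM : M.IsHermitian)
    (v w : Fin m → ℝ) : v ⬝ᵥ M.mulVec w = w ⬝ᵥ M.mulVec v := by
  have : M.transpose = M := transpose_eq_of_isHermitian hM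
  rw [Matrix.dotProduct_mulVec, dotProduct_comm, ← Matrix.mulVec_transpose, this]

lemma mulVec_eq_zero_of_form {M : Matrix (Fin m) (Fin m) ℝ} (hM : M.PosSemidef) {v : Fin m → ℝ}
    (h : v ⬝ᵥ M.mulVec v = 0) : M.mulVec v = 0 := by
  rw [← hM.dotProduct_mulVec_zero_iff]; simpa using h

/-- If `f` vanishes on the kernel of a positive semidefinite `M`, then `M + ε f` stays positive
semidefinite for small `ε`. -/
lemma exists_posSemidef_add_smul {M f : Matrix (Fin m) (Fin m) ℝ} (hM : M.PosSemidef)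
    (hf : f.IsHermitian) (hk : ∀ v, M.mulVec v = 0 → f.mulVec v = 0) :
    ∃ δ > (0 : ℝ), ∀ ε : ℝ, 0 ≤ ε → ε ≤ δ → (M + ε • f).PosSemidef := by
  obtain ⟨W, hW⟩ := Submodule.exists_isCompl (LinearMap.ker M.mulVecLin)
  have hS : IsCompact (Metric.sphere (0 : Fin m → ℝ) 1 ∩ W) :=
    (isCompact_sphere _ _).inter_right W.closed_of_finiteDimensional
  have hcont : ∀ A : Matrix (Fin m) (Fin m) ℝ, Continuous fun v : Fin m → ℝ => v ⬝ᵥ A.mulVec v :=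
    fun A => by fun_prop
  obtain ⟨c, hc, hcM⟩ := hS.exists_forall_le' (hcont M).continuousOn (a := 0) (by
    rintro v ⟨hv1, hvW⟩
    refine lt_of_le_of_ne ((posSemidef_iff_form.mp hM).2 v) fun h => ?_
    have h0 : v ∈ LinearMap.ker M.mulVecLin := by
      simpa using mulVec_eq_zero_of_form hM h.symm
    have : v = 0 := by simpa using (Submodule.disjoint_def.mp hW.disjoint) v h0 hvW
    simp [this] at hv1)
  obtain ⟨C, hC⟩ := hS.exists_bound_of_continuousOn (hcont f).continuousOn
  have hfC : ∀ w ∈ W, 0 ≤ w ⬝ᵥ M.mulVec w - c / (|C| + 1) * |w ⬝ᵥ f.mulVec w| := by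
    intro w hw
    by_cases h0 : w = 0
    · simp [h0]
    have hn : 0 < ‖w‖ := norm_pos_iff.mpr h0
    obtain ⟨r, w', hw', rfl⟩ :
        ∃ r : ℝ, ∃ w' ∈ Metric.sphere (0 : Fin m → ℝ) 1 ∩ W, w = r • w' :=
      ⟨‖w‖, ‖w‖⁻¹ • w, ⟨by simp [norm_smul, hn.ne'], W.smul_mem _ hw⟩, by
        rw [smul_smul, mul_inv_cancel₀ hn.ne', one_smul]⟩
    have h1 := hcM w' hw'
    have h2 := hC w' hw'
    simp only [Matrix.mulVec_smul, dotProduct_smul, smul_dotProduct, smul_eq_mul, abs_mul]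
    rw [Real.norm_eq_abs] at h2
    have h3 : c / (|C| + 1) * |w' ⬝ᵥ f.mulVec w'| ≤ c := by
      rw [div_mul_eq_mul_div, div_le_iff₀ (by positivity)]
      have := le_abs_self C
      gcongr; linarith
    have h4 := abs_mul_abs_self r
    have h5 := mul_self_nonneg r
    have : r * (r * w' ⬝ᵥ M.mulVec w') -
        c / (|C| + 1) * (|r| * (|r| * |w' ⬝ᵥ f.mulVec w'|)) =
        r * r * (w' ⬝ᵥ M.mulVec w' - c / (|C| + 1) * |w' ⬝ᵥ f.mulVec w'|) := by
      rw [← h4]; rw [show r * (r * w' ⬝ᵥ M.mulVec w') = (r * r) * w' ⬝ᵥ M.mulVec w' by ring, ← h4]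
      ring
    rw [this]
    exact mul_nonneg h5 (by linarith)
  refine ⟨c / (|C| + 1), by positivity, fun ε hε hεδ => posSemidef_iff_form.mpr ⟨?_, fun v => ?_⟩⟩
  · exact hM.1.add (by rw [isHermitian_iff_apply] at hf ⊢; intro i j; simp [hf i j])
  -- Both symmetric matrices annihilate the kernel component `k`, so the cross terms vanish and only
  -- the form at `w` remains.
  · obtain ⟨k, hk', w, hw, rfl⟩ :=
      Submodule.mem_sup.mp (show v ∈ LinearMap.ker M.mulVecLin ⊔ W by rw [hW.sup_eq_top]; trivial)
    have hMk : M.mulVec k = 0 := by simpa using hk'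
    have hfk := hk k hMk
    have e : ∀ A : Matrix (Fin m) (Fin m) ℝ, A.IsHermitian → A.mulVec k = 0 →
        (k + w) ⬝ᵥ A.mulVec (k + w) = w ⬝ᵥ A.mulVec w := fun A hA h => by
      rw [Matrix.mulVec_add, h, zero_add, add_dotProduct, dotProduct_mulVec_comm hA, h]
      simp
    rw [Matrix.add_mulVec, dotProduct_add, e M hM.1 hMk, Matrix.smul_mulVec, dotProduct_smul,
      e f hf hfk, smul_eq_mul]
    have h1 := hfC w hw
    have h2 : ε * |w ⬝ᵥ f.mulVec w| ≤ c / (|C| + 1) * |w ⬝ᵥ f.mulVec w| := by gcongr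
    have h3 : -(ε * |w ⬝ᵥ f.mulVec w|) ≤ ε * w ⬝ᵥ f.mulVec w := by
      rw [← mul_neg]; exact mul_le_mul_of_nonneg_left (neg_abs_le _) hε
    linarith

/-- With `A = CᵀC` and `B = EᵀE`, the pairing is the squared Frobenius norm of `C Eᵀ`. -/
lemma mul_eq_zero_of_frob_eq_zero {A B : Matrix (Fin m) (Fin m) ℝ} (hA : A.PosSemidef)
    (hB : B.PosSemidef) (h : frob A B = 0) : A * B = 0 := by
  obtain ⟨C, rfl⟩ := exists_eq_transpose_mul hA
  obtain ⟨E, rfl⟩ := exists_eq_transpose_mul hB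
  have h1 : ((C * E.transpose).conjTranspose * (C * E.transpose)).trace = 0 := by
    rw [frob_eq_trace] at h
    rw [← h]
    simp only [Matrix.conjTranspose_eq_transpose_of_trivial, Matrix.transpose_mul,
      Matrix.transpose_transpose]
    rw [Matrix.mul_assoc, Matrix.trace_mul_comm]
    simp only [Matrix.mul_assoc]
  rw [Matrix.trace_conjTranspose_mul_self_eq_zero_iff] at h1
  calc C.transpose * C * (E.transpose * E) = C.transpose * (C * E.transpose) * E := by
        simp only [Matrix.mul_assoc]
    _ = 0 := by rw [h1]; simp

lemma eq_zero_of_mul_posDef_mul {Z A : Matrix (Fin m) (Fin m) ℝ} (hZ : Z.PosDef)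
    (h : A.transpose * Z * A = 0) : A = 0 := by
  have : ∀ v, A.mulVec v = 0 := fun v => by
    by_contra hv
    have h1 := hZ.dotProduct_mulVec_pos hv
    have h2 : v ⬝ᵥ (A.transpose * Z * A).mulVec v = A.mulVec v ⬝ᵥ Z.mulVec (A.mulVec v) := by
      rw [← Matrix.mulVec_mulVec, ← Matrix.mulVec_mulVec, Matrix.dotProduct_mulVec,
        Matrix.vecMul_transpose]
    rw [h] at h2
    simp at h2 h1
    linarith
  ext i j
  simpa using congrFun (this (Pi.single j 1)) i

/-- A zero pairing would force `Z D Z D Z D = 0`. Cancelling `Z` and writing `D = CᵀC` gives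
successively `C Z D = 0`, `D Z D = 0` and `D = 0`. This strict sign is what a jump of the
distribution function contradicts at the end. -/
lemma frob_cubic_pos {Z D : Matrix (Fin m) (Fin m) ℝ} (hZ : Z.PosDef) (hD : D.PosSemidef)
    (hD0 : D ≠ 0) : 0 < frob (Z * D * Z * D * Z) D := by
  have hZt : Z.transpose = Z := transpose_eq_of_isHermitian hZ.1
  have hDt : D.transpose = D := transpose_eq_of_isHermitian hD.1
  have hps : (Z * D * Z * D * Z).PosSemidef := by
    have := hZ.posSemidef.mul_mul_conjTranspose_same (Z * D)
    simp only [Matrix.conjTranspose_eq_transpose_of_trivial, Matrix.transpose_mul, hZt, hDt] at this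
    simpa only [Matrix.mul_assoc] using this
  refine lt_of_le_of_ne (frob_nonneg hps hD) fun h => hD0 ?_
  have h0 := mul_eq_zero_of_frob_eq_zero hps hD h.symm
  have hu := hZ.isUnit
  obtain ⟨C, hC⟩ := exists_eq_transpose_mul hD
  have h1 : D * Z * D * Z * D = 0 := by
    have : Z * (D * Z * D * Z * D) = Z * 0 := by
      simpa only [Matrix.mul_assoc, Matrix.mul_zero] using h0
    exact hu.mul_left_cancel this
  have h2 : C * Z * D = 0 := by
    have : (C * Z * D).conjTranspose * (C * Z * D) = 0 := by
      simp only [Matrix.conjTranspose_eq_transpose_of_trivial, Matrix.transpose_mul, hZt, hDt]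
      rw [← h1]
      conv_rhs => rw [Matrix.mul_assoc D Z D]
      simp only [Matrix.mul_assoc, ← Matrix.mul_assoc C.transpose C, ← hC]
    exact Matrix.conjTranspose_mul_self_eq_zero.mp this
  have h3 : D.transpose * Z * D = 0 := by
    rw [hDt]; nth_rewrite 1 [hC]
    rw [Matrix.mul_assoc, Matrix.mul_assoc, ← Matrix.mul_assoc C, h2]; simp
  exact eq_zero_of_mul_posDef_mul hZ h3

end LinearAlgebra

/-! ### Derivatives of the matrix inverse and of the log-determinant. -/

section Calculus

variable {m : ℕ}

lemma continuousAt_inv_apply {A : Matrix (Fin m) (Fin m) ℝ} (h : A.det ≠ 0) :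
    ContinuousAt (fun B : Matrix (Fin m) (Fin m) ℝ => B⁻¹) A := by
  have : (fun B : Matrix (Fin m) (Fin m) ℝ => B⁻¹) = fun B => (B.det)⁻¹ • B.adjugate := by
    funext B; rw [Matrix.inv_def, Ring.inverse_eq_inv']
  rw [this]
  exact (continuous_id.matrix_det.continuousAt.inv₀ h).smul
    continuous_id.matrix_adjugate.continuousAt

lemma inv_sub_inv_eq {A B : Matrix (Fin m) (Fin m) ℝ} (hA : A.det ≠ 0) (hB : B.det ≠ 0) :
    B⁻¹ - A⁻¹ = -(B⁻¹ * (B - A) * A⁻¹) := by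
  rw [Matrix.mul_sub, Matrix.nonsing_inv_mul _ hB.isUnit, Matrix.sub_mul, Matrix.one_mul,
    Matrix.mul_assoc, Matrix.mul_nonsing_inv _ hA.isUnit, Matrix.mul_one, neg_sub]

/-- A matrix-valued function is differentiable entrywise iff its difference quotients converge. -/
lemma hasDerivWithinAt_entries_iff {A : ℝ → Matrix (Fin m) (Fin m) ℝ}
    {A' : Matrix (Fin m) (Fin m) ℝ} {S : Set ℝ} {t : ℝ} :
    (∀ i j, HasDerivWithinAt (fun s => A s i j) (A' i j) S t) ↔
      Tendsto (fun s => (s - t)⁻¹ • (A s - A t)) (𝓝[S \ {t}] t) (𝓝 A') := by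
  simp only [hasDerivWithinAt_iff_tendsto_slope]
  exact ⟨fun h => tendsto_pi_nhds.mpr fun i => tendsto_pi_nhds.mpr fun j => h i j,
    fun h i j => tendsto_pi_nhds.mp (tendsto_pi_nhds.mp h i) j⟩

/-- The resolvent identity divided by `s - t`. A general set `S` is allowed because `P̂` has only
one-sided derivatives at atoms. -/
lemma hasDerivWithinAt_inv_apply {A : ℝ → Matrix (Fin m) (Fin m) ℝ}
    {A' : Matrix (Fin m) (Fin m) ℝ} {S : Set ℝ} {t : ℝ} (hdet : (A t).det ≠ 0)
    (h : ∀ i j, HasDerivWithinAt (fun s => A s i j) (A' i j) S t) (i j : Fin m) :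
    HasDerivWithinAt (fun s => (A s)⁻¹ i j) ((-((A t)⁻¹ * A' * (A t)⁻¹)) i j) S t := by
  have hc : Tendsto A (𝓝[S \ {t}] t) (𝓝 (A t)) :=
    tendsto_pi_nhds.mpr fun i => tendsto_pi_nhds.mpr fun j =>
      ((h i j).continuousWithinAt.tendsto).mono_left (nhdsWithin_mono _ sdiff_subset)
  have hci : Tendsto (fun s => (A s)⁻¹) (𝓝[S \ {t}] t) (𝓝 (A t)⁻¹) :=
    (continuousAt_inv_apply hdet).tendsto.comp hc
  have hd : ∀ᶠ s in 𝓝[S \ {t}] t, (A s).det ≠ 0 :=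
    ((continuous_id.matrix_det.tendsto (A t)).comp hc).eventually_ne hdet
  refine (hasDerivWithinAt_entries_iff (A := fun s => (A s)⁻¹)).mpr ?_ i j
  have h1 := ((hci.mul (hasDerivWithinAt_entries_iff.mp h)).mul
    (tendsto_const_nhds (x := (A t)⁻¹))).neg
  refine h1.congr' ?_
  filter_upwards [hd] with s hs
  rw [inv_sub_inv_eq hdet hs]
  simp

lemma hasDerivAt_log_det {A E : Matrix (Fin m) (Fin m) ℝ} (hA : 0 < A.det) :
    HasDerivAt (fun ε : ℝ => Real.log (A + ε • E).det) ((A⁻¹ * E).trace) 0 := by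
  -- Factoring out `A` reduces the claim to the polynomial expansion of `det (1 + ε B)`, whose
  -- linear coefficient is the trace of `B`.
  have h1 : ∀ ε : ℝ, (A + ε • E).det = A.det * (1 + ε • (A⁻¹ * E)).det := fun ε => by
    rw [← Matrix.det_mul, Matrix.mul_add, Matrix.mul_one, Matrix.mul_smul, ← Matrix.mul_assoc,
      Matrix.mul_nonsing_inv _ hA.ne'.isUnit, Matrix.one_mul]
  obtain ⟨p, hp⟩ : ∃ p : Polynomial ℝ, ∀ ε : ℝ,
      (1 + ε • (A⁻¹ * E)).det = 1 + (A⁻¹ * E).trace * ε + p.eval ε * ε ^ 2 :=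
    ⟨_, fun ε => Matrix.det_one_add_smul ε _⟩
  simp only [h1, hp]
  have h2 : HasDerivAt (fun ε : ℝ => A.det * (1 + (A⁻¹ * E).trace * ε + p.eval ε * ε ^ 2))
      (A.det * (A⁻¹ * E).trace) 0 := by
    have := ((((hasDerivAt_id (0 : ℝ)).const_mul ((A⁻¹ * E).trace)).const_add 1).add
      ((p.hasDerivAt 0).mul ((hasDerivAt_id (0 : ℝ)).pow 2))).const_mul A.det
    simpa using this
  have h3 := h2.log (by simpa using hA.ne')
  simpa [hA.ne'] using h3

end Calculus

/-! ### Analyticity of the entries of `ξ'` and their potential. -/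

section Mixture

variable {m : ℕ}

/-- The scalar power series in the `(i, j)` entry of `ξ'`. -/
noncomputable def xiEntry (β : ℕ → Fin m → ℝ) (i j : Fin m) (a : ℝ) : ℝ :=
  ∑' p : ℕ, ((p : ℝ) + 2) * (β (p + 2) i * β (p + 2) j) * a ^ (p + 1)

lemma xiDeriv_apply (β : ℕ → Fin m → ℝ) (A : Matrix (Fin m) (Fin m) ℝ) (i j : Fin m) :
    xiDeriv β A i j = xiEntry β i j (A i j) := rfl

lemma xiEntry_comm (β : ℕ → Fin m → ℝ) (i j : Fin m) (a : ℝ) :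
    xiEntry β i j a = xiEntry β j i a := by
  simp only [xiEntry, mul_comm (β _ i)]

/-- The summability hypothesis makes `2 ^ n |βᵢ βⱼ|` bounded. The radius `3 / 2` is enough: it
absorbs the factor `p` and leaves room around `[-1, 1]` for perturbed paths. -/
lemma analyticOnNhd_xiEntry {β : ℕ → Fin m → ℝ} (hβ : IsEvenMixture β) (i j : Fin m) :
    AnalyticOnNhd ℝ (xiEntry β i j) (Ioo (-3 / 2) (3 / 2)) := by
  let c : ℕ → ℝ := fun n => ((n : ℝ) + 2) * (β (n + 2) i * β (n + 2) j)
  let P := FormalMultilinearSeries.ofScalars ℝ c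
  have hP : xiEntry β i j = fun a => a * P.sum a := by
    funext a
    have : P.sum a = ∑' n, c n • a ^ n := FormalMultilinearSeries.ofScalars_sum_eq c a
    rw [this, ← tsum_mul_left, xiEntry]
    exact tsum_congr fun n => by simp only [c, smul_eq_mul]; ring
  have hr : ((3 / 2 : NNReal) : ENNReal) ≤ P.radius := by
    obtain ⟨C, hC⟩ : ∃ C : ℝ, ∀ j n, (2 : ℝ) ^ n * β n j ^ 2 ≤ C :=
      ⟨∑ k, ∑' n, (2 : ℝ) ^ n * β n k ^ 2, fun j n =>
        ((hβ.summable j).le_tsum n fun k _ => by positivity).trans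
          (Finset.single_le_sum (f := fun k => ∑' n, (2 : ℝ) ^ n * β n k ^ 2)
            (fun k _ => tsum_nonneg fun n => by positivity) (Finset.mem_univ j))⟩
    refine P.le_radius_of_bound (3 * C) fun n => ?_
    have h1 : ‖P n‖ = |c n| := by
      simp only [P, FormalMultilinearSeries.ofScalars_norm, Real.norm_eq_abs]
    -- Bernoulli's inequality; the rate `4 / 3` is chosen because `4 / 3 * (3 / 2) = 2`.
    have h2 : (n : ℝ) + 2 ≤ 3 * (4 / 3) ^ n := by
      have := one_add_mul_le_pow (a := (1 / 3 : ℝ)) (by norm_num) n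
      norm_num at this; linarith
    have h3 : 2 ^ n * |β (n + 2) i * β (n + 2) j| ≤ C := by
      have hi := hC i (n + 2)
      have hj := hC j (n + 2)
      rw [pow_add] at hi hj
      have h5 : 2 ^ n * |β (n + 2) i * β (n + 2) j|
          ≤ 2 ^ n * (β (n + 2) i ^ 2 + β (n + 2) j ^ 2) := by
        gcongr
        rw [abs_mul]
        nlinarith [sq_abs (β (n + 2) i), sq_abs (β (n + 2) j),
          sq_nonneg (|β (n + 2) i| - |β (n + 2) j|), sq_nonneg (β (n + 2) i),
          sq_nonneg (β (n + 2) j)]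
      have : 0 ≤ (2 : ℝ) ^ n * β (n + 2) i ^ 2 := by positivity
      have : 0 ≤ (2 : ℝ) ^ n * β (n + 2) j ^ 2 := by positivity
      linarith
    rw [h1]
    have h4 : |c n| = (n + 2) * |β (n + 2) i * β (n + 2) j| := by
      simp only [c]; rw [abs_mul, abs_of_nonneg (by positivity)]
    rw [h4]
    calc ((n : ℝ) + 2) * |β (n + 2) i * β (n + 2) j| * ((3 / 2 : NNReal) : ℝ) ^ n
        ≤ 3 * (4 / 3) ^ n * |β (n + 2) i * β (n + 2) j| * (3 / 2) ^ n := by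
          push_cast; gcongr
      _ = 3 * ((4 / 3 * (3 / 2)) ^ n * |β (n + 2) i * β (n + 2) j|) := by
          rw [mul_pow]; ring
      _ ≤ 3 * C := by
          rw [show (4 / 3 * (3 / 2) : ℝ) = 2 by norm_num]; linarith
  have hpos : 0 < P.radius := lt_of_lt_of_le (by norm_num) hr
  rw [hP]
  refine analyticOnNhd_id.mul fun a ha => (P.hasFPowerSeriesOnBall hpos).analyticAt_of_mem ?_
  refine Metric.eball_subset_eball hr ?_
  have : |a| < 3 / 2 := by rw [abs_lt]; constructor <;> linarith [ha.1, ha.2]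
  rw [Metric.mem_eball, edist_dist, dist_zero_right, Real.norm_eq_abs]
  rw [ENNReal.ofReal_lt_iff_lt_toReal (abs_nonneg _) ENNReal.coe_ne_top]
  simpa using this

/-- The antiderivative of `xiEntry` vanishing at `0`. -/
noncomputable def xiInt (β : ℕ → Fin m → ℝ) (i j : Fin m) (a : ℝ) : ℝ :=
  ∫ s in (0 : ℝ)..a, xiEntry β i j s

lemma hasDerivAt_xiInt {β : ℕ → Fin m → ℝ} (hβ : IsEvenMixture β) (i j : Fin m) {a : ℝ}
    (ha : a ∈ Ioo (-3 / 2 : ℝ) (3 / 2)) : HasDerivAt (xiInt β i j) (xiEntry β i j a) a := by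
  have hc := (analyticOnNhd_xiEntry hβ i j).continuousOn
  have hsub : uIcc 0 a ⊆ Ioo (-3 / 2 : ℝ) (3 / 2) :=
    ordConnected_Ioo.uIcc_subset (by norm_num) ha
  exact intervalIntegral.integral_hasDerivAt_right (hc.mono hsub).intervalIntegrable
    (hc.stronglyMeasurableAtFilter isOpen_Ioo a ha) (hc.continuousAt (isOpen_Ioo.mem_nhds ha))

/-- The potential whose gradient is `ξ'(A) + h hᵀ`. -/
noncomputable def potential (β : ℕ → Fin m → ℝ) (h : Fin m → ℝ)
    (A : Matrix (Fin m) (Fin m) ℝ) : ℝ :=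
  ∑ i, ∑ j, (xiInt β i j (A i j) + h i * h j * A i j)

end Mixture

/-! ### Fubini against a distribution function. -/

section Swap

lemma intervalIntegral_integral_swap {μ : Measure ℝ} [IsFiniteMeasure μ] {a b : ℝ} (hab : a ≤ b)
    {K : ℝ → ℝ → ℝ} (hK : Measurable (Function.uncurry K)) {C : ℝ}
    (hC : ∀ᵐ r ∂μ, ∀ t ∈ Icc a b, |K r t| ≤ C) :
    ∫ t in a..b, ∫ r, K r t ∂μ = ∫ r, (∫ t in a..b, K r t) ∂μ := by
  simp only [intervalIntegral.integral_of_le hab]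
  symm
  refine integral_integral_swap ?_
  refine Integrable.of_bound hK.aestronglyMeasurable C ?_
  have h1 := Measure.quasiMeasurePreserving_fst (μ := μ) (ν := volume.restrict (Ioc a b)) |>.ae hC
  have h2 := Measure.quasiMeasurePreserving_snd (μ := μ) (ν := volume.restrict (Ioc a b)) |>.ae
    (ae_restrict_mem measurableSet_Ioc)
  filter_upwards [h1, h2] with p hp1 hp2
  exact hp1 _ (Ioc_subset_Icc_self hp2)

lemma integrable_of_continuousOn_Icc {μ : Measure ℝ} [IsFiniteMeasure μ] {a b : ℝ} {f : ℝ → ℝ}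
    (hf : ContinuousOn f (Icc a b)) (ha : ∀ᵐ r ∂μ, a ≤ r) (hb : ∀ᵐ r ∂μ, r ≤ b) :
    Integrable f μ := by
  have h : μ.restrict (Icc a b) = μ :=
    Measure.restrict_eq_self_of_ae_mem (by filter_upwards [ha, hb] with r h1 h2 using ⟨h1, h2⟩)
  rw [← h]
  exact hf.integrableOn_Icc

lemma measurable_ite_le (f : ℝ → ℝ → ℝ) (hf : Measurable (Function.uncurry f)) :
    Measurable (Function.uncurry fun r t : ℝ => if r ≤ t then f r t else 0) :=
  Measurable.ite (measurableSet_le measurable_fst measurable_snd) hf measurable_const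

lemma integral_ite_le {g : ℝ → ℝ} (hg : Continuous g) {a b r : ℝ} (hr : r ≤ b) (hab : a ≤ b) :
    ∫ t in a..b, (if r ≤ t then g t else 0) = ∫ t in (max r a)..b, g t := by
  have h1 : max r a ≤ b := max_le hr hab
  have hint : ∀ c d, IntervalIntegrable (fun t => if r ≤ t then g t else 0) volume c d := by
    intro c d
    have : (fun t => if r ≤ t then g t else 0) = (Ici r).indicator g := by
      funext t; simp [indicator]
    rw [this]
    exact ⟨(hg.intervalIntegrable c d).1.indicator measurableSet_Ici,
      (hg.intervalIntegrable c d).2.indicator measurableSet_Ici⟩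
  rw [← intervalIntegral.integral_add_adjacent_intervals (hint a (max r a)) (hint _ b)]
  have h2 : ∫ t in a..(max r a), (if r ≤ t then g t else 0) = 0 := by
    rw [intervalIntegral.integral_of_le (le_max_right _ _), ← integral_Ico_eq_integral_Ioc]
    refine setIntegral_eq_zero_of_forall_eq_zero fun t ht => if_neg ?_
    rcases le_total r a with h | h
    · simp [max_eq_right h] at ht
    · rw [max_eq_left h] at ht; exact not_le.mpr ht.2
  have h3 : ∫ t in (max r a)..b, (if r ≤ t then g t else 0) = ∫ t in (max r a)..b, g t := by
    refine intervalIntegral.integral_congr fun t ht => if_pos ?_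
    rw [uIcc_of_le h1] at ht
    exact (le_max_left _ _).trans ht.1
  rw [h2, h3, zero_add]

lemma distFun_eq_integral {μ : Measure ℝ} [IsFiniteMeasure μ] (h0 : ∀ᵐ r ∂μ, 0 ≤ r) (t : ℝ) :
    distFun μ t = ∫ r, (if r ≤ t then 1 else 0) ∂μ := by
  have : ∫ r, (if r ≤ t then (1 : ℝ) else 0) ∂μ = ∫ r, (Icc 0 t).indicator 1 r ∂μ := by
    refine integral_congr_ae ?_
    filter_upwards [h0] with r hr
    simp [indicator, hr]
  rw [this, integral_indicator_one measurableSet_Icc, distFun]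

/-- Fubini for `x(t) = ∫ 1_{r ≤ t} dμ(r)`. The maximum appears because mass below `a` contributes on
the whole interval. -/
lemma integral_distFun_mul {μ : Measure ℝ} [IsFiniteMeasure μ] {a b : ℝ} (hab : a ≤ b)
    (h0 : ∀ᵐ r ∂μ, 0 ≤ r) (hb : ∀ᵐ r ∂μ, r ≤ b) {g : ℝ → ℝ} (hg : Continuous g) :
    ∫ t in a..b, distFun μ t * g t = ∫ r, (∫ t in (max r a)..b, g t) ∂μ := by
  obtain ⟨C, hC⟩ := isCompact_Icc.exists_bound_of_continuousOn (s := Icc a b) hg.continuousOn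
  have h1 : ∀ t, distFun μ t * g t = ∫ r, (if r ≤ t then g t else 0) ∂μ := fun t => by
    rw [distFun_eq_integral h0, ← integral_mul_const]
    simp
  simp only [h1]
  rw [intervalIntegral_integral_swap hab (C := C) (measurable_ite_le (fun _ t => g t)
    (hg.measurable.comp measurable_snd))]
  · refine integral_congr_ae ?_
    filter_upwards [hb] with r hr
    exact integral_ite_le hg hr hab
  · refine Eventually.of_forall fun r t ht => ?_
    have := hC t ht
    rw [Real.norm_eq_abs] at this
    split_ifs
    · exact this
    · simpa using (abs_nonneg _).trans this

/-- Integration by parts against the distribution function of a probability measure. -/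
lemma integral_distFun_mul_deriv {μ : Measure ℝ} [IsProbabilityMeasure μ] {a b : ℝ} (ha : 0 ≤ a)
    (hab : a ≤ b) (h0 : ∀ᵐ r ∂μ, 0 ≤ r) (hb : ∀ᵐ r ∂μ, r ≤ b) {f f' : ℝ → ℝ}
    (hf : ∀ t ∈ Icc 0 b, HasDerivWithinAt f (f' t) (Icc 0 b) t) (hf' : ContinuousOn f' (Icc 0 b)) :
    ∫ t in a..b, distFun μ t * f' t = f b - ∫ r, f (max r a) ∂μ := by
  have h0b : (0 : ℝ) ≤ b := ha.trans hab
  -- The constant extension is continuous on the line and agrees with `f'` where it matters.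
  let g := IccExtend h0b ((Icc 0 b).domRestrict f')
  have hg : Continuous g := (continuousOn_iff_continuous_domRestrict.mp hf').Icc_extend'
  have hgf : ∀ t ∈ Icc 0 b, g t = f' t := fun t ht => by
    simp only [g, IccExtend_of_mem h0b _ ht]; rfl
  have h1 : ∫ t in a..b, distFun μ t * f' t = ∫ t in a..b, distFun μ t * g t := by
    refine intervalIntegral.integral_congr fun t ht => ?_
    rw [uIcc_of_le hab] at ht
    simp only [hgf t ⟨ha.trans ht.1, ht.2⟩]
  have h2 : ∀ c ∈ Icc 0 b, ∫ t in c..b, g t = f b - f c := fun c hc => by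
    have hsub : Icc c b ⊆ Icc 0 b := Icc_subset_Icc_left hc.1
    refine intervalIntegral.integral_eq_sub_of_hasDeriv_right_of_le hc.2
      (fun t ht => ((hf t (hsub ht)).continuousWithinAt).mono hsub) (fun t ht => ?_)
      (hg.intervalIntegrable _ _)
    have ht' : t ∈ Ioo 0 b := ⟨hc.1.trans_lt ht.1, ht.2⟩
    rw [hgf t (Ioo_subset_Icc_self ht')]
    exact ((hf t (Ioo_subset_Icc_self ht')).hasDerivAt (Icc_mem_nhds ht'.1 ht'.2)).hasDerivWithinAt
  have hfc : ContinuousOn f (Icc 0 b) := fun t ht => (hf t ht).continuousWithinAt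
  rw [h1, integral_distFun_mul hab h0 hb hg]
  have h3 : ∫ r, (∫ t in (max r a)..b, g t) ∂μ = ∫ r, (f b - f (max r a)) ∂μ := by
    refine integral_congr_ae ?_
    filter_upwards [h0, hb] with r hr hrb
    exact h2 _ ⟨hr.trans (le_max_left _ _), max_le hrb hab⟩
  rw [h3, integral_sub (integrable_const _)]
  · simp
  · refine integrable_of_continuousOn_Icc (hfc.comp (continuous_id.max continuous_const).continuousOn
      fun r hr => ⟨hr.1.trans (le_max_left _ _), max_le hr.2 hab⟩) h0 hb

end Swap

/-! ### The functional in terms of the measure instead of its distribution function. -/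

section Path

variable {m : ℕ} {Q : Matrix (Fin m) (Fin m) ℝ} {μ : Measure ℝ}
  {Φ : ℝ → Matrix (Fin m) (Fin m) ℝ}

lemma hasDerivWithinAt_form {A : ℝ → Matrix (Fin m) (Fin m) ℝ} {A' : Matrix (Fin m) (Fin m) ℝ}
    {S : Set ℝ} {t : ℝ} (h : ∀ i j, HasDerivWithinAt (fun s => A s i j) (A' i j) S t)
    (v : Fin m → ℝ) :
    HasDerivWithinAt (fun s => v ⬝ᵥ (A s).mulVec v) (v ⬝ᵥ A'.mulVec v) S t := by
  simp only [dotProduct, Matrix.mulVec]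
  refine HasDerivWithinAt.fun_sum fun i _ => HasDerivWithinAt.const_mul _ ?_
  exact HasDerivWithinAt.fun_sum fun j _ => (h i j).mul_const _

lemma IsRegularPath.hasDerivWithinAt (hp : IsRegularPath Q μ Φ) {t : ℝ} (ht : t ∈ Icc (0 : ℝ) m)
    (i j : Fin m) :
    HasDerivWithinAt (fun s => Φ s i j) (pathDeriv Φ t i j) (Icc (0 : ℝ) m) t :=
  (hp.differentiable i j t ht).hasDerivWithinAt

lemma IsRegularPath.continuousOn_pathDeriv (hp : IsRegularPath Q μ Φ) (i j : Fin m) :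
    ContinuousOn (fun t => pathDeriv Φ t i j) (Icc (0 : ℝ) m) := by
  obtain ⟨K, hK⟩ := hp.lipschitz_deriv
  exact (hK i j).continuousOn

lemma IsRegularPath.continuousOn (hp : IsRegularPath Q μ Φ) (i j : Fin m) :
    ContinuousOn (fun t => Φ t i j) (Icc (0 : ℝ) m) :=
  (hp.differentiable i j).continuousOn

lemma IsRegularPath.abs_apply_le (hp : IsRegularPath Q μ Φ) (hQ : IsConstraint Q) {t : ℝ}
    (ht : t ∈ Icc (0 : ℝ) m) (i j : Fin m) : |Φ t i j| ≤ 1 := by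
  have hm : (m : ℝ) ∈ Icc (0 : ℝ) m := ⟨by positivity, le_rfl⟩
  refine abs_apply_le_one (hp.posSemidef t ht) (Q := Q) ?_ hQ.diag i j
  rw [← hp.finish]
  exact hp.monotone t ht m hm ht.2

lemma IsRegularPath.apply_mem (hp : IsRegularPath Q μ Φ) (hQ : IsConstraint Q) {t : ℝ}
    (ht : t ∈ Icc (0 : ℝ) m) (i j : Fin m) : Φ t i j ∈ Ioo (-3 / 2 : ℝ) (3 / 2) := by
  have := abs_le.mp (hp.abs_apply_le hQ ht i j)
  constructor <;> linarith [this.1, this.2]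

lemma IsRegularPath.posSemidef_pathDeriv (hm : 1 ≤ m) (hp : IsRegularPath Q μ Φ) {t : ℝ}
    (ht : t ∈ Icc (0 : ℝ) m) : (pathDeriv Φ t).PosSemidef := by
  have hm' : (0 : ℝ) < m := by exact_mod_cast hm
  have hu : UniqueDiffWithinAt ℝ (Icc (0 : ℝ) m) t := uniqueDiffOn_Icc hm' t ht
  rw [posSemidef_iff_form]
  constructor
  · rw [isHermitian_iff_apply]
    intro i j
    refine derivWithin_congr (fun s hs => ?_) ?_ <;>
    exact apply_comm_of_posSemidef (hp.posSemidef _ (by assumption)) i j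
  · intro v
    have h1 := hasDerivWithinAt_form (fun i j => hp.hasDerivWithinAt ht i j) v
    rw [← h1.derivWithin hu]
    refine MonotoneOn.derivWithin_nonneg fun a ha b hb hab => ?_
    have := (posSemidef_iff_form.mp (hp.monotone a ha b hb hab)).2 v
    rw [Matrix.sub_mulVec, dotProduct_sub] at this
    simpa using this

/-- The matrix `Q - ∫ Ψ(r ∨ t) dν(r)`, which is `Ψ̂(t)` on the domain of the path. -/
noncomputable def hatMean (Q : Matrix (Fin m) (Fin m) ℝ) (μ : Measure ℝ)
    (Φ : ℝ → Matrix (Fin m) (Fin m) ℝ) (t : ℝ) : Matrix (Fin m) (Fin m) ℝ :=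
  Matrix.of fun i j => Q i j - ∫ r, Φ (max r t) i j ∂μ

lemma ae_mem_of_concentrated (h : μ (Icc (0 : ℝ) m)ᶜ = 0) :
    (∀ᵐ r ∂μ, 0 ≤ r) ∧ ∀ᵐ r ∂μ, r ≤ (m : ℝ) := by
  have : ∀ᵐ r ∂μ, r ∈ Icc (0 : ℝ) m := by
    rw [ae_iff]; exact h
  exact ⟨this.mono fun r hr => hr.1, this.mono fun r hr => hr.2⟩

/-- The right-hand form is affine in the path and free of derivatives, so it is easy to perturb and
to transport under a time change. -/
lemma hatPath_eq_hatMean [IsProbabilityMeasure μ] (hc : μ (Icc (0 : ℝ) m)ᶜ = 0)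
    (hp : IsRegularPath Q μ Φ) {t : ℝ} (ht : t ∈ Icc (0 : ℝ) m) :
    hatPath μ Φ t = hatMean Q μ Φ t := by
  obtain ⟨h0, h1⟩ := ae_mem_of_concentrated hc
  ext i j
  simp only [hatPath, hatMean, Matrix.of_apply]
  rw [integral_distFun_mul_deriv ht.1 ht.2 h0 h1 (fun s hs => hp.hasDerivWithinAt hs i j)
    (hp.continuousOn_pathDeriv i j), hp.finish]

/-- The pairing in the integrand is the derivative of the potential along the path. -/
lemma integral_distFun_mul_potential [IsProbabilityMeasure μ] {β : ℕ → Fin m → ℝ}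
    (hβ : IsEvenMixture β) (h : Fin m → ℝ) (hQ : IsConstraint Q) (hc : μ (Icc (0 : ℝ) m)ᶜ = 0)
    (hp : IsRegularPath Q μ Φ) :
    (∫ t in (0 : ℝ)..(m : ℝ),
        distFun μ t * frob (xiDeriv β (Φ t) + Matrix.vecMulVec h h) (pathDeriv Φ t)) =
      potential β h Q - ∫ r, potential β h (Φ r) ∂μ := by
  obtain ⟨h0, h1⟩ := ae_mem_of_concentrated hc
  rw [integral_distFun_mul_deriv (f := fun t => potential β h (Φ t)) le_rfl (by positivity) h0 h1,
    hp.finish]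
  · congr 1
    refine integral_congr_ae ?_
    filter_upwards [h0] with r hr
    simp only [max_eq_left hr]
  · intro t ht
    refine HasDerivWithinAt.fun_sum fun i _ => HasDerivWithinAt.fun_sum fun j _ => ?_
    have hd := hp.hasDerivWithinAt ht i j
    have := ((hasDerivAt_xiInt hβ i j (hp.apply_mem hQ ht i j)).comp_hasDerivWithinAt t hd).add
      (hd.const_mul (h i * h j))
    refine this.congr_deriv ?_
    simp only [Matrix.add_apply, xiDeriv_apply, Matrix.vecMulVec_apply]
    ring
  · refine continuousOn_finsetSum _ fun i _ => continuousOn_finsetSum _ fun j _ => ?_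
    refine ContinuousOn.mul ?_ (hp.continuousOn_pathDeriv i j)
    simp only [Matrix.add_apply, xiDeriv_apply]
    refine ContinuousOn.add ?_ continuousOn_const
    exact (analyticOnNhd_xiEntry hβ i j).continuousOn.comp (hp.continuousOn i j)
      fun t ht => hp.apply_mem hQ ht i j

/-- The functional without the term that only depends on `Q`, written with the measure instead of
its distribution function. -/
noncomputable def reduced (β : ℕ → Fin m → ℝ) (h : Fin m → ℝ) (Q : Matrix (Fin m) (Fin m) ℝ)
    (μ : Measure ℝ) (Φ Φ' : ℝ → Matrix (Fin m) (Fin m) ℝ) (T : ℝ) : ℝ :=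
  -(∫ r, potential β h (Φ r) ∂μ) + Real.log (Q - Φ T).det
    + ∫ t in (0 : ℝ)..T, frob (hatMean Q μ Φ t)⁻¹ (Φ' t)

lemma crisantiSommers_eq_reduced [IsProbabilityMeasure μ] {β : ℕ → Fin m → ℝ}
    (hβ : IsEvenMixture β) (h : Fin m → ℝ) (hQ : IsConstraint Q) (hc : μ (Icc (0 : ℝ) m)ᶜ = 0)
    (hp : IsRegularPath Q μ Φ) {T : ℝ} (hT : T ∈ Icc (0 : ℝ) m) :
    crisantiSommers β h μ Φ T =
      (1 / 2) * (potential β h Q + reduced β h Q μ Φ (pathDeriv Φ) T) := by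
  rw [crisantiSommers, integral_distFun_mul_potential hβ h hQ hc hp, hp.finish, reduced]
  have : ∫ t in (0 : ℝ)..T, frob (hatPath μ Φ t)⁻¹ (pathDeriv Φ t) =
      ∫ t in (0 : ℝ)..T, frob (hatMean Q μ Φ t)⁻¹ (pathDeriv Φ t) := by
    refine intervalIntegral.integral_congr fun t ht => ?_
    rw [uIcc_of_le hT.1] at ht
    simp only [hatPath_eq_hatMean hc hp ⟨ht.1, ht.2.trans hT.2⟩]
  rw [this]
  ring

end Path

/-! ### `C^{1,1}` functions, time changes and smooth steps. -/

section C11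

/-- `f` is differentiable with locally Lipschitz derivative `f'`. -/
structure IsC11 (f f' : ℝ → ℝ) : Prop where
  hasDerivAt : ∀ t, HasDerivAt f (f' t) t
  locallyLipschitz : LocallyLipschitz f'

lemma locallyLipschitz_mul {f g : ℝ → ℝ} (hf : LocallyLipschitz f) (hg : LocallyLipschitz g) :
    LocallyLipschitz fun t => f t * g t := by
  have h : LocallyLipschitz fun p : ℝ × ℝ => p.1 * p.2 :=
    (contDiff_fst.mul contDiff_snd : ContDiff ℝ 1 _).locallyLipschitz
  exact h.comp (hf.prodMk hg)

lemma locallyLipschitz_add {f g : ℝ → ℝ} (hf : LocallyLipschitz f) (hg : LocallyLipschitz g) :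
    LocallyLipschitz fun t => f t + g t := by
  have h : LocallyLipschitz fun p : ℝ × ℝ => p.1 + p.2 :=
    (contDiff_fst.add contDiff_snd : ContDiff ℝ 1 _).locallyLipschitz
  exact h.comp (hf.prodMk hg)

lemma locallyLipschitz_inv {f : ℝ → ℝ} (hf : LocallyLipschitz f) (h0 : ∀ t, f t ≠ 0) :
    LocallyLipschitz fun t => (f t)⁻¹ := by
  intro t
  obtain ⟨K, S, hS, hK⟩ := hf t
  obtain ⟨K', S', hS', hK'⟩ := (contDiffAt_inv ℝ (h0 t) (n := 1)).exists_lipschitzOnWith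
  refine ⟨K' * K, S ∩ f ⁻¹' S', inter_mem hS (hf.continuous.continuousAt hS'), ?_⟩
  exact hK'.comp (hK.mono inter_subset_left) fun x hx => hx.2

lemma IsC11.contDiff {f f' : ℝ → ℝ} (hf : IsC11 f f') : ContDiff ℝ 1 f := by
  have hd : deriv f = f' := funext fun t => (hf.hasDerivAt t).deriv
  rw [contDiff_one_iff_deriv, hd]
  exact ⟨fun t => (hf.hasDerivAt t).differentiableAt, hf.locallyLipschitz.continuous⟩

lemma IsC11.continuous {f f' : ℝ → ℝ} (hf : IsC11 f f') : Continuous f := hf.contDiff.continuous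

lemma isC11_of_contDiff {f : ℝ → ℝ} (hf : ContDiff ℝ 2 f) : IsC11 f (deriv f) where
  hasDerivAt t := (hf.differentiable (by norm_num) t).hasDerivAt
  locallyLipschitz := ((contDiff_succ_iff_deriv (n := 1)).mp hf).2.2.locallyLipschitz

lemma isC11_const (c : ℝ) : IsC11 (fun _ => c) (fun _ => 0) where
  hasDerivAt t := hasDerivAt_const t c
  locallyLipschitz := LocallyLipschitz.const 0

lemma IsC11.add {f f' g g' : ℝ → ℝ} (hf : IsC11 f f') (hg : IsC11 g g') :
    IsC11 (fun t => f t + g t) (fun t => f' t + g' t) where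
  hasDerivAt t := (hf.hasDerivAt t).add (hg.hasDerivAt t)
  locallyLipschitz := locallyLipschitz_add hf.locallyLipschitz hg.locallyLipschitz

lemma IsC11.mul {f f' g g' : ℝ → ℝ} (hf : IsC11 f f') (hg : IsC11 g g') :
    IsC11 (fun t => f t * g t) (fun t => f' t * g t + f t * g' t) where
  hasDerivAt t := (hf.hasDerivAt t).mul (hg.hasDerivAt t)
  locallyLipschitz := locallyLipschitz_add
    (locallyLipschitz_mul hf.locallyLipschitz hg.contDiff.locallyLipschitz)
    (locallyLipschitz_mul hf.contDiff.locallyLipschitz hg.locallyLipschitz)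

lemma IsC11.const_mul {f f' : ℝ → ℝ} (hf : IsC11 f f') (c : ℝ) :
    IsC11 (fun t => c * f t) (fun t => c * f' t) where
  hasDerivAt t := (hf.hasDerivAt t).const_mul c
  locallyLipschitz := locallyLipschitz_mul (LocallyLipschitz.const c) hf.locallyLipschitz

lemma IsC11.comp {f f' g g' : ℝ → ℝ} (hf : IsC11 f f') (hg : IsC11 g g') :
    IsC11 (fun t => f (g t)) (fun t => f' (g t) * g' t) where
  hasDerivAt t := (hf.hasDerivAt (g t)).comp t (hg.hasDerivAt t)
  locallyLipschitz := locallyLipschitz_mul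
    (hf.locallyLipschitz.comp hg.contDiff.locallyLipschitz) hg.locallyLipschitz

lemma exists_lipschitzOnWith_Icc {f : ℝ → ℝ} (hf : LocallyLipschitz f) (a b : ℝ) :
    ∃ K, LipschitzOnWith K f (Icc a b) :=
  (hf.locallyLipschitzOn (s := Icc a b)).exists_lipschitzOnWith_of_compact isCompact_Icc

/-- A function with derivative at least `1 / 2` is an increasing homeomorphism of the line. -/
lemma exists_homeomorph {τ τ' : ℝ → ℝ} (hτ : IsC11 τ τ') (h : ∀ t, 1 / 2 ≤ τ' t) :
    ∃ e : ℝ ≃ₜ ℝ, (∀ t, e t = τ t) ∧ StrictMono e ∧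
      IsC11 e.symm (fun t => (τ' (e.symm t))⁻¹) := by
  -- Subtracting half the identity gives strict monotonicity and linear growth at both ends, hence
  -- surjectivity.
  have hmono : Monotone fun t => τ t - t / 2 := by
    refine monotone_of_hasDerivAt_nonneg (f' := fun t => τ' t - 1 / 2)
      (fun t => (hτ.hasDerivAt t).sub ((hasDerivAt_id t).div_const 2)) fun t => ?_
    simpa using h t
  have hsm : StrictMono τ := fun a b hab => by
    have := hmono hab.le
    simp only at this; linarith
  have hsurj : Function.Surjective τ := by
    refine hτ.continuous.surjective ?_ ?_
    · refine tendsto_atTop_mono' (f₁ := fun t => t / 2 + τ 0) _ ?_ ?_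
      · filter_upwards [eventually_ge_atTop 0] with t ht
        have := hmono ht
        simp only at this; linarith
      · exact tendsto_atTop_add_const_right _ _ (tendsto_id.atTop_div_const (by norm_num))
    · refine tendsto_atBot_mono' (f₁ := fun t => t / 2 + τ 0) _ ?_ ?_
      · filter_upwards [eventually_le_atBot 0] with t ht
        have := hmono ht
        simp only at this; linarith
      · exact tendsto_atBot_add_const_right _ _ (tendsto_id.atBot_div_const (by norm_num))
  let e : ℝ ≃ₜ ℝ := (hsm.orderIsoOfSurjective τ hsurj).toHomeomorph
  have he : ∀ t, e t = τ t := fun t => rfl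
  have h0 : ∀ t, τ' (e.symm t) ≠ 0 := fun t => by have := h (e.symm t); positivity
  have hd : ∀ t, HasDerivAt e.symm (τ' (e.symm t))⁻¹ t := fun t =>
    HasDerivAt.of_local_left_inverse e.symm.continuous.continuousAt (hτ.hasDerivAt _) (h0 t)
      (Eventually.of_forall fun y => e.apply_symm_apply y)
  have hlip : LocallyLipschitz e.symm := by
    refine ContDiff.locallyLipschitz (𝕂 := ℝ) (contDiff_one_iff_deriv.mpr
      ⟨fun t => (hd t).differentiableAt, ?_⟩)
    rw [funext fun t => (hd t).deriv]
    exact (hτ.locallyLipschitz.continuous.comp e.symm.continuous).inv₀ h0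
  exact ⟨e, he, hsm, hd, locallyLipschitz_inv (hτ.locallyLipschitz.comp hlip) h0⟩

lemma deriv_smoothTransition_nonneg (x : ℝ) : 0 ≤ deriv Real.smoothTransition x :=
  Real.smoothTransition.monotone.deriv_nonneg

lemma deriv_smoothTransition_of_nonpos {x : ℝ} (hx : x ≤ 0) : deriv Real.smoothTransition x = 0 := by
  refine IsLocalMin.deriv_eq_zero (Eventually.of_forall fun y => ?_)
  rw [Real.smoothTransition.zero_of_nonpos hx]
  exact Real.smoothTransition.nonneg y

lemma deriv_smoothTransition_of_one_le {x : ℝ} (hx : 1 ≤ x) : deriv Real.smoothTransition x = 0 := by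
  refine IsLocalMax.deriv_eq_zero (Eventually.of_forall fun y => ?_)
  rw [Real.smoothTransition.one_of_one_le hx]
  exact Real.smoothTransition.le_one y

lemma isC11_smoothTransition : IsC11 Real.smoothTransition (deriv Real.smoothTransition) :=
  isC11_of_contDiff (Real.smoothTransition.contDiff (n := 2))

lemma isC11_affine (c a : ℝ) : IsC11 (fun t => c * (t - a)) (fun _ => c) where
  hasDerivAt t := by simpa using ((hasDerivAt_id t).sub_const a).const_mul c
  locallyLipschitz := LocallyLipschitz.const c

lemma exists_bound_deriv_smoothTransition : ∃ C, ∀ x, |deriv Real.smoothTransition x| ≤ C := by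
  obtain ⟨C, hC⟩ := isCompact_Icc.exists_bound_of_continuousOn (s := Icc (0 : ℝ) 1)
    isC11_smoothTransition.locallyLipschitz.continuous.continuousOn
  refine ⟨C, fun x => ?_⟩
  have hC0 : 0 ≤ C := (norm_nonneg _).trans (hC 0 (by simp))
  rcases le_total x 0 with h | h
  · simpa [deriv_smoothTransition_of_nonpos h] using hC0
  rcases le_total 1 x with h' | h'
  · simpa [deriv_smoothTransition_of_one_le h'] using hC0
  exact hC x ⟨h, h'⟩

end C11

/-! ### Openness of positive definiteness. -/

section PosDef

variable {m : ℕ}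

lemma eventually_posDef {α : Type*} {l : Filter α} {A : α → Matrix (Fin m) (Fin m) ℝ}
    {A₀ : Matrix (Fin m) (Fin m) ℝ} (hA : Tendsto A l (𝓝 A₀)) (hs : ∀ᶠ x in l, (A x).IsHermitian)
    (h₀ : A₀.PosDef) : ∀ᶠ x in l, (A x).PosDef := by
  have hcont : ∀ B : Matrix (Fin m) (Fin m) ℝ, Continuous fun v : Fin m → ℝ => v ⬝ᵥ B.mulVec v :=
    fun B => by fun_prop
  obtain ⟨c, hc, hcM⟩ := (isCompact_sphere (0 : Fin m → ℝ) 1).exists_forall_le'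
    (hcont A₀).continuousOn (a := 0) (by
      intro v hv
      have : v ≠ 0 := by rintro rfl; simp at hv
      simpa using h₀.dotProduct_mulVec_pos this)
  have hent : ∀ᶠ x in l, ∀ i j, |(A x - A₀) i j| ≤ c / (2 * (m ^ 2 + 1)) := by
    simp only [eventually_all]
    intro i j
    have h1 : Tendsto (fun x => |(A x - A₀) i j|) l (𝓝 0) := by
      have := ((tendsto_pi_nhds.mp (tendsto_pi_nhds.mp hA i) j).sub_const (A₀ i j)).abs
      simpa using this
    exact (h1.eventually (gt_mem_nhds (by positivity))).mono fun x hx => hx.le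
  filter_upwards [hs, hent] with x hx1 hx2
  refine Matrix.PosDef.of_dotProduct_mulVec_pos hx1 fun v hv => ?_
  have hn : 0 < ‖v‖ := norm_pos_iff.mpr hv
  let w := ‖v‖⁻¹ • v
  have hw : w ∈ Metric.sphere (0 : Fin m → ℝ) 1 := by simp [w, norm_smul, hn.ne']
  have hvw : v = ‖v‖ • w := by simp only [w]; rw [smul_smul, mul_inv_cancel₀ hn.ne', one_smul]
  have h1 := hcM w hw
  have h2 : |w ⬝ᵥ (A x - A₀).mulVec w| ≤ m ^ 2 * (c / (2 * (m ^ 2 + 1)) * 1) := by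
    rw [← frob_vecMulVec]
    refine abs_frob_le (by positivity) hx2 fun i j => ?_
    rw [Matrix.vecMulVec_apply, abs_mul]
    have hwi : ∀ i, |w i| ≤ 1 := fun i => by
      have := norm_le_pi_norm w i
      rw [mem_sphere_zero_iff_norm.mp hw] at this
      exact this
    exact mul_le_one₀ (hwi i) (abs_nonneg _) (hwi j)
  have h3 : (m : ℝ) ^ 2 * (c / (2 * (m ^ 2 + 1)) * 1) < c := by
    rw [mul_one, mul_div_assoc', div_lt_iff₀ (by positivity)]
    nlinarith [sq_nonneg (m : ℝ)]
  rw [Matrix.sub_mulVec, dotProduct_sub] at h2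
  have h4 : 0 < w ⬝ᵥ (A x).mulVec w := by linarith [(abs_le.mp h2).1]
  rw [hvw]
  simp only [star_trivial, Matrix.mulVec_smul, dotProduct_smul, smul_dotProduct, smul_eq_mul]
  positivity

end PosDef

/-! ### Extending paths to the line and recognizing regular paths. -/

section Extension

variable {m : ℕ} {Q : Matrix (Fin m) (Fin m) ℝ} {μ : Measure ℝ}
  {Φ : ℝ → Matrix (Fin m) (Fin m) ℝ}

/-- An extension `P` of the path `Φ` from `[0, m]` to the line, with derivative `P'`. -/
structure IsPathExtension (Φ P P' : ℝ → Matrix (Fin m) (Fin m) ℝ) : Prop where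
  eq : ∀ t ∈ Icc (0 : ℝ) m, P t = Φ t
  deriv_eq : ∀ t ∈ Icc (0 : ℝ) m, P' t = pathDeriv Φ t
  isC11 : ∀ i j, IsC11 (fun t => P t i j) (fun t => P' t i j)
  posSemidef_deriv : ∀ t, (P' t).PosSemidef
  isHermitian : ∀ t, (P t).IsHermitian

lemma IsRegularPath.exists_extension (hm : 1 ≤ m) (hp : IsRegularPath Q μ Φ) :
    ∃ P P', IsPathExtension Φ P P' := by
  have hm0 : (0 : ℝ) ≤ m := by positivity
  -- Freezing the derivative outside `[0, m]` keeps it Lipschitz and positive semidefinite, which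
  -- removes end points from all later perturbations.
  let P' : ℝ → Matrix (Fin m) (Fin m) ℝ := fun t => pathDeriv Φ (projIcc 0 (m : ℝ) hm0 t)
  let P : ℝ → Matrix (Fin m) (Fin m) ℝ := fun t => Matrix.of fun i j => ∫ s in (0 : ℝ)..t, P' s i j
  obtain ⟨K, hK⟩ := hp.lipschitz_deriv
  have hLip : ∀ i j, LipschitzWith K fun t => P' t i j := fun i j => by
    have := (hK i j).to_restrict.comp (LipschitzWith.projIcc hm0)
    rw [mul_one] at this
    exact this
  have hP' : ∀ t ∈ Icc (0 : ℝ) m, P' t = pathDeriv Φ t := fun t ht => by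
    simp only [P', projIcc_of_mem hm0 ht]
  have hpos : ∀ t, (P' t).PosSemidef := fun t =>
    hp.posSemidef_pathDeriv hm (projIcc 0 (m : ℝ) hm0 t).2
  refine ⟨P, P', fun t ht => ?_, hP', fun i j => ⟨fun t => ?_, (hLip i j).locallyLipschitz⟩, hpos,
    fun t => ?_⟩
  · ext i j
    have hsub : Icc 0 t ⊆ Icc (0 : ℝ) m := Icc_subset_Icc_right ht.2
    have := intervalIntegral.integral_eq_sub_of_hasDeriv_right_of_le (f := fun s => Φ s i j)
      (f' := fun s => P' s i j) ht.1 ((hp.continuousOn i j).mono hsub) (fun s hs => by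
        have hs' : s ∈ Ioo (0 : ℝ) m := ⟨hs.1, hs.2.trans_le ht.2⟩
        rw [hP' s (Ioo_subset_Icc_self hs')]
        exact ((hp.hasDerivWithinAt (Ioo_subset_Icc_self hs') i j).hasDerivAt
          (Icc_mem_nhds hs'.1 hs'.2)).hasDerivWithinAt)
      ((hLip i j).continuous.intervalIntegrable _ _)
    simpa [P, hp.start] using this
  · exact ((hLip i j).continuous.integral_hasStrictDerivAt 0 t).hasDerivAt
  · rw [isHermitian_iff_apply]
    intro i j
    simp only [P, Matrix.of_apply, apply_comm_of_posSemidef (hpos _) i j]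

lemma pathDeriv_eq_of_isC11 (hm : 1 ≤ m) {Ψ Ψ' : ℝ → Matrix (Fin m) (Fin m) ℝ}
    (hC : ∀ i j, IsC11 (fun t => Ψ t i j) (fun t => Ψ' t i j)) {t : ℝ} (ht : t ∈ Icc (0 : ℝ) m) :
    pathDeriv Ψ t = Ψ' t := by
  ext i j
  exact ((hC i j).hasDerivAt t).hasDerivWithinAt.derivWithin
    (uniqueDiffOn_Icc (by exact_mod_cast hm) t ht)

/-- Monotonicity holds because every quadratic form along the path has nonnegative derivative. -/
lemma isRegularPath_of_isC11 (hm : 1 ≤ m) {Ψ Ψ' : ℝ → Matrix (Fin m) (Fin m) ℝ} {ν : Measure ℝ}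
    (hC : ∀ i j, IsC11 (fun t => Ψ t i j) (fun t => Ψ' t i j))
    (hpos : ∀ t ∈ Icc (0 : ℝ) m, (Ψ' t).PosSemidef) (hherm : ∀ t, (Ψ t).IsHermitian)
    (h0 : Ψ 0 = 0) (hfin : Ψ m = Q) (htr : ∀ t ∈ ν.support, (Ψ t).trace = t) :
    IsRegularPath Q ν Ψ := by
  have hmono : ∀ s ∈ Icc (0 : ℝ) m, ∀ t ∈ Icc (0 : ℝ) m, s ≤ t → (Ψ t - Ψ s).PosSemidef := by
    intro s hs t ht hst
    refine posSemidef_iff_form.mpr ⟨(hherm t).sub (hherm s), fun v => ?_⟩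
    have hd : ∀ x, HasDerivAt (fun s => v ⬝ᵥ (Ψ s).mulVec v) (v ⬝ᵥ (Ψ' x).mulVec v) x := fun x =>
      (hasDerivWithinAt_form (S := univ) (fun i j => ((hC i j).hasDerivAt x).hasDerivWithinAt)
        v).hasDerivAt univ_mem
    have hmon : MonotoneOn (fun s => v ⬝ᵥ (Ψ s).mulVec v) (Icc (0 : ℝ) m) := by
      refine monotoneOn_of_deriv_nonneg (convex_Icc _ _)
        (fun x _ => (hd x).continuousAt.continuousWithinAt)
        (fun x _ => (hd x).differentiableAt.differentiableWithinAt) fun x hx => ?_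
      rw [(hd x).deriv]
      exact (posSemidef_iff_form.mp (hpos x (interior_subset hx))).2 v
    have := hmon hs ht hst
    rw [Matrix.sub_mulVec, dotProduct_sub]
    simpa using this
  have hunif : ∀ f : Fin m → Fin m → ℝ → ℝ, (∀ i j, LocallyLipschitz (f i j)) →
      ∃ K : NNReal, ∀ i j, LipschitzOnWith K (f i j) (Icc (0 : ℝ) m) := fun f hf => by
    choose K hK using fun i j => exists_lipschitzOnWith_Icc (hf i j) 0 m
    refine ⟨∑ i, ∑ j, K i j, fun i j => (hK i j).weaken ?_⟩
    exact (Finset.single_le_sum (f := fun j => K i j) (fun _ _ => zero_le) (Finset.mem_univ j)).trans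
      (Finset.single_le_sum (f := fun i => ∑ j, K i j) (fun _ _ => zero_le) (Finset.mem_univ i))
  have hm0 : (0 : ℝ) ∈ Icc (0 : ℝ) m := ⟨le_rfl, by positivity⟩
  refine ⟨fun t ht => ?_, hmono, h0, hfin, fun i j t _ =>
    ((hC i j).hasDerivAt t).differentiableAt.differentiableWithinAt,
    hunif _ fun i j => (hC i j).contDiff.locallyLipschitz, ?_, htr⟩
  · have := hmono 0 hm0 t ht ht.1
    rwa [h0, sub_zero] at this
  · obtain ⟨K, hK⟩ := hunif _ fun i j => (hC i j).locallyLipschitz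
    refine ⟨K, fun i j s hs t ht => ?_⟩
    simp only [pathDeriv_eq_of_isC11 hm hC ht, pathDeriv_eq_of_isC11 hm hC hs]
    exact hK i j hs ht

end Extension

/-! ### Competitors obtained by perturbing the path and changing time. -/

section Perturbation

variable {m : ℕ} {Q : Matrix (Fin m) (Fin m) ℝ} {μ : Measure ℝ}
  {Φ P P' : ℝ → Matrix (Fin m) (Fin m) ℝ}

lemma distFun_natCast_eq_one [IsProbabilityMeasure μ] (hc : μ (Icc (0 : ℝ) m)ᶜ = 0) :
    distFun μ m = 1 := by
  have : μ (Icc (0 : ℝ) m) = 1 := (prob_compl_eq_zero_iff measurableSet_Icc).mp hc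
  simp [distFun, Measure.real, this]

lemma exists_lt_distFun_eq_one [IsProbabilityMeasure μ] (hc : μ (Icc (0 : ℝ) m)ᶜ = 0) {s : ℝ}
    (hs : topPoint m μ < s) : ∃ t, t ∈ Icc (0 : ℝ) m ∧ t < s ∧ distFun μ t = 1 := by
  obtain ⟨t, ⟨ht, h1⟩, hts⟩ := exists_lt_of_csInf_lt
    (s := {t | t ∈ Icc (0 : ℝ) m ∧ distFun μ t = 1})
    ⟨(m : ℝ), ⟨by positivity, le_rfl⟩, distFun_natCast_eq_one hc⟩ hs
  exact ⟨t, ht, hts, h1⟩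

lemma topPoint_le {t : ℝ} (ht : t ∈ Icc (0 : ℝ) m) (h1 : distFun μ t = 1) : topPoint m μ ≤ t :=
  csInf_le ⟨0, fun _ hx => hx.1.1⟩ ⟨ht, h1⟩

lemma topPoint_nonneg : 0 ≤ topPoint m μ := Real.sInf_nonneg fun _ hx => hx.1.1

lemma ae_mem_Icc_of_distFun_eq_one [IsProbabilityMeasure μ] {t : ℝ} (h : distFun μ t = 1) :
    ∀ᵐ r ∂μ, r ∈ Icc 0 t := by
  have h1 : μ (Icc 0 t) = 1 := by
    rw [distFun, Measure.real] at h
    rw [← ENNReal.ofReal_toReal (measure_ne_top μ (Icc 0 t)), h, ENNReal.ofReal_one]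
  exact (mem_ae_iff_prob_eq_one measurableSet_Icc).mpr h1

lemma mem_support_of_mem_support_map (e : ℝ ≃ₜ ℝ) {t : ℝ} (ht : t ∈ (μ.map e).support) :
    e.symm t ∈ μ.support := by
  rw [Measure.mem_support_iff_forall] at ht ⊢
  intro U hU
  have := ht (e.symm ⁻¹' U) (e.symm.continuous.continuousAt hU)
  rw [← e.toMeasurableEquiv_coe, MeasurableEquiv.map_apply] at this
  simpa [← preimage_comp] using this

/-- A pair obtained from an increasing time change `e` of a path `P` followed by a smooth
interpolation to `Q` is admissible, and its functional is that of `P` in the old time. -/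
lemma exists_admissible_of_timeChange (hm : 1 ≤ m) [IsProbabilityMeasure μ]
    (β : ℕ → Fin m → ℝ) (h : Fin m → ℝ) {s t₀ : ℝ} (ht₀ : 0 ≤ t₀) (ht₀s : t₀ < s)
    (hμ : distFun μ t₀ = 1) (hC : ∀ i j, IsC11 (fun t => P t i j) (fun t => P' t i j))
    (hpos : ∀ t, (P' t).PosSemidef) (hherm : ∀ t, (P t).IsHermitian) (hQ : Q.IsHermitian)
    (h0 : P 0 = 0) (hdet : (Q - P s).PosDef)
    {τ τ' : ℝ → ℝ} (hτ : IsC11 τ τ') (hτ' : ∀ t, 1 / 2 ≤ τ' t) (hτ0 : τ 0 = 0) (hτs : τ s < m)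
    (htr : ∀ t ∈ μ.support, (P t).trace = τ t) :
    ∃ (ν : Measure ℝ) (Ψ : ℝ → Matrix (Fin m) (Fin m) ℝ), IsAdmissible Q ν Ψ ∧
      IsCutoff Q ν Ψ (τ s) ∧
      reduced β h Q ν Ψ (pathDeriv Ψ) (τ s) = reduced β h Q μ P P' s := by
  obtain ⟨e, he, hemono, heC⟩ := exists_homeomorph hτ hτ'
  have he' : ∀ t, e.symm (τ t) = t := fun t => by rw [← he, e.symm_apply_apply]
  have hlt : ∀ {a b}, τ a ≤ τ b ↔ a ≤ b := fun {a b} => by rw [← he, ← he]; exact hemono.le_iff_le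
  have hlt' : ∀ {a b}, τ a < τ b ↔ a < b := fun {a b} => by rw [← he, ← he]; exact hemono.lt_iff_lt
  have hs0 : 0 < s := ht₀.trans_lt ht₀s
  have ht1 : 0 < τ s := by rw [← hτ0]; exact hlt'.mpr hs0
  -- the time-changed path
  let R : ℝ → Matrix (Fin m) (Fin m) ℝ := fun t => P (e.symm t)
  let R' : ℝ → Matrix (Fin m) (Fin m) ℝ := fun t => (τ' (e.symm t))⁻¹ • P' (e.symm t)
  have hRC : ∀ i j, IsC11 (fun t => R t i j) (fun t => R' t i j) := fun i j => by
    have := (hC i j).comp heC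
    simpa only [R, R', Matrix.smul_apply, smul_eq_mul, mul_comm] using this
  have hτpos : ∀ t, 0 < τ' t := fun t => by have := hτ' t; linarith
  have hR'pos : ∀ t, (R' t).PosSemidef := fun t =>
    (hpos _).smul (inv_nonneg.mpr (hτpos _).le)
  have hRcont : Continuous R := continuous_pi fun i => continuous_pi fun j => (hRC i j).continuous
  have hev : ∀ᶠ t in 𝓝 (τ s), (Q - R t).PosDef := by
    refine eventually_posDef (A₀ := Q - P s) ?_ (Eventually.of_forall fun t => hQ.sub (hherm _)) hdet
    have hval : Q - R (τ s) = Q - P s := by simp only [R, he']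
    rw [← hval]
    exact (continuous_const.sub hRcont).tendsto (τ s)
  obtain ⟨δ, hδ, hball⟩ := Metric.eventually_nhds_iff.mp hev
  -- The window `[τ s, t₂]` is short enough that `Q - R` stays positive definite on it, and it
  -- closes before `m`.
  obtain ⟨t₂, ht12, ht2⟩ : ∃ t₂, τ s < t₂ ∧ t₂ < min (m : ℝ) (τ s + δ) :=
    exists_between (lt_min hτs (by linarith))
  have ht2m : t₂ < m := ht2.trans_le (min_le_left _ _)
  have ht2δ : t₂ < τ s + δ := ht2.trans_le (min_le_right _ _)
  have hQR : ∀ t ∈ Icc (τ s) t₂, (Q - R t).PosDef := fun t ht => by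
    refine hball ?_
    rw [Real.dist_eq, abs_of_nonneg (by linarith [ht.1])]
    linarith [ht.2]
  -- the interpolation to `Q`
  have hc : 0 < (t₂ - τ s)⁻¹ := inv_pos.mpr (by linarith)
  let w : ℝ → ℝ := fun t => Real.smoothTransition ((t₂ - τ s)⁻¹ * (t - τ s))
  let w' : ℝ → ℝ := fun t =>
    deriv Real.smoothTransition ((t₂ - τ s)⁻¹ * (t - τ s)) * (t₂ - τ s)⁻¹
  have hw : IsC11 w w' := isC11_smoothTransition.comp (isC11_affine _ _)
  have hw0 : ∀ t ≤ τ s, w t = 0 ∧ w' t = 0 := fun t ht => by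
    have : (t₂ - τ s)⁻¹ * (t - τ s) ≤ 0 := mul_nonpos_of_nonneg_of_nonpos hc.le (by linarith)
    exact ⟨Real.smoothTransition.zero_of_nonpos this, by
      simp only [w', deriv_smoothTransition_of_nonpos this, zero_mul]⟩
  have hw1 : ∀ t, t₂ ≤ t → w t = 1 ∧ w' t = 0 := fun t ht => by
    have : 1 ≤ (t₂ - τ s)⁻¹ * (t - τ s) := by
      rw [inv_mul_eq_div, one_le_div (by linarith)]; linarith
    exact ⟨Real.smoothTransition.one_of_one_le this, by
      simp only [w', deriv_smoothTransition_of_one_le this, zero_mul]⟩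
  -- The derivative is `(1 - w) R' + w' (Q - R)`. As `w'` vanishes off the window, the sign of `Q -
  -- R` is needed only there.
  let Ψ : ℝ → Matrix (Fin m) (Fin m) ℝ := fun t => (1 - w t) • R t + w t • Q
  let Ψ' : ℝ → Matrix (Fin m) (Fin m) ℝ := fun t => (1 - w t) • R' t + w' t • (Q - R t)
  have hΨC : ∀ i j, IsC11 (fun t => Ψ t i j) (fun t => Ψ' t i j) := fun i j => by
    have h1 : IsC11 (fun t => 1 + (-1) * w t) (fun t => 0 + (-1) * w' t) :=
      (isC11_const 1).add (hw.const_mul (-1))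
    have h2 := (h1.mul (hRC i j)).add (hw.const_mul (Q i j))
    convert h2 using 2 with t t
    · simp [Ψ]; ring
    · simp [Ψ']; ring
  have hΨ'pos : ∀ t, (Ψ' t).PosSemidef := fun t => by
    have hw'0 : 0 ≤ w' t := mul_nonneg (deriv_smoothTransition_nonneg _) hc.le
    have h1 : ((1 - w t) • R' t).PosSemidef :=
      (hR'pos t).smul (sub_nonneg.mpr (Real.smoothTransition.le_one _))
    refine h1.add ?_
    rcases le_total t (τ s) with ht | ht
    · rw [(hw0 t ht).2, zero_smul]; exact Matrix.PosSemidef.zero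
    rcases le_total t₂ t with ht' | ht'
    · rw [(hw1 t ht').2, zero_smul]; exact Matrix.PosSemidef.zero
    · exact (hQR t ⟨ht, ht'⟩).posSemidef.smul hw'0
  have hΨR : ∀ t ≤ τ s, Ψ t = R t ∧ Ψ' t = R' t := fun t ht => by
    simp [Ψ, Ψ', (hw0 t ht).1, (hw0 t ht).2]
  have hΨτ : ∀ r ≤ s, Ψ (τ r) = P r := fun r hr => by
    rw [(hΨR _ (hlt.mpr hr)).1]; simp only [R, he']
  have hprob : IsProbabilityMeasure (μ.map e) :=
    Measure.isProbabilityMeasure_map e.continuous.aemeasurable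
  -- The new measure lives on `[0, τ t₀]`, strictly before the interpolation, which therefore
  -- affects neither the trace constraint nor the reduced functional with cut-off `τ s`.
  have hdist : distFun (μ.map e) (τ t₀) = 1 := by
    rw [← hμ, distFun, distFun, Measure.real, Measure.real,
      Measure.map_apply e.measurable measurableSet_Icc]
    congr 2
    ext r
    simp only [mem_preimage, mem_Icc, he]
    rw [hlt, ← hτ0, hlt]; simp [hτ0]
  have haeμ := ae_mem_Icc_of_distFun_eq_one hμ
  have haeν := ae_mem_Icc_of_distFun_eq_one hdist
  have hτt : τ t₀ < τ s := hlt'.mpr ht₀s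
  have hτt0 : 0 ≤ τ t₀ := by rw [← hτ0]; exact hlt.mpr ht₀
  have htop : topPoint m (μ.map e) ≤ τ t₀ := topPoint_le ⟨hτt0, (hτt.trans hτs).le⟩ hdist
  have hsuppν : ∀ t ∈ (μ.map e).support, t ≤ τ s := fun t ht => by
    have : (μ.map e).support ⊆ Icc 0 (τ t₀) :=
      Measure.support_subset_of_isClosed isClosed_Icc haeν
    exact (this ht).2.trans hτt.le
  have hreg : IsRegularPath Q (μ.map e) Ψ := by
    refine isRegularPath_of_isC11 hm hΨC (fun t _ => hΨ'pos t) (fun t => ?_) ?_ ?_ fun t ht => ?_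
    · have hR : (R t).IsHermitian := hherm _
      rw [isHermitian_iff_apply] at hR hQ ⊢
      intro i j
      simp [Ψ, hR i j, hQ i j]
    · have := hΨτ 0 hs0.le
      rwa [hτ0, h0] at this
    · simp [Ψ, (hw1 m ht2m.le).1]
    · rw [(hΨR t (hsuppν t ht)).1]
      simp only [R]
      rw [htr _ (mem_support_of_mem_support_map e ht), ← he, e.apply_symm_apply]
  have hmem : τ s ∈ Icc (0 : ℝ) m := ⟨ht1.le, hτs.le⟩
  have hQΨ : (Q - Ψ (τ s)).PosDef := by rw [hΨτ s le_rfl]; exact hdet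
  have htopmem : topPoint m (μ.map e) ∈ Icc (0 : ℝ) m :=
    ⟨topPoint_nonneg, htop.trans (hτt.trans hτs).le⟩
  have hdettop : 0 < (Q - Ψ (topPoint m (μ.map e))).det := by
    -- `Q - Ψ` at the top point is the positive definite `Q - Ψ (τ s)` plus an increment of the
    -- path.
    have h1 := hreg.monotone _ htopmem _ hmem (htop.trans hτt.le)
    have h2 := hQΨ.add_posSemidef h1
    rw [sub_add_sub_cancel] at h2
    exact h2.det_pos
  refine ⟨μ.map e, Ψ, ⟨hprob, ?_, hreg, htop.trans_lt (hτt.trans hτs), hdettop⟩,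
    ⟨htop.trans_lt hτt, hτs, hQΨ.det_pos⟩, ?_⟩
  · have : ∀ᵐ r ∂(μ.map e), r ∈ Icc (0 : ℝ) m := haeν.mono fun r hr =>
      ⟨hr.1, hr.2.trans (hτt.trans hτs).le⟩
    rwa [ae_iff] at this
  -- comparison of the functionals
  have hmape : ∀ f : ℝ → ℝ, ∫ r, f r ∂(μ.map e) = ∫ r, f (τ r) ∂μ := fun f => by
    rw [← e.toMeasurableEquiv_coe, integral_map_equiv]
    simp [he]
  rw [reduced, reduced, hmape, hΨτ s le_rfl]
  congr 1
  · congr 2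
    refine integral_congr_ae ?_
    filter_upwards [haeμ] with r hr
    rw [hΨτ r (hr.2.trans ht₀s.le)]
  · have himg : τ '' Icc 0 s = Icc 0 (τ s) := by
      ext t
      constructor
      · rintro ⟨r, hr, rfl⟩
        exact ⟨by rw [← hτ0]; exact hlt.mpr hr.1, hlt.mpr hr.2⟩
      · intro ht
        have h3 : τ (e.symm t) = t := by rw [← he, e.apply_symm_apply]
        refine ⟨e.symm t, ⟨?_, ?_⟩, h3⟩
        · rw [← hlt, h3, hτ0]; exact ht.1
        · rw [← hlt, h3]; exact ht.2
    -- Substituting `t = τ u`, the Jacobian `τ' u` cancels the factor `(τ' u)⁻¹` in the derivative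
    -- of the time-changed path.
    rw [intervalIntegral.integral_of_le ht1.le, intervalIntegral.integral_of_le hs0.le,
      ← integral_Icc_eq_integral_Ioc, ← integral_Icc_eq_integral_Ioc, ← himg,
      integral_image_eq_integral_deriv_smul_of_monotoneOn measurableSet_Icc
        (fun t _ => (hτ.hasDerivAt t).hasDerivWithinAt) (fun a _ b _ hab => hlt.mpr hab)]
    refine setIntegral_congr_fun measurableSet_Icc fun u hu => ?_
    have h1 : hatMean Q (μ.map e) Ψ (τ u) = hatMean Q μ P u := by
      ext i j
      simp only [hatMean, Matrix.of_apply]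
      rw [hmape]
      congr 1
      refine integral_congr_ae ?_
      filter_upwards [haeμ] with r hr
      have : max (τ r) (τ u) = τ (max r u) := by
        have hmon : Monotone τ := fun a b hab => hlt.mpr hab
        exact (hmon.map_max).symm
      rw [this, hΨτ _ (max_le (hr.2.trans ht₀s.le) hu.2)]
    have hu' : τ u ∈ Icc (0 : ℝ) m :=
      ⟨by rw [← hτ0]; exact hlt.mpr hu.1, (hlt.mpr hu.2).trans hτs.le⟩
    have h2 : pathDeriv Ψ (τ u) = (τ' u)⁻¹ • P' u := by
      rw [pathDeriv_eq_of_isC11 hm hΨC hu', (hΨR _ (hlt.mpr hu.2)).2]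
      simp only [R', he']
    simp only [h1, h2, frob_smul_right, smul_eq_mul]
    rw [← mul_assoc, mul_inv_cancel₀ (hτpos u).ne', one_mul]

lemma IsPathExtension.reduced_eq (hE : IsPathExtension Φ P P') [IsProbabilityMeasure μ]
    (β : ℕ → Fin m → ℝ) (h : Fin m → ℝ) (hc : μ (Icc (0 : ℝ) m)ᶜ = 0) {s : ℝ}
    (hs : s ∈ Icc (0 : ℝ) m) :
    reduced β h Q μ Φ (pathDeriv Φ) s = reduced β h Q μ P P' s := by
  obtain ⟨h0, h1⟩ := ae_mem_of_concentrated hc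
  rw [reduced, reduced, hE.eq s hs]
  congr 1
  · congr 2
    refine integral_congr_ae ?_
    filter_upwards [h0, h1] with r hr hr'
    rw [hE.eq r ⟨hr, hr'⟩]
  · refine intervalIntegral.integral_congr fun t ht => ?_
    rw [uIcc_of_le hs.1] at ht
    have : hatMean Q μ Φ t = hatMean Q μ P t := by
      ext i j
      simp only [hatMean, Matrix.of_apply]
      congr 1
      refine integral_congr_ae ?_
      filter_upwards [h0, h1] with r hr hr'
      rw [hE.eq _ ⟨hr.trans (le_max_left _ _), max_le hr' (ht.2.trans hs.2)⟩]
    simp only [this, hE.deriv_eq t ⟨ht.1, ht.2.trans hs.2⟩]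

/-- Perturbations of the path of a minimizer, not subject to the trace constraint, do not decrease
the functional. -/
theorem IsCSMinimizer.eventually_reduced_le (hm : 1 ≤ m) {β : ℕ → Fin m → ℝ}
    (hβ : IsEvenMixture β) {h : Fin m → ℝ} (hQ : IsConstraint Q)
    (hmin : IsCSMinimizer β h Q μ Φ) (hE : IsPathExtension Φ P P') {s : ℝ}
    (hs : IsCutoff Q μ Φ s) {η η' : ℝ → Matrix (Fin m) (Fin m) ℝ}
    (hη : ∀ i j, IsC11 (fun t => η t i j) (fun t => η' t i j)) (hη0 : η 0 = 0)
    (hηh : ∀ t, (η t).IsHermitian) {κ κ' : ℝ → ℝ} (hκ : IsC11 κ κ') (hκ0 : κ 0 = 0) {C : ℝ}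
    (hκ' : ∀ t, |κ' t| ≤ C) (htr : ∀ t ∈ μ.support, (η t).trace = κ t)
    (hpos : ∀ᶠ ε in 𝓝[>] (0 : ℝ), ∀ t, (P' t + ε • η' t).PosSemidef) :
    ∀ᶠ ε in 𝓝[>] (0 : ℝ), reduced β h Q μ P P' s ≤
      reduced β h Q μ (fun t => P t + ε • η t) (fun t => P' t + ε • η' t) s := by
  have hprob := hmin.1.prob
  have hconc := hmin.1.concentrated
  have hp := hmin.1.path
  obtain ⟨t₀, ht₀, ht₀s, hμt₀⟩ := exists_lt_distFun_eq_one hconc hs.1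
  have hs0 : 0 < s := ht₀.1.trans_lt ht₀s
  have hsm : s ∈ Icc (0 : ℝ) m := ⟨hs0.le, hs.2.1.le⟩
  have hQs : (Q - P s).PosDef := by
    rw [hE.eq s hsm]
    refine posDef_of_det_pos ?_ hs.2.2
    rw [← hp.finish]
    exact hp.monotone s hsm m ⟨by positivity, le_rfl⟩ hsm.2
  have hlin : ∀ a b : ℝ, Tendsto (fun ε : ℝ => a + ε * b) (𝓝[>] 0) (𝓝 a) := fun a b => by
    have : Tendsto (fun ε : ℝ => a + ε * b) (𝓝 0) (𝓝 (a + 0 * b)) :=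
      Continuous.tendsto (by fun_prop) 0
    rw [zero_mul, add_zero] at this
    exact this.mono_left nhdsWithin_le_nhds
  have hsmul : ∀ {A : Matrix (Fin m) (Fin m) ℝ} (ε : ℝ), A.IsHermitian → (ε • A).IsHermitian := by
    intro A ε hA
    rw [isHermitian_iff_apply] at hA ⊢
    intro i j
    simp [hA i j]
  have hev1 : ∀ᶠ ε in 𝓝[>] (0 : ℝ), (Q - (P s + ε • η s)).PosDef := by
    refine eventually_posDef ?_ (Eventually.of_forall fun ε =>
      hQ.posSemidef.1.sub ((hE.isHermitian s).add (hsmul ε (hηh s)))) hQs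
    refine tendsto_pi_nhds.mpr fun i => tendsto_pi_nhds.mpr fun j => ?_
    exact tendsto_const_nhds.sub (hlin (P s i j) (η s i j))
  have hev2 : ∀ᶠ ε in 𝓝[>] (0 : ℝ), s + ε * κ s < m := (hlin s (κ s)).eventually_lt_const hs.2.1
  -- Keeps the derivative `1 + ε κ'` of the time change above `1 / 2`.
  have hev3 : ∀ᶠ ε in 𝓝[>] (0 : ℝ), 1 / 2 < 1 + ε * (-C) :=
    (hlin 1 (-C)).eventually_const_lt (by norm_num)
  filter_upwards [hev1, hev2, hev3, hpos, self_mem_nhdsWithin] with ε h1 h2 h3 h4 h5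
  have hε : 0 < ε := h5
  have hid : IsC11 (fun t : ℝ => t) fun _ => 1 :=
    ⟨fun t => hasDerivAt_id t, LocallyLipschitz.const 1⟩
  obtain ⟨ν, Ψ, hadm, hcut, hred⟩ := exists_admissible_of_timeChange (Q := Q) hm β h
    (P := fun t => P t + ε • η t) (P' := fun t => P' t + ε • η' t) ht₀.1 ht₀s hμt₀
    (fun i j => (hE.isC11 i j).add ((hη i j).const_mul ε)) h4
    (fun t => (hE.isHermitian t).add (hsmul ε (hηh t))) hQ.posSemidef.1
    (by simp [hη0, hE.eq 0 ⟨le_rfl, by positivity⟩, hp.start]) h1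
    -- On the support this is the trace of the perturbed path, so reparametrizing by it restores the
    -- trace constraint.
    (τ := fun t => t + ε * κ t) (τ' := fun t => 1 + ε * κ' t)
    (hid.add (hκ.const_mul ε))
    (fun t => by
      have : ε * (-C) ≤ ε * κ' t := by gcongr; exact (abs_le.mp (hκ' t)).1
      linarith)
    (by simp [hκ0]) h2
    (fun t ht => by
      have htm : t ∈ Icc (0 : ℝ) m :=
        Measure.support_subset_of_isClosed isClosed_Icc (mem_ae_iff.mpr hconc) ht
      rw [Matrix.trace_add, Matrix.trace_smul, htr t ht, hE.eq t htm, hp.trace_eq t ht, smul_eq_mul])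
  have hle := hmin.2 ν Ψ hadm s _ hs hcut
  have hprobν := hadm.prob
  rw [crisantiSommers_eq_reduced hβ h hQ hconc hp hsm,
    crisantiSommers_eq_reduced hβ h hQ hadm.concentrated hadm.path
      ⟨topPoint_nonneg.trans hcut.1.le, hcut.2.1.le⟩, hred, hE.reduced_eq β h hconc hsm] at hle
  linarith

end Perturbation

/-! ### Integration by parts and differentiation under the integral. -/

section Variation

/-- Integration by parts with a right derivative of the form `x y`. -/
lemma integral_by_parts_distFun {μ : Measure ℝ} [IsProbabilityMeasure μ] {s : ℝ} (hs0 : 0 ≤ s)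
    (h0 : ∀ᵐ r ∂μ, 0 ≤ r) (hs : ∀ᵐ r ∂μ, r ≤ s) {z y e e' : ℝ → ℝ} (hz : Continuous z)
    (hy : Continuous y) (he : ∀ t, HasDerivAt e (e' t) t) (he' : Continuous e') (he0 : e 0 = 0)
    (hzd : ∀ t ∈ Ioo 0 s, HasDerivWithinAt z (distFun μ t * y t) (Ioi t) t) :
    (∫ t in (0 : ℝ)..s, (z t * e' t + (∫ r, e (max r t) ∂μ) * y t)) - z s * e s =
      ∫ r, (∫ t in (0 : ℝ)..r, y t) * e r ∂μ := by
  have hec : Continuous e := continuous_iff_continuousAt.mpr fun t => (he t).continuousAt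
  have hmono : Monotone (distFun μ) := fun a b hab =>
    measureReal_mono (Icc_subset_Icc_right hab)
  have hxi : ∀ {g : ℝ → ℝ}, Continuous g → ∀ a b,
      IntervalIntegrable (fun t => distFun μ t * g t) volume a b := fun hg a b =>
    (hmono.intervalIntegrable).mul_continuousOn hg.continuousOn
  have hye : Continuous fun t => y t * e t := hy.mul hec
  have hze : Continuous fun t => z t * e' t := hz.mul he'
  -- The fundamental theorem for `z e`; only a right derivative of `z` exists where `x` jumps.
  have hftc : ∫ t in (0 : ℝ)..s, (distFun μ t * (y t * e t) + z t * e' t) = z s * e s := by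
    have := intervalIntegral.integral_eq_sub_of_hasDeriv_right_of_le (f := fun t => z t * e t)
      (f' := fun t => distFun μ t * (y t * e t) + z t * e' t) hs0 (hz.mul hec).continuousOn
      (fun t ht => by
        have := (hzd t ht).mul (he t).hasDerivWithinAt
        exact this.congr_deriv (by ring))
      ((hxi hye _ _).add (hze.intervalIntegrable _ _))
    simpa [he0] using this
  rw [intervalIntegral.integral_add (hxi hye _ _) (hze.intervalIntegrable _ _),
    integral_distFun_mul hs0 h0 hs hye] at hftc
  obtain ⟨Ce, hCe⟩ := isCompact_Icc.exists_bound_of_continuousOn (s := Icc 0 s) hec.continuousOn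
  obtain ⟨Cy, hCy⟩ := isCompact_Icc.exists_bound_of_continuousOn (s := Icc 0 s) hy.continuousOn
  have hCe0 : 0 ≤ Ce := (norm_nonneg _).trans (hCe 0 ⟨le_rfl, hs0⟩)
  have hswap := intervalIntegral_integral_swap (μ := μ) hs0 (C := Ce * Cy)
    (K := fun r t => e (max r t) * y t)
    (((hec.comp (continuous_fst.max continuous_snd)).mul
      (hy.comp continuous_snd)).measurable) (by
      filter_upwards [h0, hs] with r hr hrs t ht
      rw [abs_mul]
      exact mul_le_mul (hCe _ ⟨hr.trans (le_max_left _ _), max_le hrs ht.2⟩) (hCy t ht)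
        (abs_nonneg _) hCe0)
  simp only [integral_mul_const] at hswap
  -- Mass at `r` sees `e r` before time `r` and `e t` afterwards. The second part cancels against
  -- the `x y e` term of `hftc`.
  have hsplit : ∀ᵐ r ∂μ, ∫ t in (0 : ℝ)..s, e (max r t) * y t =
      (∫ t in (0 : ℝ)..r, y t) * e r + ∫ t in (max r 0)..s, y t * e t := by
    filter_upwards [h0, hs] with r hr hrs
    have hcont : Continuous fun t => e (max r t) * y t :=
      (hec.comp (continuous_const.max continuous_id)).mul hy
    rw [max_eq_left hr, ← intervalIntegral.integral_add_adjacent_intervals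
      (hcont.intervalIntegrable 0 r) (hcont.intervalIntegrable r s),
      ← intervalIntegral.integral_mul_const]
    congr 1
    · refine intervalIntegral.integral_congr fun t ht => ?_
      rw [uIcc_of_le hr] at ht
      simp only [max_eq_left ht.2]; ring
    · refine intervalIntegral.integral_congr fun t ht => ?_
      rw [uIcc_of_le hrs] at ht
      simp only [max_eq_right ht.1]; ring
  have hyint : Continuous fun r => ∫ t in (0 : ℝ)..r, y t :=
    intervalIntegral.continuous_primitive (fun a b => hy.intervalIntegrable a b) 0
  have hyeint : Continuous fun r => ∫ t in (max r 0)..s, y t * e t := by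
    have h1 : Continuous fun r => ∫ t in s..r, y t * e t :=
      intervalIntegral.continuous_primitive (fun a b => (hy.mul hec).intervalIntegrable a b) s
    simp only [intervalIntegral.integral_symm s]
    exact (h1.comp (continuous_id.max continuous_const)).neg
  have hyinte : Continuous fun r => (∫ t in (0 : ℝ)..r, y t) * e r := hyint.mul hec
  rw [integral_congr_ae hsplit, integral_add
    (integrable_of_continuousOn_Icc hyinte.continuousOn h0 hs)
    (integrable_of_continuousOn_Icc hyeint.continuousOn h0 hs)] at hswap
  have hmaxcont : IntervalIntegrable (fun t => (∫ r, e (max r t) ∂μ) * y t) volume 0 s := by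
    have h1 : ContinuousOn (fun t => (∫ r, e (max r t) ∂μ) * y t) (Icc 0 s) := by
      refine ContinuousOn.mul ?_ hy.continuousOn
      refine continuousOn_of_dominated (bound := fun _ => Ce) (fun t _ =>
        (hec.comp (continuous_id.max continuous_const)).aestronglyMeasurable) (fun t ht => ?_)
        (integrable_const _) (Eventually.of_forall fun r =>
          (hec.comp (continuous_const.max continuous_id)).continuousOn)
      filter_upwards [h0, hs] with r hr hrs
      exact hCe _ ⟨hr.trans (le_max_left _ _), max_le hrs ht.2⟩
    exact (h1.mono (by rw [uIcc_of_le hs0])).intervalIntegrable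
  rw [intervalIntegral.integral_add (hze.intervalIntegrable _ _) hmaxcont, hswap]
  linarith

lemma exists_entry_bound {m : ℕ} {A : ℝ → Matrix (Fin m) (Fin m) ℝ} {K : Set ℝ}
    (hK : IsCompact K) (hA : ContinuousOn A K) : ∃ C, 0 ≤ C ∧ ∀ t ∈ K, ∀ i j, |A t i j| ≤ C := by
  have hb : ∀ i j, ∃ C, ∀ t ∈ K, ‖A t i j‖ ≤ C := fun i j =>
    hK.exists_bound_of_continuousOn ((continuous_apply_apply i j).comp_continuousOn hA)
  choose C hC using hb
  refine ⟨∑ i, ∑ j, |C i j|, Finset.sum_nonneg fun _ _ => Finset.sum_nonneg fun _ _ =>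
    abs_nonneg _, fun t ht i j => (hC i j t ht).trans ?_⟩
  exact (le_abs_self _).trans ((Finset.single_le_sum (f := fun j => |C i j|)
    (fun _ _ => abs_nonneg _) (Finset.mem_univ j)).trans
      (Finset.single_le_sum (f := fun i => ∑ j, |C i j|)
        (fun _ _ => Finset.sum_nonneg fun _ _ => abs_nonneg _) (Finset.mem_univ i)))

/-- Joint continuity in `(ε, t)` near `ε = 0` and compactness of `K` give a uniform bound, which
later serves as the dominating constant. -/
lemma eventually_inv_bounded {m : ℕ} {A E : ℝ → Matrix (Fin m) (Fin m) ℝ} (hA : Continuous A)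
    (hE : Continuous E) {K : Set ℝ} (hK : IsCompact K) (hdet : ∀ t ∈ K, (A t).det ≠ 0) :
    ∃ C, ∀ᶠ ε in 𝓝 (0 : ℝ), ∀ t ∈ K, (A t + ε • E t).det ≠ 0 ∧
      ∀ i j, |(A t + ε • E t)⁻¹ i j| ≤ C := by
  have hcontinv : ContinuousOn (fun t => (A t)⁻¹) K := fun t ht =>
    ((continuousAt_inv_apply (hdet t ht)).comp hA.continuousAt).continuousWithinAt
  obtain ⟨C, -, hC⟩ := exists_entry_bound hK hcontinv
  refine ⟨C + 1, hK.eventually_forall_of_forall_eventually fun t ht => ?_⟩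
  have hjoint : Continuous fun p : ℝ × ℝ => A p.2 + p.1 • E p.2 :=
    (hA.comp continuous_snd).add (continuous_fst.smul (hE.comp continuous_snd))
  have hval : A t + (0 : ℝ) • E t = A t := by simp
  have hd : (A t + (0 : ℝ) • E t).det ≠ 0 := by rw [hval]; exact hdet t ht
  have h1 : ∀ᶠ p : ℝ × ℝ in 𝓝 (0, t), (A p.2 + p.1 • E p.2).det ≠ 0 :=
    hjoint.matrix_det.continuousAt.eventually_ne hd
  have h2 : ContinuousAt (fun p : ℝ × ℝ => (A p.2 + p.1 • E p.2)⁻¹) (0, t) :=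
    ContinuousAt.comp (f := fun p : ℝ × ℝ => A p.2 + p.1 • E p.2)
      (continuousAt_inv_apply hd) hjoint.continuousAt
  have h3 : ∀ i j, ∀ᶠ p : ℝ × ℝ in 𝓝 (0, t),
      |(A p.2 + p.1 • E p.2)⁻¹ i j| < C + 1 := fun i j => by
    have h4 := (((continuous_apply j).comp (continuous_apply i)).continuousAt.comp h2).abs
    refine h4.eventually_lt_const ?_
    simp only [Function.comp, hval]
    linarith [hC t ht i j]
  have h4 : ∀ᶠ p : ℝ × ℝ in 𝓝 (0, t), ∀ i j,
      |(A p.2 + p.1 • E p.2)⁻¹ i j| < C + 1 := by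
    simp only [eventually_all]; exact h3
  filter_upwards [h1, h4] with p hp1 hp2 using ⟨hp1, fun i j => (hp2 i j).le⟩

lemma integrand_quotient {m : ℕ} {A E D D' : Matrix (Fin m) (Fin m) ℝ} {ε : ℝ} (hε : ε ≠ 0)
    (hA : A.det ≠ 0) (hAE : (A + ε • E).det ≠ 0) :
    ε⁻¹ * (frob (A + ε • E)⁻¹ (D + ε • D') - frob A⁻¹ D) =
      frob (A + ε • E)⁻¹ D' - frob ((A + ε • E)⁻¹ * E * A⁻¹) D := by
  have h1 := inv_sub_inv_eq hA hAE
  rw [add_sub_cancel_left, Matrix.mul_smul, Matrix.smul_mul] at h1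
  have h2 : frob (A + ε • E)⁻¹ D - frob A⁻¹ D = -(ε * frob ((A + ε • E)⁻¹ * E * A⁻¹) D) := by
    rw [← frob_sub_left, h1, frob_neg_left, frob_smul_left]
  rw [frob_add_right, frob_smul_right]
  field_simp
  linarith

lemma tendsto_frob {α : Type*} {l : Filter α} {m : ℕ}
    {A B : α → Matrix (Fin m) (Fin m) ℝ} {A₀ B₀ : Matrix (Fin m) (Fin m) ℝ}
    (hA : Tendsto A l (𝓝 A₀)) (hB : Tendsto B l (𝓝 B₀)) :
    Tendsto (fun x => frob (A x) (B x)) l (𝓝 (frob A₀ B₀)) :=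
  tendsto_finsetSum _ fun i _ => tendsto_finsetSum _ fun j _ =>
    (tendsto_pi_nhds.mp (tendsto_pi_nhds.mp hA i) j).mul
      (tendsto_pi_nhds.mp (tendsto_pi_nhds.mp hB i) j)

lemma abs_mul_apply_le {m : ℕ} {A B : Matrix (Fin m) (Fin m) ℝ} {a b : ℝ} (ha : 0 ≤ a)
    (hA : ∀ i j, |A i j| ≤ a) (hB : ∀ i j, |B i j| ≤ b) (i j : Fin m) :
    |(A * B) i j| ≤ m * (a * b) := by
  rw [Matrix.mul_apply]
  calc |∑ k, A i k * B k j| ≤ ∑ k, |A i k * B k j| := Finset.abs_sum_le_sum_abs _ _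
    _ ≤ ∑ _k : Fin m, a * b := Finset.sum_le_sum fun k _ => by
        rw [abs_mul]; exact mul_le_mul (hA i k) (hB k j) (abs_nonneg _) ha
    _ = m * (a * b) := by simp

/-- Differentiation of `ε ↦ ∫ ⟨(A + ε E)⁻¹, D + ε D'⟩` at `0`. -/
lemma tendsto_quotient_integral_inv {m : ℕ} {A E D D' : ℝ → Matrix (Fin m) (Fin m) ℝ}
    (hA : Continuous A) (hE : Continuous E) (hD : Continuous D) (hD' : Continuous D') {s : ℝ}
    (hs : 0 ≤ s) (hdet : ∀ t ∈ Icc 0 s, (A t).det ≠ 0) :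
    Tendsto (fun ε : ℝ => ε⁻¹ * ((∫ t in (0 : ℝ)..s, frob (A t + ε • E t)⁻¹ (D t + ε • D' t)) -
        ∫ t in (0 : ℝ)..s, frob (A t)⁻¹ (D t))) (𝓝[>] 0)
      (𝓝 (∫ t in (0 : ℝ)..s, (frob (A t)⁻¹ (D' t) - frob ((A t)⁻¹ * E t * (A t)⁻¹) (D t)))) := by
  obtain ⟨C, hC⟩ := eventually_inv_bounded hA hE isCompact_Icc hdet
  have hC0 := hC.self_of_nhds
  simp only [zero_smul, add_zero] at hC0
  -- The sign of `C` can be read off only if an index exists; `m = 0` is treated apart in the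
  -- domination step.
  have hCnn : ∀ i : Fin m, 0 ≤ C := fun i =>
    (abs_nonneg _).trans ((hC0 0 ⟨le_rfl, hs⟩).2 i i)
  obtain ⟨d, hd0, hd⟩ := exists_entry_bound (isCompact_Icc (a := 0) (b := s)) hD.continuousOn
  obtain ⟨d', hd0', hd'⟩ := exists_entry_bound (isCompact_Icc (a := 0) (b := s)) hD'.continuousOn
  obtain ⟨e, he0, he⟩ := exists_entry_bound (isCompact_Icc (a := 0) (b := s)) hE.continuousOn
  have hCε := nhdsWithin_le_nhds (s := Ioi (0 : ℝ)) hC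
  have hinvAt : ∀ ε : ℝ, ∀ t, (A t + ε • E t).det ≠ 0 →
      ContinuousAt (fun t => (A t + ε • E t)⁻¹) t := fun ε t h =>
    ContinuousAt.comp (f := fun t => A t + ε • E t) (continuousAt_inv_apply h)
      (hA.add (hE.const_smul ε)).continuousAt
  have hinvAt0 : ∀ t ∈ Icc 0 s, ContinuousAt (fun t => (A t)⁻¹) t := fun t ht =>
    (continuousAt_inv_apply (hdet t ht)).comp hA.continuousAt
  have hfrobOn : ∀ {B B' : ℝ → Matrix (Fin m) (Fin m) ℝ}, (∀ t ∈ Icc 0 s, ContinuousAt B t) →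
      Continuous B' → IntervalIntegrable (fun t => frob (B t) (B' t)) volume 0 s :=
    fun {B B'} hB hB' => ContinuousOn.intervalIntegrable (by
      rw [uIcc_of_le hs]
      exact fun t ht => (tendsto_frob (hB t ht).tendsto (hB'.tendsto t)).mono_left
        nhdsWithin_le_nhds)
  have hquot : ∀ᶠ ε in 𝓝[>] (0 : ℝ), (∫ t in (0 : ℝ)..s, (frob (A t + ε • E t)⁻¹ (D' t) -
      frob ((A t + ε • E t)⁻¹ * E t * (A t)⁻¹) (D t))) =
      ε⁻¹ * ((∫ t in (0 : ℝ)..s, frob (A t + ε • E t)⁻¹ (D t + ε • D' t)) -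
        ∫ t in (0 : ℝ)..s, frob (A t)⁻¹ (D t)) := by
    filter_upwards [hCε, self_mem_nhdsWithin] with ε h1 h2
    have hDD : Continuous fun t => D t + ε • D' t := hD.add (hD'.const_smul ε)
    rw [← intervalIntegral.integral_sub (hfrobOn
      (fun t ht => hinvAt ε t (h1 t ht).1) hDD) (hfrobOn hinvAt0 hD), ← intervalIntegral.integral_const_mul]
    refine intervalIntegral.integral_congr fun t ht => ?_
    rw [uIcc_of_le hs] at ht
    exact (integrand_quotient (ne_of_gt h2) (hdet t ht) (h1 t ht).1).symm
  refine Tendsto.congr' hquot ?_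
  refine intervalIntegral.tendsto_integral_filter_of_dominated_convergence
    (fun _ => m ^ 2 * (C * d') + m ^ 2 * (m * (m * (C * e) * C) * d)) ?_ ?_ (by simp) ?_
  · filter_upwards [hCε] with ε h1
    have h2 : IntervalIntegrable (fun t => frob (A t + ε • E t)⁻¹ (D' t) -
      frob ((A t + ε • E t)⁻¹ * E t * (A t)⁻¹) (D t)) volume 0 s :=
      (hfrobOn (fun t ht => hinvAt ε t (h1 t ht).1) hD').sub
        (hfrobOn (fun t ht => ((hinvAt ε t (h1 t ht).1).mul hE.continuousAt).mul
          (hinvAt0 t ht)) hD)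
    rw [uIoc_of_le hs]
    exact h2.1.aestronglyMeasurable
  · filter_upwards [hCε] with ε h1
    refine Eventually.of_forall fun t ht => ?_
    rw [uIoc_of_le hs] at ht
    have ht' := Ioc_subset_Icc_self ht
    rcases isEmpty_or_nonempty (Fin m) with hemp | ⟨⟨i⟩⟩
    · have : m = 0 := by
        have := Fintype.card_eq_zero_iff.mpr hemp
        rwa [Fintype.card_fin] at this
      simp [frob, this]
    have hCp := hCnn i
    rw [Real.norm_eq_abs]
    refine (abs_sub _ _).trans (add_le_add ?_ ?_)
    · exact abs_frob_le hCp (h1 t ht').2 (hd' t ht')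
    · refine abs_frob_le (by positivity) (fun i j => ?_) (hd t ht')
      exact abs_mul_apply_le (by positivity)
        (fun i j => abs_mul_apply_le hCp (h1 t ht').2 (he t ht') i j) (hC0 t ht').2 i j
  · refine Eventually.of_forall fun t ht => ?_
    rw [uIoc_of_le hs] at ht
    have ht' := Ioc_subset_Icc_self ht
    have hlim : Tendsto (fun ε : ℝ => (A t + ε • E t)⁻¹) (𝓝[>] 0) (𝓝 (A t)⁻¹) := by
      have h1 : Tendsto (fun ε : ℝ => A t + ε • E t) (𝓝[>] 0) (𝓝 (A t)) := by
        have : Tendsto (fun ε : ℝ => A t + ε • E t) (𝓝 0) (𝓝 (A t + (0 : ℝ) • E t)) :=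
          (continuous_const.add (continuous_id.smul continuous_const)).tendsto 0
        rw [zero_smul, add_zero] at this
        exact this.mono_left nhdsWithin_le_nhds
      exact (continuousAt_inv_apply (hdet t ht')).tendsto.comp h1
    exact (tendsto_frob hlim tendsto_const_nhds).sub
      (tendsto_frob ((hlim.mul tendsto_const_nhds).mul tendsto_const_nhds) tendsto_const_nhds)

end Variation

/-! ### The matrix `P̂` and its one-sided derivatives. -/

section Setup

variable {m : ℕ} {Q : Matrix (Fin m) (Fin m) ℝ} {μ : Measure ℝ}
  {P P' : ℝ → Matrix (Fin m) (Fin m) ℝ} {s : ℝ}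

/-- A path on the line and a probability measure on `[0, s]` with `Q - P(s)` positive definite. -/
structure IsPathData (Q : Matrix (Fin m) (Fin m) ℝ) (μ : Measure ℝ)
    (P P' : ℝ → Matrix (Fin m) (Fin m) ℝ) (s : ℝ) : Prop where
  prob : IsProbabilityMeasure μ
  nonneg : ∀ᵐ r ∂μ, 0 ≤ r
  le : ∀ᵐ r ∂μ, r ≤ s
  pos : 0 < s
  isC11 : ∀ i j, IsC11 (fun t => P t i j) (fun t => P' t i j)
  posSemidef_deriv : ∀ t, (P' t).PosSemidef
  isHermitian : ∀ t, (P t).IsHermitian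
  start : P 0 = 0
  posDef : (Q - P s).PosDef
  abs_le : ∀ t ∈ Icc 0 s, ∀ i j, |P t i j| ≤ 1

/-- `P̂` extended to the line. -/
noncomputable def hatExt (Q : Matrix (Fin m) (Fin m) ℝ) (μ : Measure ℝ)
    (P P' : ℝ → Matrix (Fin m) (Fin m) ℝ) (s t : ℝ) : Matrix (Fin m) (Fin m) ℝ :=
  Matrix.of fun i j => (Q - P s) i j + ∫ u in t..s, distFun μ u * P' u i j

lemma distFun_eq_cdf [IsProbabilityMeasure μ] (h0 : ∀ᵐ r ∂μ, 0 ≤ r) (t : ℝ) :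
    distFun μ t = ProbabilityTheory.cdf μ t := by
  rw [ProbabilityTheory.cdf_eq_real, distFun]
  refine measureReal_congr ?_
  filter_upwards [h0] with r hr
  exact propext ⟨fun h => h.2, fun h => ⟨hr, h⟩⟩

lemma monotone_distFun [IsProbabilityMeasure μ] : Monotone (distFun μ) := fun _ _ hab =>
  measureReal_mono (Icc_subset_Icc_right hab)

lemma intervalIntegrable_distFun_mul [IsProbabilityMeasure μ] {g : ℝ → ℝ} (hg : Continuous g)
    (a b : ℝ) : IntervalIntegrable (fun t => distFun μ t * g t) volume a b :=
  (monotone_distFun.intervalIntegrable).mul_continuousOn hg.continuousOn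

lemma IsPathData.continuous_deriv (hd : IsPathData Q μ P P' s) : Continuous P' :=
  continuous_pi fun i => continuous_pi fun j => (hd.isC11 i j).locallyLipschitz.continuous

lemma IsPathData.continuous_deriv_apply (hd : IsPathData Q μ P P' s) (i j : Fin m) :
    Continuous fun t => P' t i j := (hd.isC11 i j).locallyLipschitz.continuous

lemma continuous_integral_distFun [IsProbabilityMeasure μ] {g : ℝ → ℝ} (hg : Continuous g)
    (s : ℝ) : Continuous fun t => ∫ u in t..s, distFun μ u * g u := by
  simp only [intervalIntegral.integral_symm s]
  exact (intervalIntegral.continuous_primitive (intervalIntegrable_distFun_mul hg) s).neg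

lemma IsPathData.continuous_hatExt (hd : IsPathData Q μ P P' s) :
    Continuous (hatExt Q μ P P' s) := by
  have := hd.prob
  exact continuous_pi fun i => continuous_pi fun j =>
    continuous_const.add (continuous_integral_distFun (hd.continuous_deriv_apply i j) s)

lemma IsPathData.posDef_hatExt (hd : IsPathData Q μ P P' s) {t : ℝ} (ht : t ≤ s) :
    (hatExt Q μ P P' s t).PosDef := by
  have := hd.prob
  have h : hatExt Q μ P P' s t =
      (Q - P s) + Matrix.of fun i j => ∫ u in t..s, distFun μ u * P' u i j := by
    ext i j; simp [hatExt]
  rw [h]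
  refine hd.posDef.add_posSemidef (posSemidef_iff_form.mpr ⟨?_, fun v => ?_⟩)
  · rw [isHermitian_iff_apply]
    intro i j
    simp only [Matrix.of_apply, apply_comm_of_posSemidef (hd.posSemidef_deriv _) i j]
  · have hi : ∀ i j, IntervalIntegrable (fun u => distFun μ u * P' u i j) volume t s := fun i j =>
      intervalIntegrable_distFun_mul (hd.continuous_deriv_apply i j) t s
    have : v ⬝ᵥ (Matrix.of fun i j => ∫ u in t..s, distFun μ u * P' u i j).mulVec v =
        ∫ u in t..s, distFun μ u * (v ⬝ᵥ (P' u).mulVec v) := by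
      simp only [dotProduct, Matrix.mulVec, Matrix.of_apply, Finset.mul_sum]
      rw [intervalIntegral.integral_finsetSum]
      · refine Finset.sum_congr rfl fun i _ => ?_
        rw [intervalIntegral.integral_finsetSum]
        · refine Finset.sum_congr rfl fun j _ => ?_
          rw [← intervalIntegral.integral_mul_const, ← intervalIntegral.integral_const_mul]
          refine intervalIntegral.integral_congr fun u _ => ?_
          ring
        · intro j _
          refine (((hi i j).mul_const (v j)).const_mul (v i)).congr fun u _ => ?_
          ring
      · intro i _
        refine (intervalIntegrable_distFun_mul (μ := μ) (g := fun u => ∑ j, v i * (P' u i j * v j))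
          (continuous_finsetSum _ fun j _ => continuous_const.mul
            ((hd.continuous_deriv_apply i j).mul continuous_const)) t s).congr fun u _ => ?_
        simp only [Finset.mul_sum]
    rw [this]
    refine intervalIntegral.integral_nonneg ht fun u _ => mul_nonneg measureReal_nonneg ?_
    exact (posSemidef_iff_form.mp (hd.posSemidef_deriv u)).2 v

lemma IsPathData.integral_distFun_mul_deriv_eq (hd : IsPathData Q μ P P' s) {f f' : ℝ → ℝ}
    (hf : IsC11 f f') {t : ℝ} (ht : t ∈ Icc 0 s) :
    ∫ u in t..s, distFun μ u * f' u = f s - ∫ r, f (max r t) ∂μ := by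
  have := hd.prob
  exact integral_distFun_mul_deriv ht.1 ht.2 hd.nonneg hd.le
    (fun u _ => (hf.hasDerivAt u).hasDerivWithinAt) hf.locallyLipschitz.continuous.continuousOn

/-- The integral form supplies positivity and one-sided derivatives, the mean form linearity under
perturbation. -/
lemma IsPathData.hatExt_eq_hatMean (hd : IsPathData Q μ P P' s) {t : ℝ} (ht : t ∈ Icc 0 s) :
    hatExt Q μ P P' s t = hatMean Q μ P t := by
  ext i j
  simp only [hatExt, hatMean, Matrix.of_apply, hd.integral_distFun_mul_deriv_eq (hd.isC11 i j) ht,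
    Matrix.sub_apply]
  ring

lemma continuousWithinAt_distFun [IsProbabilityMeasure μ] (h0 : ∀ᵐ r ∂μ, 0 ≤ r) (t : ℝ) :
    ContinuousWithinAt (distFun μ) (Ici t) t := by
  rw [funext (distFun_eq_cdf h0)]
  exact (ProbabilityTheory.cdf μ).right_continuous t

lemma IsPathData.hasDerivWithinAt_hatExt_right (hd : IsPathData Q μ P P' s) (t : ℝ)
    (i j : Fin m) : HasDerivWithinAt (fun t => hatExt Q μ P P' s t i j)
      ((-(distFun μ t • P' t)) i j) (Ici t) t := by
  have := hd.prob
  have h1 := intervalIntegral.integral_hasDerivWithinAt_left (s := Ici t) (t := Ioi t)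
    (intervalIntegrable_distFun_mul (μ := μ) (hd.continuous_deriv_apply i j) t s)
    ((monotone_distFun.measurable.mul
      (hd.continuous_deriv_apply i j).measurable).stronglyMeasurable.stronglyMeasurableAtFilter)
    (((continuousWithinAt_distFun hd.nonneg t).mul
      (hd.continuous_deriv_apply i j).continuousWithinAt).mono Ioi_subset_Ici_self)
  exact (h1.const_add ((Q - P s) i j)).congr_deriv (by simp)

/-- From the left the weight is `x(t-)` instead of `x(t)`. At an atom this discrepancy is the source
of the final contradiction. -/
lemma IsPathData.hasDerivWithinAt_hatExt_left (hd : IsPathData Q μ P P' s) (t : ℝ)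
    (i j : Fin m) : HasDerivWithinAt (fun t => hatExt Q μ P P' s t i j)
      ((-(Function.leftLim (distFun μ) t • P' t)) i j) (Iic t) t := by
  have := hd.prob
  have hlim : Tendsto (fun u => distFun μ u * P' u i j) (𝓝[<] t)
      (𝓝 (Function.leftLim (distFun μ) t * P' t i j)) :=
    (monotone_distFun.tendsto_leftLim t).mul
      (((hd.continuous_deriv_apply i j).tendsto t).mono_left nhdsWithin_le_nhds)
  have h1 := intervalIntegral.integral_hasDerivWithinAt_of_tendsto_ae_left (s := Iic t) (t := Iic t)
    (intervalIntegrable_distFun_mul (μ := μ) (hd.continuous_deriv_apply i j) t s)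
    ((monotone_distFun.measurable.mul
      (hd.continuous_deriv_apply i j).measurable).stronglyMeasurable.stronglyMeasurableAtFilter)
    (c := Function.leftLim (distFun μ) t * P' t i j) (hlim.mono_left (by
      -- The limit is needed only almost everywhere, so the point `t` itself, where the integrand
      -- may differ from its left limit, can be discarded.
      have h2 : ae (volume : Measure ℝ) ≤ 𝓟 {t}ᶜ := by
        rw [le_principal_iff, mem_ae_iff, compl_compl]; simp
      have h3 : (𝓝[<] t) = 𝓝[≤] t ⊓ 𝓟 {t}ᶜ := by
        rw [nhdsWithin, nhdsWithin, inf_assoc, inf_principal]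
        congr 2
        ext x; simp [lt_iff_le_and_ne]
      rw [h3]
      exact inf_le_inf_left _ h2))
  exact (h1.const_add ((Q - P s) i j)).congr_deriv (by simp)

end Setup

/-! ### The force and the first variation of the functional. -/

section FirstVariation

variable {m : ℕ} {Q : Matrix (Fin m) (Fin m) ℝ} {μ : Measure ℝ}
  {P P' : ℝ → Matrix (Fin m) (Fin m) ℝ} {s : ℝ} {β : ℕ → Fin m → ℝ} {h : Fin m → ℝ}

/-- The inverse of `P̂`, frozen after time `s`. -/
noncomputable def invHat (Q : Matrix (Fin m) (Fin m) ℝ) (μ : Measure ℝ)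
    (P P' : ℝ → Matrix (Fin m) (Fin m) ℝ) (s t : ℝ) : Matrix (Fin m) (Fin m) ℝ :=
  (hatExt Q μ P P' s (min t s))⁻¹

/-- `P̂⁻¹ P' P̂⁻¹`. -/
noncomputable def conjDeriv (Q : Matrix (Fin m) (Fin m) ℝ) (μ : Measure ℝ)
    (P P' : ℝ → Matrix (Fin m) (Fin m) ℝ) (s t : ℝ) : Matrix (Fin m) (Fin m) ℝ :=
  invHat Q μ P P' s t * P' t * invHat Q μ P P' s t

/-- The derivative of the functional when the mass at time `t` is moved, up to a factor
`-1 / 2`: the matrix `ξ'(P(t)) + h hᵀ - ∫₀ᵗ P̂⁻¹ P' P̂⁻¹`. -/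
noncomputable def force (β : ℕ → Fin m → ℝ) (h : Fin m → ℝ) (Q : Matrix (Fin m) (Fin m) ℝ)
    (μ : Measure ℝ) (P P' : ℝ → Matrix (Fin m) (Fin m) ℝ) (s t : ℝ) :
    Matrix (Fin m) (Fin m) ℝ :=
  xiDeriv β (P t) + Matrix.vecMulVec h h -
    Matrix.of fun i j => ∫ u in (0 : ℝ)..t, conjDeriv Q μ P P' s u i j

lemma IsPathData.det_hatExt_ne_zero (hd : IsPathData Q μ P P' s) {t : ℝ} (ht : t ≤ s) :
    (hatExt Q μ P P' s t).det ≠ 0 := (hd.posDef_hatExt ht).det_pos.ne'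

lemma IsPathData.posDef_invHat (hd : IsPathData Q μ P P' s) (t : ℝ) :
    (invHat Q μ P P' s t).PosDef := (hd.posDef_hatExt (min_le_right t s)).inv

lemma IsPathData.continuous_invHat (hd : IsPathData Q μ P P' s) :
    Continuous (invHat Q μ P P' s) := by
  rw [continuous_iff_continuousAt]
  intro t
  exact ContinuousAt.comp (f := fun t => hatExt Q μ P P' s (min t s))
    (continuousAt_inv_apply (hd.det_hatExt_ne_zero (min_le_right t s)))
    (hd.continuous_hatExt.comp (continuous_id.min continuous_const)).continuousAt

lemma IsPathData.continuous_conjDeriv (hd : IsPathData Q μ P P' s) :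
    Continuous (conjDeriv Q μ P P' s) :=
  (hd.continuous_invHat.mul hd.continuous_deriv).mul hd.continuous_invHat

lemma IsPathData.hasDerivWithinAt_invHat_right (hd : IsPathData Q μ P P' s) {t : ℝ} (ht : t < s)
    (i j : Fin m) : HasDerivWithinAt (fun t => invHat Q μ P P' s t i j)
      (distFun μ t * conjDeriv Q μ P P' s t i j) (Ici t) t := by
  have h1 := hasDerivWithinAt_inv_apply (hd.det_hatExt_ne_zero ht.le)
    (fun i j => hd.hasDerivWithinAt_hatExt_right t i j) i j
  have hev : ∀ᶠ u in 𝓝[Ici t] t, invHat Q μ P P' s u i j = (hatExt Q μ P P' s u)⁻¹ i j := by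
    filter_upwards [nhdsWithin_le_nhds (Iio_mem_nhds ht)] with u hu
    rw [invHat, min_eq_left (le_of_lt hu)]
  refine (h1.congr_of_eventuallyEq hev ?_).congr_deriv ?_
  · rw [invHat, min_eq_left ht.le]
  · rw [conjDeriv, invHat, min_eq_left ht.le]
    simp

lemma IsPathData.hasDerivWithinAt_invHat_left (hd : IsPathData Q μ P P' s) {t : ℝ} (ht : t < s)
    (i j : Fin m) : HasDerivWithinAt (fun t => invHat Q μ P P' s t i j)
      (Function.leftLim (distFun μ) t * conjDeriv Q μ P P' s t i j) (Iic t) t := by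
  have h1 := hasDerivWithinAt_inv_apply (hd.det_hatExt_ne_zero ht.le)
    (fun i j => hd.hasDerivWithinAt_hatExt_left t i j) i j
  have hev : ∀ᶠ u in 𝓝[Iic t] t, invHat Q μ P P' s u i j = (hatExt Q μ P P' s u)⁻¹ i j := by
    filter_upwards [nhdsWithin_le_nhds (Iio_mem_nhds ht)] with u hu
    rw [invHat, min_eq_left (le_of_lt hu)]
  refine (h1.congr_of_eventuallyEq hev ?_).congr_deriv ?_
  · rw [invHat, min_eq_left ht.le]
  · rw [conjDeriv, invHat, min_eq_left ht.le]
    simp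

/-- Differentiation of `ε ↦ ∫ Ξ(p + ε e) dμ` at `0`, for one entry. -/
lemma hasDerivAt_integral_xiInt (hβ : IsEvenMixture β) [IsProbabilityMeasure μ] (hs : 0 ≤ s)
    (h0 : ∀ᵐ r ∂μ, 0 ≤ r) (h1 : ∀ᵐ r ∂μ, r ≤ s) (i j : Fin m) {p e : ℝ → ℝ} (hp : Continuous p)
    (he : Continuous e) (hb : ∀ t ∈ Icc 0 s, |p t| ≤ 1) :
    (∀ᶠ ε in 𝓝 (0 : ℝ), Integrable (fun r => xiInt β i j (p r + ε * e r)) μ) ∧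
    HasDerivAt (fun ε : ℝ => ∫ r, xiInt β i j (p r + ε * e r) ∂μ)
      (∫ r, xiEntry β i j (p r) * e r ∂μ) 0 := by
  obtain ⟨C, hC⟩ := isCompact_Icc.exists_bound_of_continuousOn (s := Icc 0 s) he.continuousOn
  have hC0 : 0 ≤ C := (norm_nonneg _).trans (hC 0 ⟨le_rfl, hs⟩)
  obtain ⟨L, hL⟩ := isCompact_Icc.exists_bound_of_continuousOn (s := Icc (-(5 / 4) : ℝ) (5 / 4))
    ((analyticOnNhd_xiEntry hβ i j).continuousOn.mono fun x hx =>
      ⟨by linarith [hx.1], by linarith [hx.2]⟩)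
  have hL0 : 0 ≤ L := (norm_nonneg _).trans (hL 0 (by norm_num))
  -- For `ε` in this range the perturbation is at most `1 / 4`, so arguments stay in `[-5/4, 5/4]`,
  -- inside the interval of analyticity.
  have hδ : 0 < 1 / (4 * (C + 1)) := by positivity
  have hmem : ∀ ε ∈ Metric.ball (0 : ℝ) (1 / (4 * (C + 1))), ∀ r ∈ Icc 0 s,
      p r + ε * e r ∈ Icc (-(5 / 4) : ℝ) (5 / 4) := fun ε hε r hr => by
    have h2 : |ε * e r| ≤ 1 / (4 * (C + 1)) * C := by
      rw [abs_mul]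
      have : |ε| < 1 / (4 * (C + 1)) := by simpa using hε
      exact mul_le_mul this.le (hC r hr) (abs_nonneg _) hδ.le
    have h3 : 1 / (4 * (C + 1)) * C ≤ 1 / 4 := by
      rw [div_mul_eq_mul_div, div_le_div_iff₀ (by positivity) (by norm_num)]; linarith
    have h4 := abs_le.mp (hb r hr)
    have h5 := abs_le.mp h2
    constructor <;> linarith [h4.1, h4.2, h5.1, h5.2]
  have hmem' : ∀ x ∈ Icc (-(5 / 4) : ℝ) (5 / 4), x ∈ Ioo (-3 / 2 : ℝ) (3 / 2) := fun x hx =>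
    ⟨by linarith [hx.1], by linarith [hx.2]⟩
  have hint : ∀ ε ∈ Metric.ball (0 : ℝ) (1 / (4 * (C + 1))),
      Integrable (fun r => xiInt β i j (p r + ε * e r)) μ := fun ε hε =>
    integrable_of_continuousOn_Icc (fun r hr => ContinuousAt.continuousWithinAt
      (ContinuousAt.comp (f := fun r => p r + ε * e r)
        (hasDerivAt_xiInt hβ i j (hmem' _ (hmem ε hε r hr))).continuousAt
        (hp.add (continuous_const.mul he)).continuousAt)) h0 h1
  refine ⟨Filter.mem_of_superset (Metric.ball_mem_nhds 0 hδ) hint, ?_⟩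
  have key := hasDerivAt_integral_of_dominated_loc_of_deriv_le (μ := μ)
    (F := fun ε r => xiInt β i j (p r + ε * e r))
    (F' := fun ε r => xiEntry β i j (p r + ε * e r) * e r) (x₀ := 0) (bound := fun _ => L * C)
    (Metric.ball_mem_nhds 0 hδ)
    (Filter.mem_of_superset (Metric.ball_mem_nhds 0 hδ) fun ε hε => (hint ε hε).aestronglyMeasurable)
    (hint 0 (Metric.mem_ball_self hδ)) ?_ ?_ (integrable_const _) ?_
  · simpa using key.2
  · refine (integrable_of_continuousOn_Icc (fun r hr => ContinuousAt.continuousWithinAt ?_)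
      h0 h1).aestronglyMeasurable
    refine ContinuousAt.mul ?_ he.continuousAt
    exact ContinuousAt.comp (f := fun r => p r + 0 * e r)
        ((analyticOnNhd_xiEntry hβ i j _ (hmem' _ (hmem 0 (Metric.mem_ball_self hδ) r hr))).continuousAt)
        (hp.add (continuous_const.mul he)).continuousAt
  · filter_upwards [h0, h1] with r hr hr' ε hε
    rw [norm_mul]
    exact mul_le_mul (hL _ (hmem ε hε r ⟨hr, hr'⟩)) (hC r ⟨hr, hr'⟩) (norm_nonneg _) hL0
  · filter_upwards [h0, h1] with r hr hr' ε hε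
    have := hasDerivAt_xiInt hβ i j (hmem' _ (hmem ε hε r ⟨hr, hr'⟩))
    have h2 : HasDerivAt (fun ε : ℝ => p r + ε * e r) (e r) ε := by
      simpa using ((hasDerivAt_id ε).mul_const (e r)).const_add (p r)
    exact this.comp ε h2

lemma integral_sum_sum {f : Fin m → Fin m → ℝ → ℝ} (hf : ∀ i j, Integrable (f i j) μ) :
    ∫ r, ∑ i, ∑ j, f i j r ∂μ = ∑ i, ∑ j, ∫ r, f i j r ∂μ := by
  rw [integral_finsetSum _ fun i _ => integrable_finsetSum _ fun j _ => hf i j]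
  exact Finset.sum_congr rfl fun i _ => integral_finsetSum _ fun j _ => hf i j

lemma IsPathData.hasDerivAt_integral_potential (hβ : IsEvenMixture β)
    (hd : IsPathData Q μ P P' s) {η : ℝ → Matrix (Fin m) (Fin m) ℝ} (hη : Continuous η) :
    HasDerivAt (fun ε : ℝ => ∫ r, potential β h (P r + ε • η r) ∂μ)
      (∫ r, frob (xiDeriv β (P r) + Matrix.vecMulVec h h) (η r) ∂μ) 0 := by
  have := hd.prob
  have hPc : ∀ i j, Continuous fun t => P t i j := fun i j => (hd.isC11 i j).continuous
  have hηc : ∀ i j, Continuous fun t => η t i j := fun i j =>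
    (continuous_apply_apply i j).comp hη
  have hI : ∀ {f : ℝ → ℝ}, Continuous f → Integrable f μ := fun hf =>
    integrable_of_continuousOn_Icc hf.continuousOn hd.nonneg hd.le
  have hx : ∀ i j, Integrable (fun r => xiEntry β i j (P r i j) * η r i j) μ := fun i j => by
    refine integrable_of_continuousOn_Icc (ContinuousOn.mul ?_ (hηc i j).continuousOn)
      hd.nonneg hd.le
    refine (analyticOnNhd_xiEntry hβ i j).continuousOn.comp (hPc i j).continuousOn fun t ht => ?_
    have := _root_.abs_le.mp (hd.abs_le t ht i j)
    exact ⟨by linarith [this.1], by linarith [this.2]⟩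
  have key := fun i j => hasDerivAt_integral_xiInt hβ hd.pos.le hd.nonneg hd.le i j (hPc i j)
    (hηc i j) fun t ht => hd.abs_le t ht i j
  have hsum : ∀ᶠ ε in 𝓝 (0 : ℝ), ∫ r, potential β h (P r + ε • η r) ∂μ =
      ∑ i, ∑ j, ((∫ r, xiInt β i j (P r i j + ε * η r i j) ∂μ) +
        (h i * h j * (∫ r, P r i j ∂μ) + ε * (h i * h j * ∫ r, η r i j ∂μ))) := by
    have hall : ∀ᶠ ε in 𝓝 (0 : ℝ), ∀ i j,
        Integrable (fun r => xiInt β i j (P r i j + ε * η r i j)) μ := by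
      simp only [eventually_all]; exact fun i j => (key i j).1
    filter_upwards [hall] with ε hε
    have h2 : ∀ i j, Integrable (fun r => h i * h j * (P r i j + ε * η r i j)) μ := fun i j =>
      hI (continuous_const.mul ((hPc i j).add (continuous_const.mul (hηc i j))))
    simp only [potential, Matrix.add_apply, Matrix.smul_apply, smul_eq_mul]
    refine (integral_sum_sum fun i j => (hε i j).add (h2 i j)).trans ?_
    refine Finset.sum_congr rfl fun i _ => Finset.sum_congr rfl fun j _ => ?_
    have h3 : Integrable (fun r => ε * η r i j) μ := hI (continuous_const.mul (hηc i j))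
    refine (integral_add (hε i j) (h2 i j)).trans ?_
    rw [integral_const_mul, integral_add (hI (hPc i j)) h3, integral_const_mul]
    ring
  refine HasDerivAt.congr_of_eventuallyEq ?_ hsum
  have hval : ∫ r, frob (xiDeriv β (P r) + Matrix.vecMulVec h h) (η r) ∂μ =
      ∑ i, ∑ j, ((∫ r, xiEntry β i j (P r i j) * η r i j ∂μ) +
        (0 + 1 * (h i * h j * ∫ r, η r i j ∂μ))) := by
    have h2 : ∀ i j, Integrable (fun r => h i * h j * η r i j) μ := fun i j =>
      hI (continuous_const.mul (hηc i j))
    simp only [frob, Matrix.add_apply, xiDeriv_apply, Matrix.vecMulVec_apply, add_mul]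
    refine (integral_sum_sum fun i j => (hx i j).add (h2 i j)).trans ?_
    refine Finset.sum_congr rfl fun i _ => Finset.sum_congr rfl fun j _ => ?_
    refine (integral_add (hx i j) (h2 i j)).trans ?_
    rw [integral_const_mul]
    ring
  rw [hval]
  refine HasDerivAt.fun_sum fun i _ => HasDerivAt.fun_sum fun j _ => (key i j).2.add ?_
  exact (hasDerivAt_const _ _).add ((hasDerivAt_id _).mul_const _)

lemma frob_conj {Z E D : Matrix (Fin m) (Fin m) ℝ} (hZ : Z.IsHermitian) :
    frob (Z * E * Z) D = frob E (Z * D * Z) := by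
  have hZt := transpose_eq_of_isHermitian hZ
  rw [frob_eq_trace, frob_eq_trace, Matrix.transpose_mul, Matrix.transpose_mul, hZt,
    Matrix.mul_assoc, Matrix.trace_mul_comm]
  simp only [Matrix.mul_assoc]

lemma IsPathData.continuousOn_force_apply (hβ : IsEvenMixture β) (hd : IsPathData Q μ P P' s)
    (i j : Fin m) : ContinuousOn (fun t => force β h Q μ P P' s t i j) (Icc 0 s) := by
  simp only [force, Matrix.sub_apply, Matrix.add_apply, xiDeriv_apply, Matrix.of_apply]
  refine ContinuousOn.sub (ContinuousOn.add ?_ continuousOn_const) ?_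
  · refine (analyticOnNhd_xiEntry hβ i j).continuousOn.comp (hd.isC11 i j).continuous.continuousOn
      fun t ht => ?_
    have := _root_.abs_le.mp (hd.abs_le t ht i j)
    exact ⟨by linarith [this.1], by linarith [this.2]⟩
  · exact (intervalIntegral.continuous_primitive (fun a b =>
      ((continuous_apply_apply i j).comp hd.continuous_conjDeriv).intervalIntegrable a b)
      0).continuousOn

/-- The first variation of the reduced functional. -/
theorem IsPathData.tendsto_reduced_quotient (hβ : IsEvenMixture β) (hd : IsPathData Q μ P P' s)
    {η η' : ℝ → Matrix (Fin m) (Fin m) ℝ}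
    (hη : ∀ i j, IsC11 (fun t => η t i j) (fun t => η' t i j)) (hη0 : η 0 = 0) :
    Tendsto (fun ε : ℝ => ε⁻¹ * (reduced β h Q μ (fun t => P t + ε • η t)
        (fun t => P' t + ε • η' t) s - reduced β h Q μ P P' s)) (𝓝[>] 0)
      (𝓝 (-∫ r, frob (force β h Q μ P P' s r) (η r) ∂μ)) := by
  have := hd.prob
  have hηc : ∀ i j, Continuous fun t => η t i j := fun i j => (hη i j).continuous
  have hηc' : ∀ i j, Continuous fun t => η' t i j := fun i j =>
    (hη i j).locallyLipschitz.continuous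
  have hηC : Continuous η := continuous_pi fun i => continuous_pi fun j => hηc i j
  have hηC' : Continuous η' := continuous_pi fun i => continuous_pi fun j => hηc' i j
  -- The `ε`-derivative of the hat matrix, exact because `hatMean` is affine in the path.
  let E : ℝ → Matrix (Fin m) (Fin m) ℝ := fun t =>
    Matrix.of fun i j => -η s i j + ∫ u in t..s, distFun μ u * η' u i j
  have hEC : Continuous E := continuous_pi fun i => continuous_pi fun j =>
    continuous_const.add (continuous_integral_distFun (hηc' i j) s)
  have hE : ∀ t ∈ Icc 0 s, ∀ i j, E t i j = -∫ r, η (max r t) i j ∂μ := fun t ht i j => by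
    simp only [E, Matrix.of_apply, hd.integral_distFun_mul_deriv_eq (hη i j) ht]
    ring
  have hhat : ∀ ε : ℝ, ∀ t ∈ Icc 0 s, hatMean Q μ (fun t => P t + ε • η t) t =
      hatExt Q μ P P' s t + ε • E t := fun ε t ht => by
    ext i j
    rw [hd.hatExt_eq_hatMean ht, Matrix.add_apply, Matrix.smul_apply, hE t ht i j]
    simp only [hatMean, Matrix.of_apply, Matrix.add_apply, Matrix.smul_apply, smul_eq_mul]
    have hmax : Continuous fun r : ℝ => max r t := continuous_id.max continuous_const
    have h1 : Integrable (fun r => P (max r t) i j) μ := integrable_of_continuousOn_Icc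
      ((hd.isC11 i j).continuous.comp hmax).continuousOn hd.nonneg hd.le
    have h2 : Integrable (fun r => ε * η (max r t) i j) μ := integrable_of_continuousOn_Icc
      (continuous_const.mul ((hηc i j).comp hmax)).continuousOn hd.nonneg hd.le
    rw [integral_add h1 h2, integral_const_mul]
    ring
  have hred : ∀ ε : ℝ, reduced β h Q μ (fun t => P t + ε • η t) (fun t => P' t + ε • η' t) s =
      -(∫ r, potential β h (P r + ε • η r) ∂μ) + Real.log ((Q - P s) + ε • (-η s)).det +
        ∫ t in (0 : ℝ)..s, frob (hatExt Q μ P P' s t + ε • E t)⁻¹ (P' t + ε • η' t) := fun ε => by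
    rw [reduced]
    congr 1
    · congr 3
      rw [smul_neg]; abel
    · refine intervalIntegral.integral_congr fun t ht => ?_
      rw [uIcc_of_le hd.pos.le] at ht
      simp only [hhat ε t ht]
  have hred0 : reduced β h Q μ P P' s = -(∫ r, potential β h (P r + (0 : ℝ) • η r) ∂μ) +
      Real.log ((Q - P s) + (0 : ℝ) • (-η s)).det +
        ∫ t in (0 : ℝ)..s, frob (hatExt Q μ P P' s t)⁻¹ (P' t) := by
    have := hred 0
    simpa only [zero_smul, add_zero] using this
  have hslope : ∀ {f : ℝ → ℝ} {f' : ℝ}, HasDerivAt f f' 0 →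
      Tendsto (fun ε : ℝ => ε⁻¹ * (f ε - f 0)) (𝓝[>] 0) (𝓝 f') := fun hf => by
    have := (hasDerivAt_iff_tendsto_slope_zero.mp hf).mono_left
      (nhdsWithin_mono (0 : ℝ) (show Ioi (0 : ℝ) ⊆ {0}ᶜ from fun x hx => ne_of_gt hx))
    simpa using this
  have hT1 := hslope (hd.hasDerivAt_integral_potential (h := h) hβ hηC)
  have hT2 := hslope (hasDerivAt_log_det (E := -η s) hd.posDef.det_pos)
  have hT3 := tendsto_quotient_integral_inv hd.continuous_hatExt hEC hd.continuous_deriv hηC'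
    hd.pos.le fun t ht => hd.det_hatExt_ne_zero ht.2
  have hT := (hT1.neg.add hT2).add hT3
  have hZ : ∀ t ∈ Icc 0 s, (hatExt Q μ P P' s t)⁻¹ = invHat Q μ P P' s t := fun t ht => by
    rw [invHat, min_eq_left ht.2]
  have hzc : ∀ i j, Continuous fun t => invHat Q μ P P' s t i j := fun i j =>
    (continuous_apply_apply i j).comp hd.continuous_invHat
  have hyc : ∀ i j, Continuous fun t => conjDeriv Q μ P P' s t i j := fun i j =>
    (continuous_apply_apply i j).comp hd.continuous_conjDeriv
  have hEc : ∀ i j, Continuous fun t => E t i j := fun i j =>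
    (continuous_apply_apply i j).comp hEC
  -- Each entry of `P̂⁻¹` has right derivative `x` times that of `P̂⁻¹ P' P̂⁻¹`. By parts, every
  -- term in `η'` and `E` becomes an integral against `μ`, and the boundary term at `s` cancels the
  -- variation of the log-determinant.
  have hparts := fun i j => integral_by_parts_distFun hd.pos.le hd.nonneg hd.le (hzc i j)
    (hyc i j) (hη i j).hasDerivAt (hηc' i j) (by simp [hη0]) fun t ht =>
      (hd.hasDerivWithinAt_invHat_right ht.2 i j).mono Ioi_subset_Ici_self
  have hI3 : ∫ t in (0 : ℝ)..s, (frob (hatExt Q μ P P' s t)⁻¹ (η' t) -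
      frob ((hatExt Q μ P P' s t)⁻¹ * E t * (hatExt Q μ P P' s t)⁻¹) (P' t)) =
      ∑ i, ∑ j, ∫ t in (0 : ℝ)..s, (invHat Q μ P P' s t i j * η' t i j +
        (∫ r, η (max r t) i j ∂μ) * conjDeriv Q μ P P' s t i j) := by
    have h1 : ∀ t ∈ uIcc 0 s, frob (hatExt Q μ P P' s t)⁻¹ (η' t) -
        frob ((hatExt Q μ P P' s t)⁻¹ * E t * (hatExt Q μ P P' s t)⁻¹) (P' t) =
        ∑ i, ∑ j, (invHat Q μ P P' s t i j * η' t i j +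
          -E t i j * conjDeriv Q μ P P' s t i j) := fun t ht => by
      rw [uIcc_of_le hd.pos.le] at ht
      rw [hZ t ht, frob_conj (hd.posDef_invHat t).1]
      simp only [frob, ← Finset.sum_sub_distrib, conjDeriv]
      exact Finset.sum_congr rfl fun i _ => Finset.sum_congr rfl fun j _ => by ring
    rw [intervalIntegral.integral_congr h1]
    have hcont : ∀ i j, Continuous fun t => invHat Q μ P P' s t i j * η' t i j +
        -E t i j * conjDeriv Q μ P P' s t i j := fun i j =>
      ((hzc i j).mul (hηc' i j)).add ((hEc i j).neg.mul (hyc i j))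
    rw [intervalIntegral.integral_finsetSum fun i _ =>
      (continuous_finsetSum _ fun j _ => hcont i j).intervalIntegrable _ _]
    refine Finset.sum_congr rfl fun i _ => ?_
    rw [intervalIntegral.integral_finsetSum fun j _ => (hcont i j).intervalIntegrable _ _]
    refine Finset.sum_congr rfl fun j _ => intervalIntegral.integral_congr fun t ht => ?_
    rw [uIcc_of_le hd.pos.le] at ht
    simp only [hE t ht i j, neg_neg]
  have hlog : ((Q - P s)⁻¹ * -η s).trace = -∑ i, ∑ j, invHat Q μ P P' s s i j * η s i j := by
    have h1 : invHat Q μ P P' s s = (Q - P s)⁻¹ := by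
      rw [invHat, min_self]
      congr 1
      ext i j
      simp [hatExt]
    have h2 : (Q - P s)⁻¹.transpose = (Q - P s)⁻¹ := transpose_eq_of_isHermitian hd.posDef.inv.1
    rw [Matrix.mul_neg, Matrix.trace_neg, h1]
    have := frob_eq_trace (Q - P s)⁻¹ (η s)
    rw [h2] at this
    rw [← this, frob]
  have hGI : ∀ i j, Integrable (fun r =>
      (∫ u in (0 : ℝ)..r, conjDeriv Q μ P P' s u i j) * η r i j) μ := fun i j =>
    integrable_of_continuousOn_Icc ((intervalIntegral.continuous_primitive (fun a b =>
      (hyc i j).intervalIntegrable a b) 0).mul (hηc i j)).continuousOn hd.nonneg hd.le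
  have hxI : Integrable (fun r => frob (xiDeriv β (P r) + Matrix.vecMulVec h h) (η r)) μ := by
    refine integrable_of_continuousOn_Icc (continuousOn_finsetSum _ fun i _ =>
      continuousOn_finsetSum _ fun j _ => ContinuousOn.mul ?_ (hηc i j).continuousOn)
      hd.nonneg hd.le
    refine ContinuousOn.add ?_ continuousOn_const
    refine (analyticOnNhd_xiEntry hβ i j).continuousOn.comp (hd.isC11 i j).continuous.continuousOn
      fun t ht => ?_
    have := _root_.abs_le.mp (hd.abs_le t ht i j)
    exact ⟨by linarith [this.1], by linarith [this.2]⟩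
  have hforce : ∫ r, frob (force β h Q μ P P' s r) (η r) ∂μ =
      (∫ r, frob (xiDeriv β (P r) + Matrix.vecMulVec h h) (η r) ∂μ) -
      ∑ i, ∑ j, ∫ r, (∫ u in (0 : ℝ)..r, conjDeriv Q μ P P' s u i j) * η r i j ∂μ := by
    rw [← integral_sum_sum hGI, ← integral_sub hxI (integrable_finsetSum _ fun i _ =>
      integrable_finsetSum _ fun j _ => hGI i j)]
    simp only [force, frob_sub_left]
    rfl
  have hval : -(∫ r, frob (xiDeriv β (P r) + Matrix.vecMulVec h h) (η r) ∂μ) +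
      ((Q - P s)⁻¹ * -η s).trace + (∫ t in (0 : ℝ)..s, (frob (hatExt Q μ P P' s t)⁻¹ (η' t) -
      frob ((hatExt Q μ P P' s t)⁻¹ * E t * (hatExt Q μ P P' s t)⁻¹) (P' t))) =
      -∫ r, frob (force β h Q μ P P' s r) (η r) ∂μ := by
    rw [hforce, hI3, hlog]
    have : ∑ i, ∑ j, ∫ r, (∫ u in (0 : ℝ)..r, conjDeriv Q μ P P' s u i j) * η r i j ∂μ =
        (∑ i, ∑ j, ∫ t in (0 : ℝ)..s, (invHat Q μ P P' s t i j * η' t i j +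
        (∫ r, η (max r t) i j ∂μ) * conjDeriv Q μ P P' s t i j)) -
        ∑ i, ∑ j, invHat Q μ P P' s s i j * η s i j := by
      simp only [← Finset.sum_sub_distrib]
      exact Finset.sum_congr rfl fun i _ => Finset.sum_congr rfl fun j _ => (hparts i j).symm
    rw [this]
    ring
  rw [hval] at hT
  refine hT.congr fun ε => ?_
  rw [hred, hred0]
  ring

end FirstVariation

/-! ### Tail integrals and summation by parts. -/

section Tail

variable {μ : Measure ℝ} {f : ℝ → ℝ}

lemma tendsto_tail_right (hf : Integrable f μ) (t : ℝ) :
    Tendsto (fun t => ∫ r in Ioi t, f r ∂μ) (𝓝[>] t) (𝓝 (∫ r in Ioi t, f r ∂μ)) := by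
  simp only [← integral_indicator measurableSet_Ioi]
  refine tendsto_integral_filter_of_dominated_convergence (fun r => ‖f r‖)
    (Eventually.of_forall fun t' => (hf.indicator measurableSet_Ioi).aestronglyMeasurable)
    (Eventually.of_forall fun t' => Eventually.of_forall fun r => norm_indicator_le_norm_self _ _)
    hf.norm (Eventually.of_forall fun r => ?_)
  refine tendsto_const_nhds.congr' ?_
  by_cases hr : t < r
  · filter_upwards [nhdsWithin_le_nhds (Iio_mem_nhds hr)] with t' ht'
    rw [indicator_of_mem (show r ∈ Ioi t from hr), indicator_of_mem (show r ∈ Ioi t' from ht')]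
  · filter_upwards [self_mem_nhdsWithin] with t' ht'
    rw [indicator_of_notMem (show r ∉ Ioi t from hr), indicator_of_notMem]
    exact fun h => hr (lt_trans ht' h)

/-- From the left the half-lines shrink to the closed one, so the limit retains an atom at `t`,
unlike the limit from the right. -/
lemma tendsto_tail_left (hf : Integrable f μ) (t : ℝ) :
    Tendsto (fun t => ∫ r in Ioi t, f r ∂μ) (𝓝[<] t) (𝓝 (∫ r in Ici t, f r ∂μ)) := by
  simp only [← integral_indicator measurableSet_Ioi, ← integral_indicator measurableSet_Ici]
  refine tendsto_integral_filter_of_dominated_convergence (fun r => ‖f r‖)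
    (Eventually.of_forall fun t' => (hf.indicator measurableSet_Ioi).aestronglyMeasurable)
    (Eventually.of_forall fun t' => Eventually.of_forall fun r => norm_indicator_le_norm_self _ _)
    hf.norm (Eventually.of_forall fun r => ?_)
  refine tendsto_const_nhds.congr' ?_
  by_cases hr : t ≤ r
  · filter_upwards [self_mem_nhdsWithin] with t' ht'
    rw [indicator_of_mem (show r ∈ Ici t from hr), indicator_of_mem]
    exact lt_of_lt_of_le ht' hr
  · filter_upwards [nhdsWithin_le_nhds (Ioi_mem_nhds (not_le.mp hr))] with t' ht'
    rw [indicator_of_notMem (show r ∉ Ici t from hr), indicator_of_notMem]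
    exact not_lt.mpr (show r < t' from ht').le

/-- Write `p r` as the integral of `p'` from `0` to `r` and exchange the integrals. -/
lemma integral_mul_eq_integral_tail [IsProbabilityMeasure μ] {s : ℝ} (hs : 0 ≤ s)
    (h0 : ∀ᵐ r ∂μ, 0 ≤ r) (h1 : ∀ᵐ r ∂μ, r ≤ s) (hf : ContinuousOn f (Icc 0 s)) {p p' : ℝ → ℝ}
    (hp : ∀ t, HasDerivAt p (p' t) t) (hp' : Continuous p') (hp0 : p 0 = 0) :
    IntervalIntegrable (fun t => (∫ r in Ioi t, f r ∂μ) * p' t) volume 0 s ∧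
    ∫ r, f r * p r ∂μ = ∫ t in (0 : ℝ)..s, (∫ r in Ioi t, f r ∂μ) * p' t := by
  let g := IccExtend hs ((Icc 0 s).domRestrict f)
  have hg : Continuous g := (continuousOn_iff_continuous_domRestrict.mp hf).Icc_extend'
  have hgf : ∀ᵐ r ∂μ, f r = g r := by
    filter_upwards [h0, h1] with r hr hr'
    simp only [g, IccExtend_of_mem hs _ (show r ∈ Icc 0 s from ⟨hr, hr'⟩)]; rfl
  have htail : ∀ t, ∫ r in Ioi t, f r ∂μ = ∫ r, (if t < r then g r else 0) ∂μ := fun t => by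
    rw [← integral_indicator measurableSet_Ioi]
    refine integral_congr_ae ?_
    filter_upwards [hgf] with r hr
    simp [indicator, hr]
  obtain ⟨C, hC⟩ := isCompact_Icc.exists_bound_of_continuousOn hf
  have hgC : ∀ r, |g r| ≤ C := fun r => hC _ (projIcc 0 s hs r).2
  obtain ⟨D, hD⟩ := isCompact_Icc.exists_bound_of_continuousOn (s := Icc 0 s) hp'.continuousOn
  have hC0 : 0 ≤ C := (abs_nonneg _).trans (hgC 0)
  have hmeas : Measurable (Function.uncurry fun r t : ℝ => if t < r then g r else 0) :=
    Measurable.ite (measurableSet_lt measurable_snd measurable_fst)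
      (hg.measurable.comp measurable_fst) measurable_const
  have hmeas' : Measurable (Function.uncurry fun r t : ℝ => (if t < r then g r else 0) * p' t) :=
    hmeas.mul (hp'.measurable.comp measurable_snd)
  have hbd : ∀ r t, |(if t < r then g r else 0)| ≤ C := fun r t => by
    split_ifs
    · exact hgC r
    · simpa using hC0
  have hswap := intervalIntegral_integral_swap (μ := μ) hs (C := C * D) hmeas'
    (Eventually.of_forall fun r t ht => by
      rw [abs_mul]
      exact mul_le_mul (hbd r t) (hD t ht) (abs_nonneg _) hC0)
  constructor
  · have hm2 : StronglyMeasurable fun t => ∫ r, (if t < r then g r else 0) ∂μ :=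
      hmeas.stronglyMeasurable.integral_prod_left
    have hi : IntervalIntegrable (fun t => ∫ r, (if t < r then g r else 0) ∂μ) volume 0 s := by
      refine (intervalIntegrable_const (c := C)).mono_fun hm2.aestronglyMeasurable
        (Eventually.of_forall fun t => ?_)
      refine (norm_integral_le_of_norm_le_const (C := C) (Eventually.of_forall fun r => hbd r t)).trans ?_
      simp [abs_of_nonneg hC0]
    simp only [htail]
    exact hi.mul_continuousOn hp'.continuousOn
  · simp only [htail, ← integral_mul_const]
    rw [hswap]
    refine integral_congr_ae ?_
    filter_upwards [h0, h1, hgf] with r hr hr' hrg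
    rw [hrg]
    have hsplit : ∫ t in (0 : ℝ)..s, (if t < r then g r else 0) * p' t =
        ∫ t in (0 : ℝ)..r, g r * p' t := by
      have hint : ∀ a b, IntervalIntegrable (fun t => (if t < r then g r else 0) * p' t) volume a b := by
        intro a b
        have hc : IntervalIntegrable (fun t => if t < r then g r else 0) volume a b := by
          refine (intervalIntegrable_const (c := C)).mono_fun
            ((Measurable.ite measurableSet_Iio measurable_const
              measurable_const).aestronglyMeasurable) (Eventually.of_forall fun t => ?_)
          simpa [abs_of_nonneg hC0] using hbd r t
        exact hc.mul_continuousOn hp'.continuousOn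
      rw [← intervalIntegral.integral_add_adjacent_intervals (hint 0 r) (hint r s)]
      have e1 : ∫ t in r..s, (if t < r then g r else 0) * p' t = 0 := by
        rw [intervalIntegral.integral_congr (g := fun _ => (0 : ℝ))]
        · simp
        · intro t ht
          rw [uIcc_of_le hr'] at ht
          simp [not_lt.mpr ht.1]
      rw [e1, add_zero, intervalIntegral.integral_of_le hr, intervalIntegral.integral_of_le hr,
        integral_Ioc_eq_integral_Ioo, integral_Ioc_eq_integral_Ioo]
      refine setIntegral_congr_fun measurableSet_Ioo fun t ht => ?_
      simp [ht.2]
    rw [hsplit, intervalIntegral.integral_const_mul,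
      intervalIntegral.integral_eq_sub_of_hasDerivAt (fun t _ => hp t)
        (hp'.intervalIntegrable _ _), hp0, sub_zero]

lemma eq_zero_of_integral_nonpos {q : ℝ → ℝ} {s : ℝ} (hs : 0 ≤ s)
    (hi : IntervalIntegrable q volume 0 s) (hq : ∀ t ∈ Icc 0 s, 0 ≤ q t)
    (hI : ∫ t in (0 : ℝ)..s, q t ≤ 0) (hr : ∀ t ∈ Ico 0 s, Tendsto q (𝓝[>] t) (𝓝 (q t))) {t : ℝ}
    (ht : t ∈ Ico 0 s) : q t = 0 := by
  rw [intervalIntegral.integral_of_le hs] at hI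
  have hi' : IntegrableOn q (Ioc 0 s) := hi.1
  have hnn : 0 ≤ᵐ[volume.restrict (Ioc 0 s)] q := by
    filter_upwards [ae_restrict_mem measurableSet_Ioc] with t ht using hq t (Ioc_subset_Icc_self ht)
  have hz : q =ᵐ[volume.restrict (Ioc 0 s)] 0 :=
    (integral_eq_zero_iff_of_nonneg_ae hnn hi').mp (le_antisymm hI (integral_nonneg_of_ae hnn))
  -- Since `q` vanishes almost everywhere, its zeros accumulate at `t` from the right, and right
  -- continuity applies.
  have hfreq : ∃ᶠ u in 𝓝[>] t, q u = 0 := by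
    rw [frequently_iff]
    intro U hU
    obtain ⟨b, hb, hbU⟩ := (mem_nhdsGT_iff_exists_Ioo_subset' ht.2).mp hU
    by_contra hno
    push Not at hno
    have hsub : Ioo t (min b s) ⊆ {u | ¬ q u = 0} := fun u hu =>
      hno u (hbU ⟨hu.1, hu.2.trans_le (min_le_left _ _)⟩)
    have hzero : volume (Ioo t (min b s)) = 0 := by
      have h1 := ae_iff.mp hz
      have h2 : volume.restrict (Ioc 0 s) (Ioo t (min b s)) = 0 :=
        measure_mono_null hsub h1
      rw [Measure.restrict_apply measurableSet_Ioo, inter_eq_left.mpr] at h2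
      · exact h2
      · exact fun u hu => ⟨ht.1.trans_lt hu.1, (hu.2.trans_le (min_le_right _ _)).le⟩
    rw [Real.volume_Ioo, ENNReal.ofReal_eq_zero] at hzero
    have : t < min b s := lt_min hb ht.2
    linarith
  by_contra hne
  obtain ⟨u, hu, hu'⟩ := (hfreq.and_eventually ((hr t ht).eventually_ne hne)).exists
  exact hu' hu

end Tail

/-! ### Positivity and complementarity of the multiplier. -/

section Stationarity

variable {m : ℕ} {Q : Matrix (Fin m) (Fin m) ℝ} {μ : Measure ℝ}
  {Φ P P' : ℝ → Matrix (Fin m) (Fin m) ℝ} {s : ℝ} {β : ℕ → Fin m → ℝ} {h : Fin m → ℝ}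

/-- The multiplier `Λ(t) = -∫_{(t, ∞)} F dμ` of the monotonicity constraint. -/
noncomputable def multiplier (μ : Measure ℝ) (F : ℝ → Matrix (Fin m) (Fin m) ℝ) (t : ℝ) :
    Matrix (Fin m) (Fin m) ℝ :=
  Matrix.of fun i j => -∫ r in Ioi t, F r i j ∂μ

lemma exists_isCutoff (hadm : IsAdmissible Q μ Φ) :
    ∃ s, IsCutoff Q μ Φ s := by
  have hp := hadm.path
  have h0 : 0 ≤ topPoint m μ := topPoint_nonneg
  have hmem : topPoint m μ ∈ Icc (0 : ℝ) m := ⟨h0, hadm.top_lt.le⟩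
  have hcont : ContinuousWithinAt (fun t => (Q - Φ t).det) (Icc (0 : ℝ) m) (topPoint m μ) := by
    have h1 : ContinuousWithinAt (fun t => Q - Φ t) (Icc (0 : ℝ) m) (topPoint m μ) :=
      continuousWithinAt_const.sub (continuousWithinAt_pi.mpr fun i => continuousWithinAt_pi.mpr
        fun j => hp.continuousOn i j _ hmem)
    exact (continuous_id.matrix_det.tendsto (Q - Φ (topPoint m μ))).comp h1
  have hev := hcont.eventually_const_lt hadm.det_pos
  have h1 : ∀ᶠ t in 𝓝[>] (topPoint m μ), t ∈ Icc (0 : ℝ) m := by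
    filter_upwards [Ioo_mem_nhdsGT hadm.top_lt] with t ht using ⟨h0.trans ht.1.le, ht.2.le⟩
  have h2 : ∀ᶠ t in 𝓝[>] (topPoint m μ), 0 < (Q - Φ t).det :=
    (tendsto_nhdsWithin_of_tendsto_nhds_of_eventually_within _
      (tendsto_id.mono_left nhdsWithin_le_nhds) h1).eventually hev
  obtain ⟨t, ht, ht'⟩ := (h2.and (Ioo_mem_nhdsGT hadm.top_lt)).exists
  exact ⟨t, ht'.1, ht'.2, ht⟩

lemma IsPathExtension.isPathData (hQ : IsConstraint Q) (hadm : IsAdmissible Q μ Φ)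
    (hE : IsPathExtension Φ P P') (hs : IsCutoff Q μ Φ s) : IsPathData Q μ P P' s := by
  have hprob := hadm.prob
  have hp := hadm.path
  obtain ⟨t₀, ht₀, ht₀s, hμt₀⟩ := exists_lt_distFun_eq_one hadm.concentrated hs.1
  have hs0 : 0 < s := ht₀.1.trans_lt ht₀s
  have hsm : s ∈ Icc (0 : ℝ) m := ⟨hs0.le, hs.2.1.le⟩
  have hae := ae_mem_Icc_of_distFun_eq_one hμt₀
  refine ⟨hprob, hae.mono fun r hr => hr.1, hae.mono fun r hr => hr.2.trans ht₀s.le, hs0,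
    hE.isC11, hE.posSemidef_deriv, hE.isHermitian, ?_, ?_, fun t ht i j => ?_⟩
  · rw [hE.eq 0 ⟨le_rfl, by positivity⟩, hp.start]
  · rw [hE.eq s hsm]
    refine posDef_of_det_pos ?_ hs.2.2
    rw [← hp.finish]
    exact hp.monotone s hsm m ⟨by positivity, le_rfl⟩ hsm.2
  · have ht' : t ∈ Icc (0 : ℝ) m := ⟨ht.1, ht.2.trans hsm.2⟩
    rw [hE.eq t ht']
    exact hp.abs_apply_le hQ ht' i j

/-- The variational inequality satisfied by a minimizer. -/
theorem IsCSMinimizer.integral_force_nonpos (hm : 1 ≤ m) (hβ : IsEvenMixture β)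
    (hQ : IsConstraint Q) (hmin : IsCSMinimizer β h Q μ Φ) (hE : IsPathExtension Φ P P')
    (hs : IsCutoff Q μ Φ s) {η η' : ℝ → Matrix (Fin m) (Fin m) ℝ}
    (hη : ∀ i j, IsC11 (fun t => η t i j) (fun t => η' t i j)) (hη0 : η 0 = 0)
    (hηh : ∀ t, (η t).IsHermitian) {κ κ' : ℝ → ℝ} (hκ : IsC11 κ κ') (hκ0 : κ 0 = 0) {C : ℝ}
    (hκ' : ∀ t, |κ' t| ≤ C) (htr : ∀ t ∈ μ.support, (η t).trace = κ t)
    (hpos : ∀ᶠ ε in 𝓝[>] (0 : ℝ), ∀ t, (P' t + ε • η' t).PosSemidef) :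
    ∫ r, frob (force β h Q μ P P' s r) (η r) ∂μ ≤ 0 := by
  have hd := hE.isPathData hQ hmin.1 hs
  have h1 := hmin.eventually_reduced_le hm hβ hQ hE hs hη hη0 hηh hκ hκ0 hκ' htr hpos
  have h2 := hd.tendsto_reduced_quotient (h := h) hβ hη hη0
  have h3 := ge_of_tendsto h2 (b := 0) (by
    filter_upwards [h1, self_mem_nhdsWithin] with ε hε hε'
    exact mul_nonneg (inv_nonneg.mpr (le_of_lt hε')) (by linarith))
  linarith

lemma IsPathData.integrable_force (hβ : IsEvenMixture β) (hd : IsPathData Q μ P P' s)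
    (i j : Fin m) : Integrable (fun r => force β h Q μ P P' s r i j) μ := by
  have := hd.prob
  exact integrable_of_continuousOn_Icc (hd.continuousOn_force_apply hβ i j) hd.nonneg hd.le

lemma integral_frob_const {ν : Measure ℝ} {F : ℝ → Matrix (Fin m) (Fin m) ℝ}
    (hF : ∀ i j, Integrable (fun r => F r i j) ν) (B : Matrix (Fin m) (Fin m) ℝ) :
    ∫ r, frob (F r) B ∂ν = ∑ i, ∑ j, (∫ r, F r i j ∂ν) * B i j := by
  simp only [frob, ← integral_mul_const]
  exact integral_sum_sum fun i j => (hF i j).mul_const (B i j)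

lemma frob_multiplier {F : ℝ → Matrix (Fin m) (Fin m) ℝ}
    (hF : ∀ i j, Integrable (fun r => F r i j) μ) (B : Matrix (Fin m) (Fin m) ℝ) (t : ℝ) :
    frob (multiplier μ F t) B = -∫ r in Ioi t, frob (F r) B ∂μ := by
  rw [integral_frob_const fun i j => (hF i j).restrict]
  simp [frob, multiplier]

lemma IsPathData.isHermitian_force (hd : IsPathData Q μ P P' s) (t : ℝ) :
    (force β h Q μ P P' s t).IsHermitian := by
  have hP := isHermitian_iff_apply.mp (hd.isHermitian t)
  have hY : ∀ u i j, conjDeriv Q μ P P' s u j i = conjDeriv Q μ P P' s u i j := fun u => by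
    have h1 := (hd.posSemidef_deriv u).mul_mul_conjTranspose_same (invHat Q μ P P' s u)
    rw [(hd.posDef_invHat u).1.eq] at h1
    exact isHermitian_iff_apply.mp h1.1
  rw [isHermitian_iff_apply]
  intro i j
  simp only [force, Matrix.sub_apply, Matrix.add_apply, xiDeriv_apply, Matrix.of_apply,
    Matrix.vecMulVec_apply, hP i j, hY, xiEntry_comm β j i]
  ring

/-- Adding an increasing scalar function times `v vᵀ` keeps the path increasing. Smooth steps
steepening at `t` tend to the indicator of `(t, ∞)`, and the variational inequality becomes the sign
of the form at `v`. -/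
theorem IsCSMinimizer.posSemidef_multiplier (hm : 1 ≤ m) (hβ : IsEvenMixture β)
    (hQ : IsConstraint Q) (hmin : IsCSMinimizer β h Q μ Φ) (hE : IsPathExtension Φ P P')
    (hs : IsCutoff Q μ Φ s) {t : ℝ} (ht : 0 ≤ t) :
    (multiplier μ (force β h Q μ P P' s) t).PosSemidef := by
  have hd := hE.isPathData hQ hmin.1 hs
  have := hd.prob
  have hFI := fun i j => hd.integrable_force (h := h) hβ i j
  rw [posSemidef_iff_form]
  constructor
  · rw [isHermitian_iff_apply]
    intro i j
    simp only [multiplier, Matrix.of_apply,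
      isHermitian_iff_apply.mp (hd.isHermitian_force _) i j]
  intro v
  rw [← frob_vecMulVec, frob_multiplier hFI]
  set B := Matrix.vecMulVec v v with hB
  have hBpos : B.PosSemidef := by
    have := Matrix.posSemidef_vecMulVec_self_star v
    simpa using this
  have hBI : Integrable (fun r => frob (force β h Q μ P P' s r) B) μ :=
    integrable_finsetSum _ fun i _ => integrable_finsetSum _ fun j _ => (hFI i j).mul_const _
  obtain ⟨C, hC⟩ := exists_bound_deriv_smoothTransition
  have hn : ∀ n : ℕ, ∫ r, Real.smoothTransition (n * (r - t)) *
      frob (force β h Q μ P P' s r) B ∂μ ≤ 0 := fun n => by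
    have hk := isC11_smoothTransition.comp (isC11_affine n t)
    have hk0 : Real.smoothTransition (n * (0 - t)) = 0 :=
      Real.smoothTransition.zero_of_nonpos (mul_nonpos_of_nonneg_of_nonpos (by positivity)
        (by linarith))
    have := hmin.integral_force_nonpos hm hβ hQ hE hs
      (η := fun r => Real.smoothTransition (n * (r - t)) • B)
      (η' := fun r => (deriv Real.smoothTransition (n * (r - t)) * n) • B)
      (κ := fun r => B.trace * Real.smoothTransition (n * (r - t)))
      (κ' := fun r => B.trace * (deriv Real.smoothTransition (n * (r - t)) * n))
      (C := |B.trace| * (C * n))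
      (fun i j => by
        simpa only [Matrix.smul_apply, smul_eq_mul, mul_comm _ (B i j)] using hk.const_mul (B i j))
      (by simp only [hk0, zero_smul])
      (fun r => (hBpos.smul (Real.smoothTransition.nonneg _)).1)
      (hk.const_mul _) (by simp only [hk0, mul_zero])
      (fun r => by
        rw [abs_mul, abs_mul, Nat.abs_cast]
        gcongr
        exact hC _)
      (fun r _ => by rw [Matrix.trace_smul, smul_eq_mul, mul_comm])
      (by
        filter_upwards [self_mem_nhdsWithin] with ε hε r
        refine (hd.posSemidef_deriv r).add ((hBpos.smul ?_).smul (le_of_lt hε))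
        exact mul_nonneg (deriv_smoothTransition_nonneg _) (by positivity))
    simpa only [frob_smul_right] using this
  have hlim : Tendsto (fun n : ℕ => ∫ r, Real.smoothTransition (n * (r - t)) *
      frob (force β h Q μ P P' s r) B ∂μ) atTop
      (𝓝 (∫ r in Ioi t, frob (force β h Q μ P P' s r) B ∂μ)) := by
    rw [← integral_indicator measurableSet_Ioi]
    refine tendsto_integral_of_dominated_convergence
      (fun r => ‖frob (force β h Q μ P P' s r) B‖) (fun n => ?_) hBI.norm (fun n => ?_) ?_
    · exact ((Real.smoothTransition.continuous.comp (continuous_const.mul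
        (continuous_id.sub continuous_const))).aestronglyMeasurable).mul hBI.aestronglyMeasurable
    · refine Eventually.of_forall fun r => ?_
      rw [norm_mul, Real.norm_of_nonneg (Real.smoothTransition.nonneg _)]
      exact mul_le_of_le_one_left (norm_nonneg _) (Real.smoothTransition.le_one _)
    · refine Eventually.of_forall fun r => tendsto_const_nhds.congr' ?_
      by_cases hr : t < r
      · have hb : Tendsto (fun n : ℕ => (n : ℝ) * (r - t)) atTop atTop :=
          tendsto_natCast_atTop_atTop.atTop_mul_const (by linarith)
        filter_upwards [hb.eventually_ge_atTop 1] with n hn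
        rw [Real.smoothTransition.one_of_one_le hn, one_mul, indicator_of_mem (show r ∈ Ioi t from hr)]
      · refine Eventually.of_forall fun n => ?_
        have hle : (n : ℝ) * (r - t) ≤ 0 :=
          mul_nonpos_of_nonneg_of_nonpos (by positivity) (by linarith [not_lt.mp hr])
        simp only [Real.smoothTransition.zero_of_nonpos hle, zero_mul]
        rw [indicator_of_notMem (show r ∉ Ioi t from hr)]
  have := le_of_tendsto hlim (Eventually.of_forall hn)
  linarith

/-- The direction `η = -P` is allowed because `P' - ε P' = (1 - ε) P'`. Summation by parts gives `∫
⟨Λ, P'⟩ dt ≤ 0`, while the integrand is nonnegative and right continuous. -/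
theorem IsCSMinimizer.frob_multiplier_eq_zero (hm : 1 ≤ m) (hβ : IsEvenMixture β)
    (hQ : IsConstraint Q) (hmin : IsCSMinimizer β h Q μ Φ) (hE : IsPathExtension Φ P P')
    (hs : IsCutoff Q μ Φ s) {t : ℝ} (ht : t ∈ Ico 0 s) :
    frob (multiplier μ (force β h Q μ P P' s) t) (P' t) = 0 := by
  have hd := hE.isPathData hQ hmin.1 hs
  have := hd.prob
  have hFI := fun i j => hd.integrable_force (h := h) hβ i j
  have htail := fun i j => integral_mul_eq_integral_tail hd.pos.le hd.nonneg hd.le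
    (hd.continuousOn_force_apply (h := h) hβ i j) (hd.isC11 i j).hasDerivAt
    (hd.continuous_deriv_apply i j) (by simp [hd.start])
  have hq : ∀ t, frob (multiplier μ (force β h Q μ P P' s) t) (P' t) =
      -∑ i, ∑ j, (∫ r in Ioi t, force β h Q μ P P' s r i j ∂μ) * P' t i j := fun t => by
    simp [frob, multiplier]
  have hsub : ∀ r ∈ μ.support, (-P r).trace = -1 * r := fun r hr => by
    have hrm : r ∈ Icc (0 : ℝ) m := Measure.support_subset_of_isClosed isClosed_Icc
      (mem_ae_iff.mpr hmin.1.concentrated) hr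
    rw [Matrix.trace_neg, hE.eq r hrm, hmin.1.path.trace_eq r hr]; ring
  have hid : IsC11 (fun t : ℝ => t) fun _ => 1 :=
    ⟨fun t => hasDerivAt_id t, LocallyLipschitz.const 1⟩
  have hvar := hmin.integral_force_nonpos hm hβ hQ hE hs (η := fun r => -P r) (η' := fun r => -P' r)
    (κ := fun r => -1 * r) (κ' := fun _ => -1 * 1) (C := 1)
    (fun i j => by simpa using (hd.isC11 i j).const_mul (-1))
    (by simp [hd.start]) (fun r => (hd.isHermitian r).neg) (hid.const_mul (-1)) (by simp)
    (fun r => by simp) hsub (by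
      filter_upwards [Ioo_mem_nhdsGT (show (0 : ℝ) < 1 by norm_num)] with ε hε r
      have h1 : P' r + ε • -P' r = (1 - ε) • P' r := by rw [sub_smul, one_smul, smul_neg]; abel
      rw [h1]
      exact (hd.posSemidef_deriv r).smul (by linarith [hε.2]))
  have hsum : ∀ i, IntervalIntegrable (fun u => ∑ j,
      (∫ r in Ioi u, force β h Q μ P P' s r i j ∂μ) * P' u i j) volume 0 s := fun i => by
    have := IntervalIntegrable.sum Finset.univ fun j _ => (htail i j).1
    simpa only [Finset.sum_fn] using this
  refine eq_zero_of_integral_nonpos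
    (q := fun t => frob (multiplier μ (force β h Q μ P P' s) t) (P' t)) hd.pos.le ?_
    (fun u hu => frob_nonneg (hmin.posSemidef_multiplier hm hβ hQ hE hs hu.1)
      (hd.posSemidef_deriv u)) ?_ (fun u _ => ?_) ht
  · simp only [hq]
    refine IntervalIntegrable.neg ?_
    have := IntervalIntegrable.sum Finset.univ fun i _ => hsum i
    simpa only [Finset.sum_fn] using this
  · have hFP : ∀ i j, Integrable (fun r => force β h Q μ P P' s r i j * P r i j) μ := fun i j =>
      integrable_of_continuousOn_Icc ((hd.continuousOn_force_apply hβ i j).mul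
        (hd.isC11 i j).continuous.continuousOn) hd.nonneg hd.le
    have e1 : ∫ r, frob (force β h Q μ P P' s r) (-P r) ∂μ =
        -∑ i, ∑ j, ∫ r, force β h Q μ P P' s r i j * P r i j ∂μ := by
      simp only [frob_neg_right]
      rw [integral_neg]
      exact congrArg Neg.neg (integral_sum_sum hFP)
    rw [e1] at hvar
    simp only [hq]
    rw [intervalIntegral.integral_neg, intervalIntegral.integral_finsetSum fun i _ => hsum i]
    simp only [intervalIntegral.integral_finsetSum fun j _ => (htail _ j).1, ← (htail _ _).2]
    exact hvar
  · refine tendsto_frob ?_ ((hd.continuous_deriv.tendsto u).mono_left nhdsWithin_le_nhds)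
    exact tendsto_pi_nhds.mpr fun i => tendsto_pi_nhds.mpr fun j =>
      (tendsto_tail_right (hFI i j) u).neg

end Stationarity

/-! ### One-sided expansion of the complementarity relation. -/

section Local

variable {m : ℕ}

/-- First-order expansion of the complementarity relation `⟨N, X⟩ = 0` between positive
semidefinite matrices, when the leading perturbation `f` of `N` at `M` is two-sided. -/
lemma eventually_frob_le_of_expansion {l : Filter ℝ} [l.NeBot]
    {M f F₁ D : Matrix (Fin m) (Fin m) ℝ} {N X R : ℝ → Matrix (Fin m) (Fin m) ℝ}
    {ε ε' ρ : ℝ → ℝ} {a K : ℝ} (ha : 0 < a) (hM : M.PosSemidef) (hMf : (M - a • f).PosSemidef)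
    (hf : f.IsHermitian) (hD : D.PosSemidef) (hMD : frob M D = 0) (hfD : frob f D = 0)
    (hN : ∀ᶠ t in l, N t = M + ε t • f + ε' t • F₁ + R t) (hNpos : ∀ᶠ t in l, (N t).PosSemidef)
    (hX : ∀ᶠ t in l, (X t).PosSemidef) (hNX : ∀ᶠ t in l, frob (N t) (X t) = 0)
    (hε : ∀ᶠ t in l, 0 < ε t) (hε0 : Tendsto ε l (𝓝 0))
    (hε' : ∀ᶠ t in l, 0 < ε' t ∧ ε' t ≤ ρ t * ε t)
    (hR : ∀ δ > 0, ∀ᶠ t in l, ∀ i j, |R t i j| ≤ δ * ε' t)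
    (hXD : ∀ᶠ t in l, ∀ i j, |(X t - D) i j| ≤ K * ρ t) (hρ : Tendsto ρ l (𝓝 0)) :
    ∀ δ > 0, ∀ᶠ t in l, frob F₁ (X t) ≤ δ * ρ t := by
  have hRB : ∀ (B : Matrix (Fin m) (Fin m) ℝ), ∀ δ > 0, ∀ᶠ t in l, |frob (R t) B| ≤ δ * ε' t := by
    intro B δ hδ
    have hb : ∀ i j, |B i j| ≤ ∑ i, ∑ j, |B i j| := fun i j =>
      (Finset.single_le_sum (f := fun j => |B i j|) (fun _ _ => abs_nonneg _)
        (Finset.mem_univ j)).trans (Finset.single_le_sum (f := fun i => ∑ j, |B i j|)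
          (fun _ _ => Finset.sum_nonneg fun _ _ => abs_nonneg _) (Finset.mem_univ i))
    have hb0 : 0 ≤ ∑ i, ∑ j, |B i j| :=
      Finset.sum_nonneg fun _ _ => Finset.sum_nonneg fun _ _ => abs_nonneg _
    set b := ∑ i, ∑ j, |B i j|
    filter_upwards [hR (δ / (m ^ 2 * b + 1)) (by positivity), hε'] with t ht ht'
    refine (abs_frob_le (mul_nonneg (by positivity) ht'.1.le) ht hb).trans ?_
    have h1 : (m : ℝ) ^ 2 * b / (m ^ 2 * b + 1) ≤ 1 := by
      rw [div_le_one (by positivity)]; linarith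
    calc (m : ℝ) ^ 2 * (δ / (m ^ 2 * b + 1) * ε' t * b)
        = δ * ε' t * ((m : ℝ) ^ 2 * b / (m ^ 2 * b + 1)) := by ring
      _ ≤ δ * ε' t := mul_le_of_le_one_right (mul_nonneg hδ.le ht'.1.le) h1
  -- On the kernel of `M`, positivity of `N` makes the form of `f` nonnegative and positivity of `M
  -- - a f` makes it nonpositive. The form of `M - a f` then vanishes at `v`, so `M - a f` kills
  -- `v`, and so does `f`.
  have hker : ∀ v, M.mulVec v = 0 → f.mulVec v = 0 := by
    intro v hv
    have hB : (Matrix.vecMulVec v v).PosSemidef := by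
      simpa using Matrix.posSemidef_vecMulVec_self_star v
    have hMB : frob M (Matrix.vecMulVec v v) = 0 := by rw [frob_vecMulVec, hv, dotProduct_zero]
    have h1 : 0 ≤ frob f (Matrix.vecMulVec v v) := by
      have hlim : Tendsto (fun t => -(ρ t * (|frob F₁ (Matrix.vecMulVec v v)| + 1))) l (𝓝 0) := by
        simpa using (hρ.mul_const (|frob F₁ (Matrix.vecMulVec v v)| + 1)).neg
      refine le_of_tendsto hlim ?_
      filter_upwards [hN, hNpos, hε, hε', hRB (Matrix.vecMulVec v v) 1 one_pos]
        with t h1 h2 h3 h4 h5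
      have h6 := frob_nonneg h2 hB
      rw [h1, frob_add_left, frob_add_left, frob_add_left, frob_smul_left, frob_smul_left, hMB] at h6
      have h7 : ε' t * frob F₁ (Matrix.vecMulVec v v) ≤
          ε' t * |frob F₁ (Matrix.vecMulVec v v)| := by
        gcongr
        · exact h4.1.le
        · exact le_abs_self _
      have h8 := (abs_le.mp h5).2
      have h9 : ε' t * (|frob F₁ (Matrix.vecMulVec v v)| + 1) ≤
          ρ t * ε t * (|frob F₁ (Matrix.vecMulVec v v)| + 1) := by
        gcongr
        exact h4.2
      have h10 : ε t * -(ρ t * (|frob F₁ (Matrix.vecMulVec v v)| + 1)) ≤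
          ε t * frob f (Matrix.vecMulVec v v) := by linarith
      exact le_of_mul_le_mul_left h10 h3
    have h2 := frob_nonneg hMf hB
    rw [frob_sub_left, frob_smul_left, hMB] at h2
    have h3 : frob f (Matrix.vecMulVec v v) = 0 := by nlinarith
    have h4 : (M - a • f).mulVec v = 0 := by
      refine mulVec_eq_zero_of_form hMf ?_
      rw [← frob_vecMulVec, frob_sub_left, frob_smul_left, hMB, h3]; simp
    rw [Matrix.sub_mulVec, hv, Matrix.smul_mulVec, zero_sub, neg_eq_zero, smul_eq_zero] at h4
    exact h4.resolve_left ha.ne'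
  obtain ⟨δ₀, hδ₀, hpos⟩ := exists_posSemidef_add_smul hM hf hker
  -- Subtract the nonnegative term `⟨M + ε f, X⟩` from `⟨N, X⟩ = 0`.
  have hineq : ∀ᶠ t in l, ε' t * frob F₁ (X t) + frob (R t) (X t) ≤ 0 := by
    filter_upwards [hN, hX, hNX, hε, hε0.eventually_lt_const hδ₀] with t h1 h2 h3 h4 h5
    have h6 := frob_nonneg (hpos (ε t) h4.le h5.le) h2
    rw [h1, frob_add_left, frob_add_left, frob_smul_left _ F₁] at h3
    linarith
  have hRX : ∀ δ > 0, ∀ᶠ t in l, |frob (R t) (X t - D)| ≤ δ * ρ t * ε' t := by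
    intro δ hδ
    filter_upwards [hR (δ / (m ^ 2 * |K| + 1)) (by positivity), hXD, hε', hε] with t h1 h2 h3 h4
    have hρ0 : 0 ≤ ρ t := by
      by_contra hneg
      nlinarith [h3.1, h3.2, mul_neg_of_neg_of_pos (not_le.mp hneg) h4]
    have h2' : ∀ i j, |(X t - D) i j| ≤ |K| * ρ t := fun i j =>
      (h2 i j).trans (mul_le_mul_of_nonneg_right (le_abs_self K) hρ0)
    refine (abs_frob_le (mul_nonneg (by positivity) h3.1.le) h1 h2').trans ?_
    have h5 : (m : ℝ) ^ 2 * |K| / (m ^ 2 * |K| + 1) ≤ 1 := by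
      rw [div_le_one (by positivity)]; linarith
    calc (m : ℝ) ^ 2 * (δ / (m ^ 2 * |K| + 1) * ε' t * (|K| * ρ t))
        = δ * ρ t * ε' t * ((m : ℝ) ^ 2 * |K| / (m ^ 2 * |K| + 1)) := by ring
      _ ≤ δ * ρ t * ε' t := mul_le_of_le_one_right
          (mul_nonneg (mul_nonneg hδ.le hρ0) h3.1.le) h5
  have hXlim : Tendsto X l (𝓝 D) := by
    refine tendsto_pi_nhds.mpr fun i => tendsto_pi_nhds.mpr fun j => ?_
    rw [tendsto_iff_norm_sub_tendsto_zero]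
    refine squeeze_zero' (Eventually.of_forall fun t => norm_nonneg _) (hXD.mono fun t ht => ht i j) ?_
    simpa using hρ.const_mul K
  -- Divide `hineq` by `ε'` and let `t` tend to the limit.
  have hFD : frob F₁ D ≤ 0 := by
    refine le_of_forall_pos_le_add fun δ hδ => ?_
    have hlim : Tendsto (fun t => frob F₁ (X t) - 1 * ρ t) l (𝓝 (frob F₁ D - 1 * 0)) :=
      (tendsto_frob tendsto_const_nhds hXlim).sub (hρ.const_mul 1)
    rw [mul_zero, sub_zero] at hlim
    rw [zero_add]
    refine le_of_tendsto hlim ?_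
    filter_upwards [hineq, hRB D δ hδ, hRX 1 one_pos, hε'] with t h1 h2 h3 h4
    have h5 : frob (R t) (X t) = frob (R t) D + frob (R t) (X t - D) := by
      rw [frob_sub_right]; ring
    rw [h5] at h1
    have h6 : ε' t * (frob F₁ (X t) - 1 * ρ t) ≤ ε' t * δ := by
      linarith [(abs_le.mp h2).1, (abs_le.mp h3).1]
    exact le_of_mul_le_mul_left h6 h4.1
  intro δ hδ
  -- The gain from `o(1)` to `o(ρ)`: positivity of `⟨N, D⟩` forces `⟨R, D⟩ ≥ -ε' ⟨F₁, D⟩ ≥ 0`, so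
  -- only `⟨R, X - D⟩` has to be estimated.
  filter_upwards [hineq, hRX δ hδ, hε', hN, hNpos] with t h1 h2 h3 h4 h5
  have h6 : frob (R t) (X t) = frob (R t) D + frob (R t) (X t - D) := by
    rw [frob_sub_right]; ring
  have h7 := frob_nonneg h5 hD
  rw [h4, frob_add_left, frob_add_left, frob_add_left, frob_smul_left, frob_smul_left, hMD, hfD] at h7
  have h8 : ε' t * frob F₁ D ≤ 0 := mul_nonpos_of_nonneg_of_nonpos h3.1.le hFD
  rw [h6] at h1
  have h9 : ε' t * frob F₁ (X t) ≤ ε' t * (δ * ρ t) := by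
    linarith [(abs_le.mp h2).1]
  exact le_of_mul_le_mul_left h9 h3.1

/-- The points `t → u` in the filter `l` lie on the side `σ (t - u) > 0` of `u`, inside `S`, and
`I t` consists of points between `u` (excluded) and `t`. -/
structure IsSide (u σ : ℝ) (l : Filter ℝ) (S : Set ℝ) (I : ℝ → Set ℝ) : Prop where
  mul_self : σ * σ = 1
  neBot : l.NeBot
  le : l ≤ 𝓝[S \ {u}] u
  measurableSet : ∀ t, MeasurableSet (I t)
  mem : ∀ t, ∀ r ∈ I t, 0 < σ * (r - u) ∧ σ * (r - u) ≤ σ * (t - u)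
  pos : ∀ᶠ t in l, 0 < σ * (t - u)
  forall_mem : ∀ {q : ℝ → Prop}, (∀ᶠ t in l, q t) → ∀ᶠ t in l, ∀ r ∈ I t, q r
  mul_neg_of_deriv_neg : ∀ {p p' : ℝ → ℝ}, (∀ᶠ t in 𝓝 u, HasDerivAt p (p' t) t) → p u = 0 →
    (∀ᶠ t in l, p' t < 0) → ∀ᶠ t in l, σ * p t < 0

lemma IsSide.abs_eq_one {u σ : ℝ} {l : Filter ℝ} {S : Set ℝ} {I : ℝ → Set ℝ}
    (hS : IsSide u σ l S I) : |σ| = 1 := by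
  have : |σ| * |σ| = 1 := by rw [abs_mul_abs_self, hS.mul_self]
  nlinarith [abs_nonneg σ]

lemma isSide_right (u : ℝ) : IsSide u 1 (𝓝[>] u) (Ici u) (Ioc u) where
  mul_self := one_mul 1
  neBot := inferInstance
  le := nhdsWithin_mono _ fun t (ht : u < t) => ⟨ht.le, ht.ne'⟩
  measurableSet _ := measurableSet_Ioc
  mem t r hr := ⟨by linarith [hr.1], by linarith [hr.2]⟩
  pos := by
    filter_upwards [self_mem_nhdsWithin] with t ht
    linarith [show u < t from ht]
  forall_mem {q} hq := by
    obtain ⟨b, hb, hbq⟩ := mem_nhdsGT_iff_exists_Ioo_subset.mp hq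
    filter_upwards [Ioo_mem_nhdsGT hb] with t ht r hr
    exact hbq ⟨hr.1, hr.2.trans_lt ht.2⟩
  mul_neg_of_deriv_neg {p p'} hp hpu hp' := by
    obtain ⟨b, hb, hbq⟩ := mem_nhdsGT_iff_exists_Ioo_subset.mp
      (hp'.and (nhdsWithin_le_nhds hp))
    filter_upwards [Ioo_mem_nhdsGT hb] with t ht
    have hanti : StrictAntiOn p (Icc u t) := by
      refine strictAntiOn_of_deriv_neg (convex_Icc _ _) (fun r hr => ?_) fun r hr => ?_
      · rcases hr.1.eq_or_lt with rfl | h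
        · exact hp.self_of_nhds.continuousAt.continuousWithinAt
        · exact (hbq ⟨h, hr.2.trans_lt ht.2⟩).2.continuousAt.continuousWithinAt
      · rw [interior_Icc] at hr
        have := hbq ⟨hr.1, hr.2.trans ht.2⟩
        rw [this.2.deriv]; exact this.1
    have := hanti (left_mem_Icc.mpr ht.1.le) (right_mem_Icc.mpr ht.1.le) ht.1
    linarith

lemma isSide_left (u : ℝ) : IsSide u (-1) (𝓝[<] u) (Iic u) (fun t => Ioo t u) where
  mul_self := by norm_num
  neBot := inferInstance
  le := nhdsWithin_mono _ fun t (ht : t < u) => ⟨ht.le, ht.ne⟩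
  measurableSet _ := measurableSet_Ioo
  mem t r hr := ⟨by linarith [hr.2], by linarith [hr.1]⟩
  pos := by
    filter_upwards [self_mem_nhdsWithin] with t ht
    linarith [show t < u from ht]
  forall_mem {q} hq := by
    obtain ⟨b, hb, hbq⟩ := mem_nhdsLT_iff_exists_Ioo_subset.mp hq
    filter_upwards [Ioo_mem_nhdsLT hb] with t ht r hr
    exact hbq ⟨ht.1.trans hr.1, hr.2⟩
  mul_neg_of_deriv_neg {p p'} hp hpu hp' := by
    obtain ⟨b, hb, hbq⟩ := mem_nhdsLT_iff_exists_Ioo_subset.mp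
      (hp'.and (nhdsWithin_le_nhds hp))
    filter_upwards [Ioo_mem_nhdsLT hb] with t ht
    have hanti : StrictAntiOn p (Icc t u) := by
      refine strictAntiOn_of_deriv_neg (convex_Icc _ _) (fun r hr => ?_) fun r hr => ?_
      · rcases hr.2.eq_or_lt with rfl | h
        · exact hp.self_of_nhds.continuousAt.continuousWithinAt
        · exact (hbq ⟨ht.1.trans_le hr.1, h⟩).2.continuousAt.continuousWithinAt
      · rw [interior_Icc] at hr
        have := hbq ⟨ht.1.trans hr.1, hr.2⟩
        rw [this.2.deriv]; exact this.1
    have := hanti (left_mem_Icc.mpr ht.2.le) (right_mem_Icc.mpr ht.2.le) ht.2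
    linarith

/-- Integral form of the previous expansion, on one side of a point. -/
lemma eventually_frob_le_of_side {μ : Measure ℝ} [IsFiniteMeasure μ] {l : Filter ℝ}
    {u σ a K : ℝ} {S : Set ℝ} {I : ℝ → Set ℝ} {M F₁ : Matrix (Fin m) (Fin m) ℝ}
    {F N X : ℝ → Matrix (Fin m) (Fin m) ℝ} (hS : IsSide u σ l S I)
    (hI0 : ∀ᶠ t in l, 0 < μ.real (I t))
    (hIlim : Tendsto (fun t => μ.real (I t)) l (𝓝 0))
    (hF : ∀ i j, Integrable (fun r => F r i j) μ)
    (hF₁ : ∀ i j, HasDerivAt (fun r => F r i j) (F₁ i j) u) (hFu : (F u).IsHermitian)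
    (ha : 0 < a) (hM : M.PosSemidef) (hMf : (M - (a * σ) • F u).PosSemidef)
    (hMD : frob M (X u) = 0) (hFD : frob (F u) (X u) = 0)
    (hN : ∀ᶠ t in l, ∀ i j, N t i j = M i j + σ * ∫ r in I t, F r i j ∂μ)
    (hNpos : ∀ᶠ t in l, (N t).PosSemidef) (hX : ∀ t, (X t).PosSemidef)
    (hNX : ∀ᶠ t in l, frob (N t) (X t) = 0)
    (hXK : ∀ᶠ t in l, ∀ i j, |(X t - X u) i j| ≤ K * (σ * (t - u))) :
    ∀ δ > 0, ∀ᶠ t in l, frob F₁ (X t) ≤ δ * (σ * (t - u)) := by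
  have := hS.neBot
  have hl : l ≤ 𝓝 u := hS.le.trans nhdsWithin_le_nhds
  have hσ1 := hS.abs_eq_one
  have hI := hS.measurableSet
  have hIσ := hS.mem
  have hρ : Tendsto (fun t => σ * (t - u)) l (𝓝 0) := by
    have : Tendsto (fun t => σ * (t - u)) (𝓝 u) (𝓝 (σ * (u - u))) :=
      (continuous_const.mul (continuous_id.sub continuous_const)).tendsto u
    rw [sub_self, mul_zero] at this
    exact this.mono_left hl
  have hbd : ∀ t, ∀ r ∈ I t, |r - u| ≤ |t - u| := fun t r hr => by
    have := abs_le_abs_of_nonneg (hIσ t r hr).1.le (hIσ t r hr).2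
    simpa [abs_mul, hσ1] using this
  have hint1 : ∀ t, IntegrableOn (fun r => r - u) (I t) μ := fun t => by
    refine Integrable.mono' (g := fun _ => |t - u|) (integrable_const _)
      (continuous_id.sub continuous_const).aestronglyMeasurable ?_
    filter_upwards [ae_restrict_mem (hI t)] with r hr using hbd t r hr
  -- Here `ε` is the mass of `I t`, `ε'` its first absolute moment about `u`, and `R` the integrated
  -- Taylor remainder of `F`. The moment is at most `|t - u|` times the mass.
  refine eventually_frob_le_of_expansion (M := M) (f := σ • F u) (D := X u) (N := N)
    (R := fun t => Matrix.of fun i j =>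
      σ * ∫ r in I t, (F r i j - F u i j - (r - u) * F₁ i j) ∂μ)
    (ε := fun t => μ.real (I t)) (ε' := fun t => ∫ r in I t, σ * (r - u) ∂μ) (a := a) (K := K)
    ha hM ?_ ?_ (hX u) hMD ?_ ?_ hNpos (Eventually.of_forall hX) hNX hI0 hIlim ?_ ?_ hXK hρ
  · rwa [smul_smul]
  · rw [isHermitian_iff_apply] at hFu ⊢
    intro i j; simp [hFu i j]
  · rw [frob_smul_left, hFD, mul_zero]
  · filter_upwards [hN] with t ht
    ext i j
    have h1 : ∫ r in I t, (F r i j - F u i j - (r - u) * F₁ i j) ∂μ =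
        (∫ r in I t, F r i j ∂μ) - μ.real (I t) * F u i j - (∫ r in I t, (r - u) ∂μ) * F₁ i j := by
      have hc : Integrable (fun _ => F u i j) (μ.restrict (I t)) := integrable_const _
      refine (integral_sub ((hF i j).restrict.sub hc) ((hint1 t).mul_const _)).trans ?_
      rw [integral_mul_const]
      refine congrArg (· - _) ((integral_sub (hF i j).restrict hc).trans ?_)
      rw [setIntegral_const, smul_eq_mul]
    simp only [ht i j, Matrix.add_apply, Matrix.smul_apply, smul_eq_mul, Matrix.of_apply, h1,
      integral_const_mul]
    ring
  · filter_upwards [hI0] with t ht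
    have hpos : ∀ r ∈ I t, 0 < σ * (r - u) := fun r hr => (hIσ t r hr).1
    constructor
    · rw [setIntegral_pos_iff_support_of_nonneg_ae]
      · have : Function.support (fun r => σ * (r - u)) ∩ I t = I t :=
          inter_eq_right.mpr fun r hr => (hpos r hr).ne'
        rw [this]
        exact (ENNReal.toReal_pos_iff.mp ht).1
      · filter_upwards [ae_restrict_mem (hI t)] with r hr using (hpos r hr).le
      · exact (hint1 t).const_mul _
    · have := setIntegral_mono_on ((hint1 t).const_mul σ)
        (integrableOn_const (s := I t) (C := σ * (t - u)) (measure_ne_top _ _)) (hI t)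
        fun r hr => (hIσ t r hr).2
      rw [setIntegral_const, smul_eq_mul] at this
      linarith
  · intro δ hδ
    have hev : ∀ᶠ r in 𝓝 u, ∀ i j, |F r i j - F u i j - (r - u) * F₁ i j| ≤ δ * |r - u| := by
      simp only [eventually_all]
      intro i j
      simpa using (hF₁ i j).isLittleO.def hδ
    obtain ⟨γ, hγ, hball⟩ := Metric.eventually_nhds_iff.mp hev
    have hnear : ∀ᶠ t in l, dist t u < γ := hl (Metric.ball_mem_nhds u hγ)
    filter_upwards [hnear] with t ht i j
    simp only [Matrix.of_apply]
    rw [abs_mul, hσ1, one_mul, ← integral_const_mul, ← Real.norm_eq_abs]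
    refine norm_integral_le_of_norm_le (((hint1 t).const_mul σ).const_mul δ) ?_
    filter_upwards [ae_restrict_mem (hI t)] with r hr
    have h1 := hball (y := r) ((hbd t r hr).trans_lt ht) i j
    have h2 : |r - u| = σ * (r - u) := by
      rw [← abs_of_pos (hIσ t r hr).1, abs_mul, hσ1, one_mul]
    rw [h2] at h1
    exact h1

end Local

/-! ### Derivatives of the force and the second-order condition. -/

section Force

variable {m : ℕ} {Q : Matrix (Fin m) (Fin m) ℝ} {μ : Measure ℝ}
  {P P' : ℝ → Matrix (Fin m) (Fin m) ℝ} {s : ℝ} {β : ℕ → Fin m → ℝ} {h : Fin m → ℝ}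

/-- The linear map `B ↦ ξ''(P(t)) ⊙ B - P̂(t)⁻¹ B P̂(t)⁻¹`, whose value at `P'(t)` is the
derivative of the force. -/
noncomputable def forceLin (β : ℕ → Fin m → ℝ) (Q : Matrix (Fin m) (Fin m) ℝ)
    (μ : Measure ℝ) (P P' : ℝ → Matrix (Fin m) (Fin m) ℝ) (s t : ℝ)
    (B : Matrix (Fin m) (Fin m) ℝ) : Matrix (Fin m) (Fin m) ℝ :=
  (Matrix.of fun i j => deriv (xiEntry β i j) (P t i j) * B i j) -
    invHat Q μ P P' s t * B * invHat Q μ P P' s t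

/-- The diagonal part `ξ'''(P(t)) ⊙ P'(t) ⊙ B` of the derivative of `forceLin`. -/
noncomputable def xiThird (β : ℕ → Fin m → ℝ) (P P' : ℝ → Matrix (Fin m) (Fin m) ℝ) (t : ℝ)
    (B : Matrix (Fin m) (Fin m) ℝ) : Matrix (Fin m) (Fin m) ℝ :=
  Matrix.of fun i j => deriv (deriv (xiEntry β i j)) (P t i j) * P' t i j * B i j

lemma IsPathData.apply_mem_Ioo (hd : IsPathData Q μ P P' s) {t : ℝ} (ht : t ∈ Icc 0 s)
    (i j : Fin m) : P t i j ∈ Ioo (-3 / 2 : ℝ) (3 / 2) := by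
  have := _root_.abs_le.mp (hd.abs_le t ht i j)
  exact ⟨by linarith [this.1], by linarith [this.2]⟩

lemma IsPathData.hasDerivAt_force (hβ : IsEvenMixture β) (hd : IsPathData Q μ P P' s) {t : ℝ}
    (ht : t ∈ Icc 0 s) (i j : Fin m) :
    HasDerivAt (fun r => force β h Q μ P P' s r i j) (forceLin β Q μ P P' s t (P' t) i j) t := by
  have h1 := (analyticOnNhd_xiEntry hβ i j _
    (hd.apply_mem_Ioo ht i j)).differentiableAt.hasDerivAt.comp t ((hd.isC11 i j).hasDerivAt t)
  have h2 : Continuous fun u => conjDeriv Q μ P P' s u i j :=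
    (continuous_apply_apply i j).comp hd.continuous_conjDeriv
  exact (h1.add_const _).sub (h2.integral_hasStrictDerivAt 0 t).hasDerivAt

/-- Entrywise multiplication and conjugation by a symmetric matrix are self-adjoint. This moves the
argument `P' t` out of the linear map, so that `P'` need not be differentiated. -/
lemma IsPathData.frob_forceLin_comm (hd : IsPathData Q μ P P' s) (t : ℝ)
    (B C : Matrix (Fin m) (Fin m) ℝ) :
    frob (forceLin β Q μ P P' s t B) C = frob (forceLin β Q μ P P' s t C) B := by
  rw [forceLin, forceLin, frob_sub_left, frob_sub_left, frob_conj (hd.posDef_invHat t).1,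
    frob_comm B]
  congr 1
  refine Finset.sum_congr rfl fun i _ => Finset.sum_congr rfl fun j _ => ?_
  simp only [Matrix.of_apply]
  ring

lemma hasDerivWithinAt_mul_mul_apply {A : ℝ → Matrix (Fin m) (Fin m) ℝ}
    {A' B : Matrix (Fin m) (Fin m) ℝ} {S : Set ℝ} {t : ℝ}
    (hA : ∀ i j, HasDerivWithinAt (fun r => A r i j) (A' i j) S t) (i j : Fin m) :
    HasDerivWithinAt (fun r => (A r * B * A r) i j) ((A' * B * A t + A t * B * A') i j) S t := by
  simp only [Matrix.mul_apply, Matrix.add_apply, ← Finset.sum_add_distrib]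
  refine HasDerivWithinAt.fun_sum fun k _ => HasDerivWithinAt.mul ?_ (hA k j)
  exact HasDerivWithinAt.fun_sum fun l _ => (hA i l).mul_const _

/-- The constant `c` is the one-sided value of the distribution function, the only quantity here
that distinguishes the two sides. -/
lemma IsPathData.hasDerivWithinAt_forceLin (hβ : IsEvenMixture β) (hd : IsPathData Q μ P P' s)
    {t c : ℝ} (ht : t ∈ Icc 0 s) {S : Set ℝ} (hZ : ∀ i j, HasDerivWithinAt
      (fun r => invHat Q μ P P' s r i j) (c * conjDeriv Q μ P P' s t i j) S t)
    (B : Matrix (Fin m) (Fin m) ℝ) (i j : Fin m) :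
    HasDerivWithinAt (fun r => forceLin β Q μ P P' s r B i j)
      ((xiThird β P P' t B - c • (conjDeriv Q μ P P' s t * B * invHat Q μ P P' s t +
        invHat Q μ P P' s t * B * conjDeriv Q μ P P' s t)) i j) S t := by
  have h1 := ((analyticOnNhd_xiEntry hβ i j _
    (hd.apply_mem_Ioo ht i j)).deriv.differentiableAt.hasDerivAt.comp t
      ((hd.isC11 i j).hasDerivAt t)).mul_const (B i j)
  have h2 := hasDerivWithinAt_mul_mul_apply (A' := c • conjDeriv Q μ P P' s t) (B := B) hZ i j
  refine (h1.hasDerivWithinAt.sub h2).congr_deriv ?_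
  simp [xiThird]

/-- If the force obeys the one-sided first-order bound and the second-order coefficient has the
wrong sign, then `⟨F, D⟩` decreases on this side. -/
lemma IsPathData.eventually_frob_deriv_neg (hβ : IsEvenMixture β) (hd : IsPathData Q μ P P' s)
    {u σ c : ℝ} {l : Filter ℝ} {S : Set ℝ} {I : ℝ → Set ℝ} (hS : IsSide u σ l S I)
    (hu : u ∈ Icc 0 s) (hZ : ∀ i j, HasDerivWithinAt
      (fun r => invHat Q μ P P' s r i j) (c * conjDeriv Q μ P P' s u i j) S u)
    (hle : ∀ δ > 0, ∀ᶠ t in l,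
      frob (forceLin β Q μ P P' s u (P' u)) (P' t) ≤ δ * (σ * (t - u)))
    (hneg : σ * (frob (xiThird β P P' u (P' u)) (P' u) - 2 * c *
      frob (invHat Q μ P P' s u * P' u * invHat Q μ P P' s u * P' u * invHat Q μ P P' s u)
        (P' u)) < 0) :
    ∀ᶠ t in l, frob (forceLin β Q μ P P' s t (P' t)) (P' u) < 0 := by
  set ℓ := frob (xiThird β P P' u (P' u)) (P' u) - 2 * c *
      frob (invHat Q μ P P' s u * P' u * invHat Q μ P P' s u * P' u * invHat Q μ P P' s u)
        (P' u) with hℓ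
  have hlim := (tendsto_frob (hasDerivWithinAt_entries_iff.mp
    (hd.hasDerivWithinAt_forceLin hβ hu hZ (P' u))) ((hd.continuous_deriv.tendsto u).mono_left
      nhdsWithin_le_nhds)).mono_left hS.le
  have hval : frob (xiThird β P P' u (P' u) - c • (conjDeriv Q μ P P' s u * P' u *
      invHat Q μ P P' s u + invHat Q μ P P' s u * P' u * conjDeriv Q μ P P' s u)) (P' u) = ℓ := by
    rw [hℓ, frob_sub_left, frob_smul_left, frob_add_left]
    simp only [conjDeriv, Matrix.mul_assoc]
    ring
  rw [hval] at hlim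
  have hlt := (hlim.const_mul σ).eventually_lt_const (u := σ * ℓ / 2) (by linarith)
  filter_upwards [hlt, hle (-(σ * ℓ) / 2) (by linarith), hS.pos] with t h1 h2 h3
  have htu : t - u ≠ 0 := fun h => by simp [h] at h3
  -- After the swap, the part frozen at `u` is controlled by `hle`, and the increment of the linear
  -- map is `(t - u) ℓ` to first order.
  rw [hd.frob_forceLin_comm]
  have h4 : frob (forceLin β Q μ P P' s t (P' u)) (P' t) =
      frob (forceLin β Q μ P P' s u (P' u)) (P' t) + (t - u) * frob ((t - u)⁻¹ •
        (forceLin β Q μ P P' s t (P' u) - forceLin β Q μ P P' s u (P' u))) (P' t) := by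
    rw [frob_smul_left, frob_sub_left, mul_inv_cancel_left₀ htu]; ring
  set g := frob ((t - u)⁻¹ •
        (forceLin β Q μ P P' s t (P' u) - forceLin β Q μ P P' s u (P' u))) (P' t)
  have h5 : (t - u) * g = σ * (t - u) * (σ * g) := by
    rw [show σ * (t - u) * (σ * g) = (σ * σ) * ((t - u) * g) by ring, hS.mul_self, one_mul]
  rw [h4, h5]
  nlinarith [mul_lt_mul_of_pos_left h1 h3]

/-- The second-order condition on one side of an atom at which mass accumulates. -/
lemma IsPathData.second_order_nonneg (hβ : IsEvenMixture β) (hd : IsPathData Q μ P P' s)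
    {u σ a c : ℝ} {l : Filter ℝ} {S : Set ℝ} {I : ℝ → Set ℝ} (hS : IsSide u σ l S I)
    (hu : u ∈ Ioo 0 s) (hZ : ∀ i j, HasDerivWithinAt
      (fun r => invHat Q μ P P' s r i j) (c * conjDeriv Q μ P P' s u i j) S u)
    (hI0 : ∀ᶠ t in l, 0 < μ.real (I t)) (hIlim : Tendsto (fun t => μ.real (I t)) l (𝓝 0))
    {M : Matrix (Fin m) (Fin m) ℝ} (ha : 0 < a) (hM : M.PosSemidef)
    (hMf : (M - (a * σ) • force β h Q μ P P' s u).PosSemidef) (hMD : frob M (P' u) = 0)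
    (hFD : frob (force β h Q μ P P' s u) (P' u) = 0)
    (hN : ∀ᶠ t in l, ∀ i j, multiplier μ (force β h Q μ P P' s) t i j =
      M i j + σ * ∫ r in I t, force β h Q μ P P' s r i j ∂μ)
    (hNpos : ∀ᶠ t in l, (multiplier μ (force β h Q μ P P' s) t).PosSemidef)
    (hNX : ∀ᶠ t in l, frob (multiplier μ (force β h Q μ P P' s) t) (P' t) = 0) :
    0 ≤ σ * (frob (xiThird β P P' u (P' u)) (P' u) - 2 * c *
      frob (invHat Q μ P P' s u * P' u * invHat Q μ P P' s u * P' u * invHat Q μ P P' s u)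
        (P' u)) := by
  have := hd.prob
  have := hS.neBot
  have hl : l ≤ 𝓝 u := hS.le.trans nhdsWithin_le_nhds
  have hFI := fun i j => hd.integrable_force (h := h) hβ i j
  have hu' : u ∈ Icc 0 s := Ioo_subset_Icc_self hu
  by_contra hneg
  obtain ⟨K, hK⟩ : ∃ K, ∀ᶠ t in l, ∀ i j, |(P' t - P' u) i j| ≤ K * (σ * (t - u)) := by
    choose K U hU hK using fun i j => (hd.isC11 i j).locallyLipschitz u
    refine ⟨∑ i, ∑ j, (K i j : ℝ), ?_⟩
    have hev : ∀ᶠ t in l, ∀ i j, t ∈ U i j := by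
      simp only [eventually_all]
      exact fun i j => hl (hU i j)
    filter_upwards [hev, hS.pos] with t ht ht0 i j
    have h1 := (hK i j).dist_le_mul t (ht i j) u (mem_of_mem_nhds (hU i j))
    have h2 : dist t u = σ * (t - u) := by
      rw [Real.dist_eq, ← abs_of_pos ht0, abs_mul, hS.abs_eq_one, one_mul]
    rw [h2] at h1
    refine h1.trans (mul_le_mul_of_nonneg_right ?_ ht0.le)
    exact (Finset.single_le_sum (f := fun j => (K i j : ℝ)) (fun _ _ => NNReal.coe_nonneg _)
      (Finset.mem_univ j)).trans (Finset.single_le_sum (f := fun i => ∑ j, (K i j : ℝ))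
        (fun _ _ => Finset.sum_nonneg fun _ _ => NNReal.coe_nonneg _) (Finset.mem_univ i))
  have hle := eventually_frob_le_of_side hS hI0 hIlim hFI
    (fun i j => hd.hasDerivAt_force (h := h) hβ hu' i j) (hd.isHermitian_force u) ha hM hMf hMD hFD
    hN hNpos hd.posSemidef_deriv hNX hK
  have hdneg := hd.eventually_frob_deriv_neg hβ hS hu' hZ hle (not_le.mp hneg)
  have hder : ∀ᶠ t in 𝓝 u, HasDerivAt (fun t => frob (force β h Q μ P P' s t) (P' u))
      (frob (forceLin β Q μ P P' s t (P' t)) (P' u)) t := by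
    filter_upwards [Icc_mem_nhds hu.1 hu.2] with t ht
    exact HasDerivAt.fun_sum fun i _ => HasDerivAt.fun_sum fun j _ =>
      (hd.hasDerivAt_force hβ ht i j).mul_const _
  -- `⟨F, P' u⟩` vanishes at `u` and is decreasing on this side, which fixes its sign on all of `I
  -- t`.
  have hsign := hS.forall_mem (hS.mul_neg_of_deriv_neg hder hFD hdneg)
  obtain ⟨t, h1, h2, h3, h4⟩ := (hsign.and (hI0.and (hN.and hNpos))).exists
  have hpI : Integrable (fun r => frob (force β h Q μ P P' s r) (P' u)) (μ.restrict (I t)) :=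
    (integrable_finsetSum _ fun i _ => integrable_finsetSum _ fun j _ =>
      (hFI i j).mul_const _).restrict
  -- As `M` is orthogonal to `P' u`, only the integral over `I t` survives; its negative sign
  -- contradicts positivity of the multiplier.
  have h5 : frob (multiplier μ (force β h Q μ P P' s) t) (P' u) =
      ∫ r in I t, σ * frob (force β h Q μ P P' s r) (P' u) ∂μ := by
    rw [integral_const_mul, integral_frob_const fun i j => (hFI i j).restrict, ← zero_add (σ * _), ← hMD]
    simp only [frob, h3, add_mul, Finset.sum_add_distrib, Finset.mul_sum, mul_assoc]
  have h6 := frob_nonneg h4 (hd.posSemidef_deriv u)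
  rw [h5] at h6
  have h7 : 0 < ∫ r in I t, -(σ * frob (force β h Q μ P P' s r) (P' u)) ∂μ := by
    rw [setIntegral_pos_iff_support_of_nonneg_ae]
    · have : Function.support (fun r => -(σ * frob (force β h Q μ P P' s r) (P' u))) ∩ I t = I t :=
        inter_eq_right.mpr fun r hr => (neg_pos.mpr (h1 r hr)).ne'
      rw [this]
      exact (ENNReal.toReal_pos_iff.mp h2).1
    · filter_upwards [ae_restrict_mem (hS.measurableSet t)] with r hr
      exact (neg_pos.mpr (h1 r hr)).le
    · exact (hpI.const_mul σ).neg
  rw [integral_neg] at h7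
  linarith

end Force

/-! ### Excluding the atom. -/

section Atom

variable {m : ℕ} {Q : Matrix (Fin m) (Fin m) ℝ} {μ : Measure ℝ}
  {Φ P P' : ℝ → Matrix (Fin m) (Fin m) ℝ} {s : ℝ} {β : ℕ → Fin m → ℝ} {h : Fin m → ℝ}

lemma measureReal_singleton_eq_sub_leftLim [IsProbabilityMeasure μ] (h0 : ∀ᵐ r ∂μ, 0 ≤ r) (u : ℝ) :
    μ.real {u} = distFun μ u - Function.leftLim (distFun μ) u := by
  have h1 : distFun μ = ProbabilityTheory.cdf μ := funext (distFun_eq_cdf h0)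
  have h2 := (ProbabilityTheory.cdf μ).measure_singleton u
  rw [ProbabilityTheory.measure_cdf, ← h1] at h2
  rw [measureReal_def, h2, ENNReal.toReal_ofReal]
  exact sub_nonneg.mpr (monotone_distFun.leftLim_le le_rfl)

lemma continuousAt_distFun [IsProbabilityMeasure μ] (h0 : ∀ᵐ r ∂μ, 0 ≤ r) {u : ℝ}
    (hu : μ {u} = 0) : ContinuousAt (distFun μ) u := by
  have h1 := measureReal_singleton_eq_sub_leftLim h0 u
  rw [measureReal_def, hu, ENNReal.toReal_zero, eq_comm, sub_eq_zero] at h1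
  rw [continuousAt_iff_continuous_left'_right']
  refine ⟨?_, (continuousWithinAt_distFun h0 u).mono Ioi_subset_Ici_self⟩
  rw [ContinuousWithinAt, h1]
  exact monotone_distFun.tendsto_leftLim u

lemma tendsto_measureReal_Ioc [IsFiniteMeasure μ] (u : ℝ) :
    Tendsto (fun t => μ.real (Ioc u t)) (𝓝[>] u) (𝓝 0) := by
  have h1 := (tendsto_tail_right (integrable_const (μ := μ) (1 : ℝ)) u).const_sub (μ.real (Ioi u))
  simp only [setIntegral_const, smul_eq_mul, mul_one, sub_self] at h1
  refine h1.congr' ?_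
  filter_upwards [self_mem_nhdsWithin] with t ht
  rw [← Ioc_union_Ioi_eq_Ioi (le_of_lt (mem_Ioi.mp ht)), measureReal_union
    (Ioc_disjoint_Ioi le_rfl) measurableSet_Ioi]
  ring

lemma tendsto_measureReal_Ioo [IsFiniteMeasure μ] (u : ℝ) :
    Tendsto (fun t => μ.real (Ioo t u)) (𝓝[<] u) (𝓝 0) := by
  have h1 := (tendsto_tail_left (integrable_const (μ := μ) (1 : ℝ)) u).sub_const (μ.real (Ici u))
  simp only [setIntegral_const, smul_eq_mul, mul_one, sub_self] at h1
  refine h1.congr' ?_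
  filter_upwards [self_mem_nhdsWithin] with t ht
  rw [← Ioo_union_Ici_eq_Ioi ht, measureReal_union
    ((Iio_disjoint_Ici le_rfl).mono_left Ioo_subset_Iio_self) measurableSet_Ici]
  ring

lemma measureReal_pos_of_mem_support [IsFiniteMeasure μ] {U : Set ℝ} {r : ℝ}
    (hr : r ∈ μ.support) (hU : U ∈ 𝓝 r) : 0 < μ.real U :=
  ENNReal.toReal_pos ((Measure.mem_support_iff_forall r).mp hr U hU).ne' (measure_ne_top _ _)

/-- All difference quotients along `v` equal one. -/
lemma eq_one_of_hasDerivAt_of_eq_self {g : ℝ → ℝ} {g' u : ℝ} {v : ℕ → ℝ} (hg : HasDerivAt g g' u)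
    (hgu : g u = u) (hv : ∀ n, v n ≠ u) (hlim : Tendsto v atTop (𝓝 u)) (hgv : ∀ n, g (v n) = v n) :
    g' = 1 := by
  have h1 := hg.tendsto_slope.comp (tendsto_nhdsWithin_iff.mpr
    ⟨hlim, Eventually.of_forall fun n => hv n⟩)
  refine tendsto_nhds_unique h1 (tendsto_const_nhds.congr fun n => ?_)
  simp [slope_def_field, hgu, hgv, div_self (sub_ne_zero.mpr (hv n))]

theorem IsCSMinimizer.measure_singleton_eq_zero (hm : 1 ≤ m) (hβ : IsEvenMixture β)
    (hQ : IsConstraint Q) (hmin : IsCSMinimizer β h Q μ Φ) {u : ℝ} {v w : ℕ → ℝ}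
    (hv : ∀ n, v n < u) (hvs : ∀ n, v n ∈ μ.support) (hvu : Tendsto v atTop (𝓝 u))
    (hw : ∀ n, u < w n) (hws : ∀ n, w n ∈ μ.support) (hwu : Tendsto w atTop (𝓝 u)) :
    μ {u} = 0 := by
  obtain ⟨s, hs⟩ := exists_isCutoff hmin.1
  obtain ⟨P, P', hE⟩ := hmin.1.path.exists_extension hm
  have hd := hE.isPathData hQ hmin.1 hs
  have := hd.prob
  have hFI := fun i j => hd.integrable_force (h := h) hβ i j
  have hsupp : μ.support ⊆ Icc 0 s := Measure.support_subset_of_isClosed isClosed_Icc (by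
    filter_upwards [hd.nonneg, hd.le] with r h1 h2 using ⟨h1, h2⟩)
  have hu : u ∈ Ioo 0 s := ⟨(hsupp (hvs 0)).1.trans_lt (hv 0), (hw 0).trans_le (hsupp (hws 0)).2⟩
  have hu' : u ∈ Ico 0 s := ⟨hu.1.le, hu.2⟩
  have hus : u ∈ μ.support :=
    Measure.isClosed_support.mem_of_tendsto hwu (Eventually.of_forall hws)
  have htrace : ∀ r ∈ μ.support, (P r).trace = r := fun r hr => by
    rw [hE.eq r ⟨(hsupp hr).1, (hsupp hr).2.trans hs.2.1.le⟩, hmin.1.path.trace_eq r hr]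
  -- The trace constraint holds only on the support, but the support accumulates at `u`, which
  -- determines the derivative there.
  have hD1 : (P' u).trace = 1 := eq_one_of_hasDerivAt_of_eq_self (g := fun t => (P t).trace)
    (HasDerivAt.fun_sum fun i _ => (hd.isC11 i i).hasDerivAt u) (htrace u hus)
    (fun n => (hw n).ne') hwu fun n => htrace _ (hws n)
  have hD0 : P' u ≠ 0 := fun h0 => by simp [h0] at hD1
  have hcubic := frob_cubic_pos (hd.posDef_invHat u) (hd.posSemidef_deriv u) hD0
  by_contra hne
  have ha : 0 < μ.real {u} := ENNReal.toReal_pos hne (measure_ne_top _ _)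
  have hjump := measureReal_singleton_eq_sub_leftLim hd.nonneg u
  set F := force β h Q μ P P' s with hF
  set a := μ.real {u} with hadef
  have hpos : ∀ t, 0 ≤ t → (multiplier μ F t).PosSemidef := fun t ht =>
    hmin.posSemidef_multiplier hm hβ hQ hE hs ht
  have hzero : ∀ t ∈ Ico 0 s, frob (multiplier μ F t) (P' t) = 0 := fun t ht =>
    hmin.frob_multiplier_eq_zero hm hβ hQ hE hs ht
  -- This matrix is the left limit of the multiplier at `u`: the tail over the closed half-line
  -- includes the atom.
  have hIci : ∀ i j, (multiplier μ F u - a • F u) i j = -∫ r in Ici u, F r i j ∂μ := fun i j => by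
    rw [← Ioi_union_left, setIntegral_union (by simp) (measurableSet_singleton u)
      (hFI i j).integrableOn (hFI i j).integrableOn, integral_singleton]
    simp only [multiplier, Matrix.sub_apply, Matrix.of_apply, Matrix.smul_apply, smul_eq_mul, hadef]
    ring
  have hlim : Tendsto (multiplier μ F) (𝓝[<] u) (𝓝 (multiplier μ F u - a • F u)) := by
    refine tendsto_pi_nhds.mpr fun i => tendsto_pi_nhds.mpr fun j => ?_
    rw [hIci i j]
    exact (tendsto_tail_left (hFI i j) u).neg
  have hnear : ∀ᶠ t in 𝓝 u, t ∈ Ico 0 s := Ico_mem_nhds hu.1 hu.2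
  have hFu : (F u).IsHermitian := hd.isHermitian_force u
  have hM' : (multiplier μ F u - a • F u).PosSemidef := by
    refine posSemidef_iff_form.mpr ⟨(hpos u hu.1.le).1.sub ?_, fun x => ?_⟩
    · rw [isHermitian_iff_apply] at hFu ⊢
      intro i j; simp [hFu i j]
    · rw [← frob_vecMulVec]
      refine ge_of_tendsto (tendsto_frob hlim tendsto_const_nhds) ?_
      filter_upwards [nhdsWithin_le_nhds hnear] with t ht
      rw [frob_vecMulVec]
      exact (posSemidef_iff_form.mp (hpos t ht.1)).2 x
  have hM'D : frob (multiplier μ F u - a • F u) (P' u) = 0 := by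
    refine tendsto_nhds_unique (tendsto_frob hlim
      ((hd.continuous_deriv.tendsto u).mono_left nhdsWithin_le_nhds)) ?_
    refine tendsto_const_nhds.congr' ?_
    filter_upwards [nhdsWithin_le_nhds hnear] with t ht using (hzero t ht).symm
  have hMD := hzero u hu'
  -- The two one-sided limits of the multiplier are orthogonal to `P' u` and differ by `a • F u`.
  have hFD : frob (F u) (P' u) = 0 := by
    rw [frob_sub_left, hMD, frob_smul_left, zero_sub, neg_eq_zero] at hM'D
    exact (mul_eq_zero.mp hM'D).resolve_left ha.ne'
  have hright := hd.second_order_nonneg (h := h) hβ (isSide_right u) hu (a := a)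
    (hd.hasDerivWithinAt_invHat_right hu.2) (by
      filter_upwards [self_mem_nhdsWithin] with t ht
      obtain ⟨n, hn⟩ := (hwu.eventually (Iio_mem_nhds ht)).exists
      exact measureReal_pos_of_mem_support (hws n) (Ioc_mem_nhds (hw n) hn))
    (tendsto_measureReal_Ioc u) (M := multiplier μ F u) ha (hpos u hu.1.le)
    (by rwa [mul_one]) hMD hFD (by
      filter_upwards [self_mem_nhdsWithin] with t ht i j
      simp only [multiplier, Matrix.of_apply]
      rw [← Ioc_union_Ioi_eq_Ioi (le_of_lt (mem_Ioi.mp ht)), setIntegral_union (Ioc_disjoint_Ioi le_rfl)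
        measurableSet_Ioi (hFI i j).integrableOn (hFI i j).integrableOn]
      ring)
    (by filter_upwards [nhdsWithin_le_nhds hnear] with t ht using hpos t ht.1)
    (by filter_upwards [nhdsWithin_le_nhds hnear] with t ht using hzero t ht)
  -- The roles are exchanged: the base matrix is the left limit, and with `σ = -1` subtracting `(a *
  -- σ) • F u` leads back to the multiplier at `u`.
  have hleft := hd.second_order_nonneg (h := h) hβ (isSide_left u) hu (a := a)
    (hd.hasDerivWithinAt_invHat_left hu.2) (by
      filter_upwards [self_mem_nhdsWithin] with t ht
      obtain ⟨n, hn⟩ := (hvu.eventually (Ioi_mem_nhds ht)).exists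
      exact measureReal_pos_of_mem_support (hvs n) (Ioo_mem_nhds hn (hv n)))
    (tendsto_measureReal_Ioo u) (M := multiplier μ F u - a • F u) ha hM'
    (by
      rw [mul_neg, mul_one, neg_smul, sub_neg_eq_add, sub_add_cancel]
      exact hpos u hu.1.le) hM'D hFD (by
      filter_upwards [self_mem_nhdsWithin] with t ht i j
      rw [hIci i j]
      simp only [multiplier, Matrix.of_apply]
      rw [← Ioo_union_Ici_eq_Ioi ht, setIntegral_union
        ((Iio_disjoint_Ici le_rfl).mono_left Ioo_subset_Iio_self)
        measurableSet_Ici (hFI i j).integrableOn (hFI i j).integrableOn]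
      ring)
    (by filter_upwards [nhdsWithin_le_nhds hnear] with t ht using hpos t ht.1)
    (by filter_upwards [nhdsWithin_le_nhds hnear] with t ht using hzero t ht)
  -- `hright` and `hleft` bound the `ξ'''` term below by `2 x(u) K` and above by `2 x(u-) K`, where
  -- `K` is the positive quantity of `hcubic`; but `x(u) - x(u-) = a > 0`.
  nlinarith [mul_pos ha hcubic]

end Atom

end VectorSpin

theorem mainTheorem11 (m : ℕ) (hm : 1 ≤ m) (β : ℕ → Fin m → ℝ)
    (hβ : VectorSpin.IsEvenMixture β) (h : Fin m → ℝ)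
    (Q : Matrix (Fin m) (Fin m) ℝ) (hQ : VectorSpin.IsConstraint Q)
    (μ : Measure ℝ) (Φ : ℝ → Matrix (Fin m) (Fin m) ℝ)
    (hmin : VectorSpin.IsCSMinimizer β h Q μ Φ)
    (u₀ : ℝ) (um up : ℕ → ℝ)
    (hum : StrictMono um) (hum_supp : ∀ l, um l ∈ μ.support)
    (hum_lim : Tendsto um atTop (𝓝 u₀))
    (hup : StrictAnti up) (hup_supp : ∀ l, up l ∈ μ.support)
    (hup_lim : Tendsto up atTop (𝓝 u₀)) :
    ContinuousAt (VectorSpin.distFun μ) u₀ ∧ μ {u₀} = 0 := by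
  have hzero : μ {u₀} = 0 := hmin.measure_singleton_eq_zero hm hβ hQ
    (fun n => (hum n.lt_succ_self).trans_le (hum.monotone.ge_of_tendsto hum_lim _)) hum_supp hum_lim
    (fun n => (hup.antitone.le_of_tendsto hup_lim _).trans_lt (hup n.lt_succ_self)) hup_supp hup_lim
  have := hmin.1.prob
  refine ⟨VectorSpin.continuousAt_distFun ?_ hzero, hzero⟩
  exact (ae_iff.mpr hmin.1.concentrated : ∀ᵐ r ∂μ, r ∈ Icc (0 : ℝ) m).mono fun r hr => hr.1
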